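/- Let $\mathcal K$ be a complex Hilbert space of finite or infinite dimension. A state on $\mathcal K$ is a positive trace class operator of trace one. For states $\rho,\sigma$ let $\Pi_\rho,\Pi_\sigma$ be the orthogonal projections onto their supports and $\Pi^\perp=I-\Pi$. On the Hilbert space $\mathcal B_2(\mathcal K)$ of Hilbert–Schmidt operators let $S$ be the antilinear operator $S(X\sqrt\sigma+Y\Pi_\sigma^\perp)=\Pi_\sigma X^\dagger\sqrt\rho$ ($X$ bounded, $Y$ Hilbert–Schmidt), let $\Delta_{\rho,\sigma}=S^\dagger\overline S$ be the relative modular operator, and let $\xi$ be its spectral measure. For a convex or concave $f:(0,\infty)\to\mathbb R$ put $f(0)=\lim_{t\downarrow0}f(t)$, $f'(\infty)=\lim_{t\to\infty}f(t)/t$ and $$D_f(\rho\|\sigma)=\int_{(0,\infty)}f(\lambda)\,\langle\sqrt\sigma,\xi(d\lambda)\sqrt\sigma\rangle_2+f(0)\operatorname{tr}(\sigma\Pi_\rho^\perp)+f'(\infty)\operatorname{tr}(\rho\Pi_\sigma^\perp)\in[-\infty,\infty],\qquad 0\cdot(\pm\infty)=0.$$ Write $D$ for $f(t)=t\log t$;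 $V$ for $f(t)=|t-1|$; $\chi^2$ for $f(t)=(t-1)^2$; $\mathscr H^2$ for $f(t)=\frac12(\sqrt t-1)^2$, with $\mathscr H=\sqrt{\mathscr H^2}$ and $\mathscr H^4=(\mathscr H^2)^2$; $\mathscr H_\alpha$ for $f(t)=\frac{t^\alpha-1}{\alpha-1}$; and $D_\alpha=\frac1{\alpha-1}\log D_{t^\alpha}$, where $\log 0=-\infty$ and $\log\infty=\infty$ ($\alpha>0$, $\alpha\ne1$). Logarithms are natural except in (2) and in the first line of (7), where any base $b>1$ may be used, the same one in $D$ and on the other side. Conventions: $a/0=\infty$ for $a>0$, $\log\infty=\infty$, $0/0=0$, $\infty/\infty=0$ and $a/\infty=0$ for finite $a$. Then for all states $\rho,\sigma$ on $\mathcal K$, with $V=V(\rho\|\sigma)$, one has $0\le V\le2$, $0\le\mathscr H^2(\rho\|\sigma)\le1$, and 1. $\mathscr H^2(\rho\|\sigma)\le\frac12V\le\mathscr H(\rho\|\sigma)\sqrt{2-\mathscr H^2(\rho\|\sigma)}$; 2. $D(\rho\|\sigma)\le\log(1+\chi^2(\rho\|\sigma))$; 3. $\chi^2(\rho\|\sigma)\le(1+(\alpha-1)\mathscr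 H_\alpha(\rho\|\sigma))^{1/(\alpha-1)}-1$ for all $\alpha>2$; 4. $\chi^2(\rho\|\sigma)\ge V^2$ if $V\in[0,1]$, and $\chi^2(\rho\|\sigma)\ge\frac V{2-V}$ if $V\in(1,2]$; 5. $\frac{D(\rho\|\sigma)^2}{D(\sigma\|\rho)}\le\frac12\chi^2(\rho\|\sigma)$; $\;16\mathscr H^4(\rho\|\sigma)\le D(\rho\|\sigma)D(\sigma\|\rho)\le\frac14\chi^2(\rho\|\sigma)\chi^2(\sigma\|\rho)$; $\;8\mathscr H^2(\rho\|\sigma)\le D(\rho\|\sigma)+D(\sigma\|\rho)\le\frac12(\chi^2(\rho\|\sigma)+\chi^2(\sigma\|\rho))$; 6. $D(\rho\|\sigma)\le\frac12(V+\chi^2(\rho\|\sigma))$; 7. $D(\rho\|\sigma)+D(\sigma\|\rho)\ge V\log\frac{2+V}{2-V}$ and $\chi^2(\rho\|\sigma)+\chi^2(\sigma\|\rho)\ge\frac{8V^2}{4-V^2}$; 8. $\mathscr H_\alpha(\rho\|\sigma)\le D_\alpha(\rho\|\sigma)\le D(\rho\|\sigma)\le D_\beta(\rho\|\sigma)\le\mathscr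 H_\beta(\rho\|\sigma)$ for $0<\alpha<1<\beta<\infty$. 9. Moreover, let $f:(0,\infty)\to[0,\infty)$ be strictly convex with $f(1)=0$. Then there is a real-valued function $\psi_f$, depending only on $f$, with $\lim_{x\downarrow0}\psi_f(x)=0$ and $V(\rho\|\sigma)\le\psi_f(D_f(\rho\|\sigma))$ for all states $\rho,\sigma$ on every $\mathcal K$; and for all sequences of states $\rho_n,\sigma_n$ on $\mathcal K$, $D_f(\rho_n\|\sigma_n)\to0$ implies $V(\rho_n\|\sigma_n)\to0$. -/

import Mathlib

open Set Filter Topology MeasureTheory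
open scoped ENNReal InnerProductSpace

universe u

noncomputable section

namespace QuantumDiv

/-! ### Hilbert-Schmidt operators -/

section HilbertSchmidt

variable (K : Type u) [NormedAddCommGroup K] [InnerProductSpace ℂ K] [CompleteSpace K]

/-- The index set of a fixed orthonormal (Hilbert) basis of `K`. -/
def basisSet : Set K := (exists_hilbertBasis ℂ K).choose

/-- A fixed orthonormal basis of `K`, used to write traces. -/
def basis : HilbertBasis (basisSet K) ℂ K := (exists_hilbertBasis ℂ K).choose_spec.choose

variable {K} in
/-- `T` is Hilbert-Schmidt: `∑ i, ‖T bᵢ‖² = tr (T† T) < ∞`. -/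
def IsHS (T : K →L[ℂ] K) : Prop := Memℓp (fun i => T (basis K i)) 2

/-- The space of Hilbert-Schmidt operators on `K`, as a subspace of the bounded operators. -/
def hsSubmodule : Submodule ℂ (K →L[ℂ] K) where
  carrier := {T | IsHS T}
  zero_mem' := zero_memℓp (E := fun _ : basisSet K => K) (p := 2)
  add_mem' := fun {S T} hS hT => Memℓp.add hS hT
  smul_mem' := fun c T hT => Memℓp.const_smul hT c

/-- The Hilbert space `B₂(K)` of Hilbert-Schmidt operators (a type of its own, so that it carries
the Hilbert-Schmidt norm and not the operator norm). -/
def HS : Type u := hsSubmodule K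

instance : AddCommGroup (HS K) := inferInstanceAs (AddCommGroup (hsSubmodule K))

instance : Module ℂ (HS K) := inferInstanceAs (Module ℂ (hsSubmodule K))

variable {K}

/-- The bounded operator underlying a Hilbert-Schmidt operator. -/
def HS.op (T : HS K) : K →L[ℂ] K := Subtype.val T

variable (K) in
/-- The linear embedding `T ↦ (T bᵢ)ᵢ` of `B₂(K)` in the `K`-valued `ℓ²` space. -/
def HS.toL2 : HS K →ₗ[ℂ] lp (fun _ : basisSet K => K) 2 where
  toFun T := ⟨fun i => T.op (basis K i), T.2⟩
  map_add' _ _ := rfl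
  map_smul' _ _ := rfl

theorem HS.toL2_injective : Function.Injective (HS.toL2 K) := by
  intro S T h
  apply Subtype.ext
  refine ContinuousLinearMap.ext_on (s := Set.range (basis K)) ?_ ?_
  · have := (basis K).dense_span
    rw [← Submodule.dense_iff_topologicalClosure_eq_top] at this
    exact this
  · rintro _ ⟨i, rfl⟩
    exact congrFun (congrArg Subtype.val h) i

/-- The Hilbert-Schmidt inner product `⟨S, T⟩₂ = ∑ i, ⟨S bᵢ, T bᵢ⟩ = tr (S† T)`. -/
@[reducible] def HS.core : InnerProductSpace.Core ℂ (HS K) where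
  inner S T := ⟪HS.toL2 K S, HS.toL2 K T⟫_ℂ
  conj_inner_symm S T := inner_conj_symm _ _
  re_inner_nonneg S := inner_self_nonneg
  add_left S T R := by rw [map_add, inner_add_left]
  smul_left S T c := by rw [map_smul, inner_smul_left]
  definite S h := HS.toL2_injective (by simpa using inner_self_eq_zero.1 h)

instance : NormedAddCommGroup (HS K) :=
  letI := HS.core (K := K)
  InnerProductSpace.Core.toNormedAddCommGroup (𝕜 := ℂ)

instance : InnerProductSpace ℂ (HS K) := InnerProductSpace.ofCore (HS.core (K := K)).toCore

/-- The inner product of `B₂(K)` is `∑ i, ⟨S bᵢ, T bᵢ⟩`. -/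
theorem HS.inner_eq (S T : HS K) :
    ⟪S, T⟫_ℂ = ∑' i, ⟪S.op (basis K i), T.op (basis K i)⟫_ℂ :=
  lp.inner_eq_tsum (HS.toL2 K S) (HS.toL2 K T)

end HilbertSchmidt

/-! ### Spectral measures -/

section Spectral

variable (H : Type u) [NormedAddCommGroup H] [InnerProductSpace ℂ H]

/-- A projection-valued measure on the Borel sets of `ℝ`. -/
structure PVM where
  /-- The projection attached to a Borel set. -/
  proj : Set ℝ → (H →L[ℂ] H)
  isProj : ∀ B, MeasurableSet B → (proj B : H →ₗ[ℂ] H).IsSymmetricProjection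
  empty : proj ∅ = 0
  univ : proj Set.univ = 1
  iUnion : ∀ B : ℕ → Set ℝ, (∀ n, MeasurableSet (B n)) → Pairwise (Function.onFun Disjoint B) →
    ∀ x, HasSum (fun n => proj (B n) x) (proj (⋃ n, B n) x)

variable {H}

theorem PVM.re_nonneg (E : PVM H) (x : H) {B : Set ℝ} (hB : MeasurableSet B) :
    0 ≤ (⟪x, E.proj B x⟫_ℂ).re := by
  have h := E.isProj B hB
  have h1 : E.proj B (E.proj B x) = E.proj B x := by
    simpa using LinearMap.congr_fun h.isIdempotentElem x
  have h2 : ⟪E.proj B x, E.proj B x⟫_ℂ = ⟪x, E.proj B (E.proj B x)⟫_ℂ :=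
    h.isSymmetric x (E.proj B x)
  rw [h1] at h2
  rw [← h2]
  exact inner_self_nonneg (𝕜 := ℂ)

/-- The scalar measure `B ↦ ⟨x, E(B) x⟩`. -/
def PVM.measure (E : PVM H) (x : H) : Measure ℝ :=
  Measure.ofMeasurable (fun B _ => ENNReal.ofReal (⟪x, E.proj B x⟫_ℂ).re)
    (by simp [E.empty])
    (by
      intro B hB hd
      have h := (E.iUnion B hB hd x).mapL (innerSL ℂ x)
      have h' := Complex.hasSum_re h
      simp only [innerSL_apply_apply] at h'
      rw [← h'.tsum_eq, ENNReal.ofReal_tsum_of_nonneg (fun n => E.re_nonneg x (hB n)) h'.summable])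

/-- `E` is the spectral measure of the (possibly unbounded) operator with graph `G`, that is
`A = ∫ t dE(t)`: the domain of `A` is `{x | ∫ t² d⟨x, E(t) x⟩ < ∞}`, and for `x` in the domain
`⟨x, A x⟩ = ∫ t d⟨x, E(t) x⟩` and `‖A x‖² = ∫ t² d⟨x, E(t) x⟩`. -/
def PVM.Represents (E : PVM H) (G : Set (H × H)) : Prop :=
  (∀ x, (∃ y, (x, y) ∈ G) ↔ ∫⁻ t, ENNReal.ofReal (t ^ 2) ∂(E.measure x) < ∞) ∧
  ∀ x y, (x, y) ∈ G →
    ⟪x, y⟫_ℂ = ((∫ t, t ∂(E.measure x) : ℝ) : ℂ) ∧ ‖y‖ ^ 2 = ∫ t, t ^ 2 ∂(E.measure x)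

open Classical in
/-- The spectral measure of zero: the unit mass at `0`. -/
def PVM.atZero : PVM H where
  proj B := if (0 : ℝ) ∈ B then 1 else 0
  isProj B _ := by
    split_ifs
    · exact ⟨LinearMap.ext fun _ => rfl, fun _ _ => rfl⟩
    · exact ⟨by simp [IsIdempotentElem], fun _ _ => by simp⟩
  empty := by simp
  univ := by simp
  iUnion B _ hd x := by
    by_cases h : ∃ n, (0 : ℝ) ∈ B n
    · obtain ⟨n, hn⟩ := h
      have hU : (0 : ℝ) ∈ ⋃ n, B n := Set.mem_iUnion.2 ⟨n, hn⟩
      have := hasSum_ite_eq n x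
      convert this using 2 with m
      · by_cases hm : m = n
        · subst hm; simp [hn]
        · have : (0 : ℝ) ∉ B m := fun h0 => Set.disjoint_left.1 (hd hm) h0 hn
          simp [this, hm]
      · simp [hU]
    · have hU : (0 : ℝ) ∉ ⋃ n, B n := by simpa using h
      have h' : ∀ n, (0 : ℝ) ∉ B n := by simpa using h
      simp only [h', hU, if_false]
      simp

instance : Nonempty (PVM H) := ⟨PVM.atZero⟩

/-- The spectral measure of the self-adjoint operator with graph `G`. -/
def spectralMeasure (G : Set (H × H)) : PVM H := Classical.epsilon fun E => E.Represents G

end Spectral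

section States

/-- A state on `K`: a positive trace class operator of trace one. -/
structure State (K : Type u) [NormedAddCommGroup K] [InnerProductSpace ℂ K] [CompleteSpace K] where
  /-- The density operator. -/
  op : K →L[ℂ] K
  isPositive : op.IsPositive
  hasSum_trace : HasSum (fun i => ⟪basis K i, op (basis K i)⟫_ℂ) 1

variable {K : Type u} [NormedAddCommGroup K] [InnerProductSpace ℂ K] [CompleteSpace K]

/-- The trace of a trace class operator. -/
def trace (T : K →L[ℂ] K) : ℂ := ∑' i, ⟪basis K i, T (basis K i)⟫_ℂ

/-- The positive square root of a state, as a bounded operator. -/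
def State.sqrtOp (ρ : State K) : K →L[ℂ] K := CFC.sqrt ρ.op

/-- The orthogonal projection onto the support `(ker ρ)ᗮ` of a state. -/
def State.supp (ρ : State K) : K →L[ℂ] K := (LinearMap.ker ρ.op.toLinearMap)ᗮ.starProjection

theorem State.norm_sqrtOp_sq (ρ : State K) (x : K) :
    ‖ρ.sqrtOp x‖ ^ 2 = (⟪x, ρ.op x⟫_ℂ).re := by
  have h0 : 0 ≤ ρ.op := (ContinuousLinearMap.nonneg_iff_isPositive _).2 ρ.isPositive
  have hs : 0 ≤ CFC.sqrt ρ.op := CFC.sqrt_nonneg _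
  have hp := (ContinuousLinearMap.nonneg_iff_isPositive _).1 hs
  have hm : CFC.sqrt ρ.op (CFC.sqrt ρ.op x) = ρ.op x := by
    have := CFC.sqrt_mul_sqrt_self ρ.op h0
    exact DFunLike.congr_fun this x
  have h2 : ⟪CFC.sqrt ρ.op x, CFC.sqrt ρ.op x⟫_ℂ = ⟪x, CFC.sqrt ρ.op (CFC.sqrt ρ.op x)⟫_ℂ :=
    hp.isSymmetric x _
  rw [hm] at h2
  rw [← h2, State.sqrtOp]
  exact (inner_self_eq_norm_sq (𝕜 := ℂ) _).symm

/-- The square root of a state, as a vector of `B₂(K)`. -/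
def State.sqrtHS (ρ : State K) : HS K :=
  ⟨ρ.sqrtOp, by
    have h := Complex.hasSum_re ρ.hasSum_trace
    refine (memℓp_gen_iff (by norm_num)).2 ?_
    refine h.summable.congr fun i => ?_
    rw [← ρ.norm_sqrtOp_sq]
    norm_num⟩

/-! ### The relative modular operator -/

/-- The graph of the antilinear operator `S`, with domain `{X √σ + Y (1 - Π_σ)}`, `X` bounded and
`Y` Hilbert-Schmidt, and `S (X √σ + Y (1 - Π_σ)) = Π_σ X† √ρ`. -/
def graphS (ρ σ : State K) : Set (HS K × HS K) :=
  {p | ∃ (X : K →L[ℂ] K) (Y : HS K),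
    p.1.op = X * σ.sqrtOp + Y.op * (1 - σ.supp) ∧
    p.2.op = σ.supp * ContinuousLinearMap.adjoint X * ρ.sqrtOp}

/-- The graph of the adjoint `S†` of the antilinear operator `S`:
`⟨a, S b⟩₂` is the conjugate of `⟨S† a, b⟩₂` for all `b` in the domain of `S`. -/
def graphSAdj (ρ σ : State K) : Set (HS K × HS K) :=
  {p | ∀ q ∈ graphS ρ σ, ⟪p.1, q.2⟫_ℂ = starRingEnd ℂ ⟪p.2, q.1⟫_ℂ}

/-- The graph of the relative modular operator `Δ_{ρ,σ} = S† S̄`, where `S̄` is the closure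
of `S`. -/
def modularGraph (ρ σ : State K) : Set (HS K × HS K) :=
  {p | ∃ z : HS K, (p.1, z) ∈ closure (graphS ρ σ) ∧ (z, p.2) ∈ graphSAdj ρ σ}

/-- The measure `⟨√σ, ξ(dλ) √σ⟩₂`, where `ξ` is the spectral measure of `Δ_{ρ,σ}`. -/
def modularMeasure (ρ σ : State K) : Measure ℝ :=
  (spectralMeasure (modularGraph ρ σ)).measure σ.sqrtHS

/-! ### Quantum `f`-divergences -/

/-- `f(0) = lim_{t ↓ 0} f(t)`, in `[-∞, ∞]`. -/
def limZero (f : ℝ → ℝ) : EReal := limUnder (𝓝[>] (0 : ℝ)) fun t => (f t : EReal)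

/-- `f'(∞) = lim_{t → ∞} f(t) / t`, in `[-∞, ∞]`. -/
def slopeInfty (f : ℝ → ℝ) : EReal := limUnder atTop fun t : ℝ => ((f t / t : ℝ) : EReal)

/-- The integral of `f` in `[-∞, ∞]`: that of the positive part minus that of the negative part. -/
def extIntegral (μ : Measure ℝ) (f : ℝ → ℝ) : EReal :=
  ((∫⁻ t, ENNReal.ofReal (f t) ∂μ : ℝ≥0∞) : EReal)
    - ((∫⁻ t, ENNReal.ofReal (-f t) ∂μ : ℝ≥0∞) : EReal)

/-- The quantum `f`-divergence `D_f(ρ‖σ)` for a convex or concave `f` on `(0, ∞)`; the values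
of `f` outside `(0, ∞)` play no role. -/
def fDiv (f : ℝ → ℝ) (ρ σ : State K) : EReal :=
  extIntegral ((modularMeasure ρ σ).restrict (Ioi 0)) f
    + limZero f * ((trace (σ.op * (1 - ρ.supp))).re : EReal)
    + slopeInfty f * ((trace (ρ.op * (1 - σ.supp))).re : EReal)

/-- The logarithm to base `b`, extended to `[0, ∞]` by `log 0 = -∞` and `log ∞ = ∞`. -/
def extLog (b : ℝ) (x : EReal) : EReal := (((Real.log b)⁻¹ : ℝ) : EReal) * ENNReal.log x.toENNReal

/-- Umegaki relative entropy, logarithm to base `b`. -/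
def umegakiBase (b : ℝ) (ρ σ : State K) : EReal := fDiv (fun t => t * Real.logb b t) ρ σ

/-- Umegaki relative entropy, natural logarithm. -/
def umegaki (ρ σ : State K) : EReal := fDiv (fun t => t * Real.log t) ρ σ

/-- Petz-Rényi `α`-relative entropy, natural logarithm. -/
def petzRenyi (α : ℝ) (ρ σ : State K) : EReal :=
  (((α - 1)⁻¹ : ℝ) : EReal) * ENNReal.log (fDiv (fun t => t ^ α) ρ σ).toENNReal

/-- Quantum Hellinger `α`-divergence. -/
def hellingerAlpha (α : ℝ) (ρ σ : State K) : EReal := fDiv (fun t => (t ^ α - 1) / (α - 1)) ρ σ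

/-- Quantum squared Hellinger distance. -/
def hellingerSq (ρ σ : State K) : EReal := fDiv (fun t => 1 / 2 * (√t - 1) ^ 2) ρ σ

/-- Quantum total variation. -/
def totalVar (ρ σ : State K) : EReal := fDiv (fun t => |t - 1|) ρ σ

/-- Quantum `χ²`-divergence. -/
def chiSq (ρ σ : State K) : EReal := fDiv (fun t => (t - 1) ^ 2) ρ σ

end States

end QuantumDiv

end

open QuantumDiv

/-! The problem is classical in disguise. A state is compact, so `ρ` and `σ` have orthonormal
eigenbases `ρ uᵢ = rᵢ uᵢ` and `σ vⱼ = sⱼ vⱼ`. The rank-one operators `|uᵢ⟩⟨vⱼ|` form an orthonormal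
basis of `B₂(K)`, and the closure of `S` carries each of them to `√(rᵢ / sⱼ) |vⱼ⟩⟨uᵢ|`, or to `0`
when `sⱼ = 0`. Hence the relative modular operator is diagonal there with eigenvalues `rᵢ / sⱼ`
(`mem_modularGraph_iff`), and `√σ` has coefficients `√sⱼ ⟨uᵢ, vⱼ⟩`. Every quantum divergence is
therefore the classical one of the Nussbaum-Szkoła weights `p = rᵢ |⟨uᵢ, vⱼ⟩|²` and `q = sⱼ |⟨uᵢ,
vⱼ⟩|²`, with `q {p = 0}` and `p {q = 0}` as the two boundary traces; exchanging the states exchanges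
`p` and `q` (`exists_classical`).

On the classical side a multiple of `t - 1` may be subtracted from `f` without changing the
divergence of two probability distributions. After this the integrand is nonnegative and the
divergence is one sum in `[0, ∞]` (`cDiv_eq_nDiv`), so each one is either `⊤` or given by a
convergent series together with `q = 0 → p = 0`.

The finite inequalities are sums of pointwise ones. Some are quadratic in a free parameter `c`, and
nonnegativity for every `c` bounds the discriminant, as in Cauchy-Schwarz (`kl_chi_one_var` and
`kl_hellinger_one_var`, where the second derivative in `t` is a perfect square). The others are
tangent bounds for a convex or concave function, taken at the point where the extremal pair lives
(`chi_tangent`, `sub_mul_log_ge`, `chi_add_chi_ge`) or at a mean value, which gives Jensen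
(`kl_le_log_two_var`, `IsPair.chi_rpow_le`, `IsPair.exp_kl_le_rpow`).

For strictly convex `f` with minimum `f 1 = 0`, convexity along rays from `1` gives `f t ≥ m (|t -
1| - ε)` with `m > 0` depending only on `f` and `ε`. Summation yields `m V ≤ D_f + m ε`, uniformly
in the states and in the space. -/

namespace QuantumDiv

/-! ### Spectral measures on eigenvectors -/

section Spectral

variable {H : Type u} [NormedAddCommGroup H] [InnerProductSpace ℂ H]

theorem PVM.measure_apply (E : PVM H) (x : H) {B : Set ℝ} (hB : MeasurableSet B) :
    E.measure x B = ENNReal.ofReal (⟪x, E.proj B x⟫_ℂ).re :=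
  Measure.ofMeasurable_apply B hB

theorem PVM.symm_apply (E : PVM H) {B : Set ℝ} (hB : MeasurableSet B) (x y : H) :
    ⟪E.proj B x, y⟫_ℂ = ⟪x, E.proj B y⟫_ℂ :=
  (E.isProj B hB).isSymmetric x y

theorem PVM.proj_proj (E : PVM H) {B : Set ℝ} (hB : MeasurableSet B) (x : H) :
    E.proj B (E.proj B x) = E.proj B x := by
  simpa using LinearMap.congr_fun (E.isProj B hB).isIdempotentElem x

theorem PVM.re_inner_proj (E : PVM H) {B : Set ℝ} (hB : MeasurableSet B) (x : H) :
    (⟪x, E.proj B x⟫_ℂ).re = ‖E.proj B x‖ ^ 2 := by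
  rw [← E.proj_proj hB x, ← E.symm_apply hB, E.proj_proj hB x]
  exact inner_self_eq_norm_sq (𝕜 := ℂ) _

theorem PVM.measure_apply_norm (E : PVM H) (x : H) {B : Set ℝ} (hB : MeasurableSet B) :
    E.measure x B = ENNReal.ofReal (‖E.proj B x‖ ^ 2) := by
  rw [E.measure_apply x hB, E.re_inner_proj hB]

theorem PVM.measure_univ (E : PVM H) (x : H) : E.measure x Set.univ = ENNReal.ofReal (‖x‖ ^ 2) := by
  rw [E.measure_apply_norm x MeasurableSet.univ, E.univ]
  rfl

instance (E : PVM H) (x : H) : IsFiniteMeasure (E.measure x) :=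
  ⟨by rw [E.measure_univ]; exact ENNReal.ofReal_lt_top⟩

/-- The scalar spectral measure of an eigenvector is concentrated at the eigenvalue. -/
theorem PVM.Represents.measure_compl_singleton {E : PVM H} {G : Set (H × H)}
    (hE : E.Represents G) {e : H} {l : ℝ} (he : (e, (l : ℂ) • e) ∈ G) :
    E.measure e {l}ᶜ = 0 := by
  have hdom := (hE.1 e).1 ⟨_, he⟩
  obtain ⟨h1, h2⟩ := hE.2 _ _ he
  have hsq : Integrable (fun t : ℝ => t ^ 2) (E.measure e) := by
    refine ⟨by fun_prop, ?_⟩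
    rw [hasFiniteIntegral_iff_ofReal (Eventually.of_forall fun t => sq_nonneg t)]
    exact hdom
  have hid : Integrable (fun t : ℝ => t) (E.measure e) := by
    refine (hsq.add (integrable_const (1 : ℝ))).mono' (by fun_prop) (Eventually.of_forall fun t => ?_)
    simp only [Pi.add_apply, Real.norm_eq_abs]
    nlinarith [sq_abs t, sq_nonneg (|t| - 1), abs_nonneg t]
  have h1' : ∫ t, t ∂(E.measure e) = l * ‖e‖ ^ 2 := by
    rw [inner_smul_right, inner_self_eq_norm_sq_to_K] at h1
    exact Complex.ofReal_injective (by rw [← h1]; push_cast; rfl)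
  have h2' : ∫ t, t ^ 2 ∂(E.measure e) = l ^ 2 * ‖e‖ ^ 2 := by
    rw [← h2, norm_smul, mul_pow]
    simp
  have hu : (E.measure e).real Set.univ = ‖e‖ ^ 2 := by
    rw [Measure.real, E.measure_univ, ENNReal.toReal_ofReal (by positivity)]
  -- The variance about the eigenvalue vanishes: the first two moments are `l ‖e‖²` and `l² ‖e‖²`,
  -- and the mass is `‖e‖²`.
  have hint : ∫ t, (t - l) ^ 2 ∂(E.measure e) = 0 := by
    have : (fun t : ℝ => (t - l) ^ 2) = fun t => (t ^ 2 - 2 * l * t) + l ^ 2 := by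
      ext t; ring
    rw [this, integral_add (f := fun t => t ^ 2 - 2 * l * t) (hsq.sub (hid.const_mul _))
      (integrable_const _), integral_sub hsq (hid.const_mul _), integral_const_mul, h1', h2', integral_const, hu]
    simp only [smul_eq_mul]
    ring
  have hsq' : Integrable (fun t : ℝ => (t - l) ^ 2) (E.measure e) := by
    have : (fun t : ℝ => (t - l) ^ 2) = fun t => (t ^ 2 - 2 * l * t) + l ^ 2 := by
      ext t; ring
    rw [this]
    exact (hsq.sub (hid.const_mul _)).add (integrable_const _)
  have hae := (integral_eq_zero_iff_of_nonneg (fun t => sq_nonneg (t - l)) hsq').1 hint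
  rw [Filter.EventuallyEq, ae_iff] at hae
  refine measure_mono_null (fun t ht => ?_) hae
  simpa [sub_eq_zero] using ht

open Classical in
-- `Represents` prescribes only domains and scalar moments. On an eigenvector this already
-- determines every projection, because the scalar measure is a point mass; no general uniqueness
-- theorem for spectral measures is needed.
theorem PVM.Represents.proj_eigenvector {E : PVM H} {G : Set (H × H)}
    (hE : E.Represents G) {e : H} {l : ℝ} (he : (e, (l : ℂ) • e) ∈ G) {B : Set ℝ}
    (hB : MeasurableSet B) : E.proj B e = if l ∈ B then e else 0 := by
  have h0 := hE.measure_compl_singleton he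
  have key : ∀ C : Set ℝ, MeasurableSet C → l ∉ C → ‖E.proj C e‖ ^ 2 = 0 := by
    intro C hC hl
    have : E.measure e C = 0 := measure_mono_null (fun t ht => by
      rintro rfl; exact hl ht) h0
    rw [E.measure_apply_norm e hC, ENNReal.ofReal_eq_zero] at this
    exact le_antisymm this (sq_nonneg _)
  split_ifs with hl
  · have hsum : ‖E.proj B e‖ ^ 2 = ‖e‖ ^ 2 := by
      have h1 : E.measure e Bᶜ = 0 := measure_mono_null (fun t ht => by
        rintro rfl; exact ht hl) h0
      have h2 := measure_add_measure_compl (μ := E.measure e) hB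
      rw [h1, add_zero, E.measure_univ, E.measure_apply_norm e hB,
        ENNReal.ofReal_eq_ofReal_iff (by positivity) (by positivity)] at h2
      exact h2
    have h3 : ‖e - E.proj B e‖ ^ 2 = 0 := by
      rw [@norm_sub_sq ℂ, hsum]
      have := E.re_inner_proj hB e
      simp only [RCLike.re_to_complex, this, hsum]
      ring
    rw [sq_eq_zero_iff, norm_eq_zero, sub_eq_zero] at h3
    exact h3.symm
  · simpa using key B hB hl

/-! ### Operators diagonal in an orthonormal basis -/

variable {Ω : Type*} (e : HilbertBasis Ω ℂ H) (l : Ω → ℝ)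

/-- The weighted point masses `∑ ω, |⟨e ω, x⟩|² δ (l ω)`. -/
noncomputable def diagMeasure (x : H) : Measure ℝ :=
  Measure.sum fun ω => ENNReal.ofReal (‖⟪e ω, x⟫_ℂ‖ ^ 2) • Measure.dirac (l ω)

theorem hasSum_norm_inner_sq (x : H) : HasSum (fun ω => ‖⟪e ω, x⟫_ℂ‖ ^ 2) (‖x‖ ^ 2) := by
  have h := Complex.hasSum_re (e.hasSum_inner_mul_inner x x)
  rw [← RCLike.re_to_complex, inner_self_eq_norm_sq (𝕜 := ℂ)] at h
  refine h.congr_fun ?_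
  intro ω
  rw [← inner_conj_symm x (e ω), ← Complex.normSq_eq_conj_mul_self, Complex.ofReal_re,
    Complex.normSq_eq_norm_sq]

open Classical in
-- Parseval for `E(B) x`, whose coefficient at `e ω` is `⟨E(B) e ω, x⟩` by self-adjointness of the
-- projection.
theorem PVM.measure_eq_diagMeasure (E : PVM H)
    (h : ∀ ω B, MeasurableSet B → E.proj B (e ω) = if l ω ∈ B then e ω else 0) (x : H) :
    E.measure x = diagMeasure e l x := by
  ext B hB
  rw [E.measure_apply_norm x hB, diagMeasure, Measure.sum_apply _ hB,
    ← (hasSum_norm_inner_sq e (E.proj B x)).tsum_eq, ENNReal.ofReal_tsum_of_nonneg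
      (fun _ => by positivity) (hasSum_norm_inner_sq e _).summable]
  congr 1
  ext ω
  rw [← E.symm_apply hB, h ω B hB, Measure.smul_apply, Measure.dirac_apply' _ hB]
  by_cases hl : l ω ∈ B <;> simp [hl]

/-- The range of the diagonal projection attached to a set of eigenvalues. -/
noncomputable def diagSpace (B : Set ℝ) : Submodule ℂ H :=
  (Submodule.span ℂ (e '' {ω | l ω ∉ B}))ᗮ

instance [CompleteSpace H] (B : Set ℝ) : (diagSpace e l B).HasOrthogonalProjection := by
  unfold diagSpace; infer_instance

open Classical in
theorem diagSpace_starProjection [CompleteSpace H] (B : Set ℝ) (ω : Ω) :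
    (diagSpace e l B).starProjection (e ω) = if l ω ∈ B then e ω else 0 := by
  split_ifs with h
  · refine Submodule.starProjection_eq_self_iff.2 ?_
    rw [diagSpace, Submodule.mem_orthogonal]
    intro y hy
    induction hy using Submodule.span_induction with
    | mem y hy =>
      obtain ⟨ω', h', rfl⟩ := hy
      exact e.orthonormal.2 (fun heq => h' (heq ▸ h))
    | zero => simp
    | add y z _ _ hy hz => rw [inner_add_left, hy, hz, add_zero]
    | smul c y _ hy => rw [inner_smul_left, hy, mul_zero]
  · rw [Submodule.starProjection_apply_eq_zero_iff]
    exact Submodule.le_orthogonal_orthogonal _ (Submodule.subset_span ⟨ω, h, rfl⟩)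

open Classical in
theorem inner_diagSpace_starProjection [CompleteSpace H] (B : Set ℝ) (ω : Ω) (x : H) :
    ⟪e ω, (diagSpace e l B).starProjection x⟫_ℂ = if l ω ∈ B then ⟪e ω, x⟫_ℂ else 0 := by
  rw [← Submodule.inner_starProjection_left_eq_right, diagSpace_starProjection]
  split_ifs <;> simp

theorem hilbertBasis_ext {x y : H} (h : ∀ ω, ⟪e ω, x⟫_ℂ = ⟪e ω, y⟫_ℂ) : x = y := by
  apply e.repr.injective
  ext ω
  simp only [e.repr_apply_apply, h]

open Classical in
theorem hasSum_diagSpace_starProjection [CompleteSpace H] (B : Set ℝ) (x : H) :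
    HasSum (fun ω => if l ω ∈ B then ⟪e ω, x⟫_ℂ • e ω else 0)
      ((diagSpace e l B).starProjection x) := by
  have := e.hasSum_repr ((diagSpace e l B).starProjection x)
  refine this.congr_fun fun ω => ?_
  rw [e.repr_apply_apply, inner_diagSpace_starProjection]
  split_ifs <;> simp

open Classical in
/-- The projection-valued measure of the operator which is diagonal in the basis `e`, with
eigenvalues `l`. -/
noncomputable def diagPVM [CompleteSpace H] : PVM H where
  proj B := (diagSpace e l B).starProjection
  isProj B _ := ⟨by
      have := (diagSpace e l B).isIdempotentElem_starProjection
      ext x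
      exact congrArg (fun T : H →L[ℂ] H => T x) this,
    fun x y => Submodule.inner_starProjection_left_eq_right _ x y⟩
  empty := by
    ext x
    refine hilbertBasis_ext e fun ω => ?_
    simp [inner_diagSpace_starProjection]
  univ := by
    ext x
    refine hilbertBasis_ext e fun ω => ?_
    simp [inner_diagSpace_starProjection]
  iUnion B _ hd x := by
    have hU := hasSum_diagSpace_starProjection e l (⋃ n, B n) x
    let g : Ω → H := fun ω => if l ω ∈ ⋃ n, B n then ⟪e ω, x⟫_ℂ • e ω else 0
    let F : ℕ × Ω → H := fun z => if l z.2 ∈ B z.1 then ⟪e z.2, x⟫_ℂ • e z.2 else 0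
    let S : Set (ℕ × Ω) := {z | l z.2 ∈ B z.1}
    -- Disjointness leaves at most one `n` for each `ω`. The expansion over `Ω` can thus be
    -- reindexed over `ℕ × Ω` and then summed fibre by fibre, which is countable additivity.
    have hinj : Function.Injective (fun z : S => z.1.2) := by
      rintro ⟨⟨n, ω⟩, hz⟩ ⟨⟨m, ω'⟩, hz'⟩ h
      obtain rfl : ω = ω' := h
      have : n = m := by
        by_contra hnm
        exact Set.disjoint_left.1 (hd hnm) hz hz'
      subst this
      rfl
    have h1 : HasSum (g ∘ fun z : S => z.1.2) ((diagSpace e l (⋃ n, B n)).starProjection x) := by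
      refine (hinj.hasSum_iff fun ω hω => ?_).2 hU
      simp only [ite_eq_right_iff, g]
      intro hl
      obtain ⟨n, hn⟩ := Set.mem_iUnion.1 hl
      exact (hω ⟨⟨(n, ω), hn⟩, rfl⟩).elim
    have h2 : HasSum F ((diagSpace e l (⋃ n, B n)).starProjection x) := by
      have h3 : Function.support F ⊆ S := fun z hz => by
        by_contra hzS
        exact hz (if_neg hzS)
      rw [← hasSum_subtype_iff_of_support_subset h3]
      refine h1.congr_fun fun z => ?_
      have hz : l z.1.2 ∈ B z.1.1 := z.2
      have hz' : l z.1.2 ∈ ⋃ n, B n := Set.mem_iUnion.2 ⟨_, hz⟩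
      simp only [Function.comp, F, g, if_pos hz, if_pos hz']
    exact h2.prod_fiberwise fun n => hasSum_diagSpace_starProjection e l (B n) x

theorem lintegral_diagMeasure (x : H) (f : ℝ → ℝ≥0∞) :
    ∫⁻ t, f t ∂(diagMeasure e l x) = ∑' ω, ENNReal.ofReal (‖⟪e ω, x⟫_ℂ‖ ^ 2) * f (l ω) := by
  simp [diagMeasure, lintegral_sum_measure, lintegral_smul_measure]

theorem hasSum_integral_diagMeasure (x : H) {f : ℝ → ℝ} (hf : Integrable f (diagMeasure e l x)) :
    HasSum (fun ω => ‖⟪e ω, x⟫_ℂ‖ ^ 2 * f (l ω)) (∫ t, f t ∂(diagMeasure e l x)) := by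
  refine (hasSum_integral_measure hf).congr_fun fun ω => ?_
  simp [integral_smul_measure]

theorem diagPVM_measure [CompleteSpace H] (x : H) : (diagPVM e l).measure x = diagMeasure e l x := by
  classical
  refine PVM.measure_eq_diagMeasure e l _ (fun ω B _ => ?_) x
  exact diagSpace_starProjection e l B ω

theorem diagPVM_represents [CompleteSpace H] {G : Set (H × H)}
    (hG : ∀ x y, (x, y) ∈ G ↔ ∀ ω, ⟪e ω, y⟫_ℂ = (l ω : ℂ) * ⟪e ω, x⟫_ℂ) :
    (diagPVM e l).Represents G := by
  have hnorm : ∀ x y, (x, y) ∈ G →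
      HasSum (fun ω => ‖⟪e ω, x⟫_ℂ‖ ^ 2 * l ω ^ 2) (‖y‖ ^ 2) := by
    intro x y hxy
    refine (hasSum_norm_inner_sq e y).congr_fun fun ω => ?_
    rw [(hG x y).1 hxy ω, norm_mul, mul_pow, mul_comm]
    simp
  have hlin : ∀ x, ∫⁻ t, ENNReal.ofReal (t ^ 2) ∂(diagMeasure e l x) =
      ∑' ω, ENNReal.ofReal (‖⟪e ω, x⟫_ℂ‖ ^ 2 * l ω ^ 2) := fun x => by
    rw [lintegral_diagMeasure]
    congr 1
    ext ω
    rw [ENNReal.ofReal_mul (by positivity)]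
  have hfin : ∀ x y, (x, y) ∈ G → ∫⁻ t, ENNReal.ofReal (t ^ 2) ∂(diagMeasure e l x) < ∞ := by
    intro x y hxy
    rw [hlin, ← ENNReal.ofReal_tsum_of_nonneg (fun _ => by positivity) (hnorm x y hxy).summable]
    exact ENNReal.ofReal_lt_top
  refine ⟨fun x => ⟨fun ⟨y, hy⟩ => ?_, fun hx => ?_⟩, fun x y hxy => ?_⟩
  · rw [diagPVM_measure]
    exact hfin x y hy
  · rw [diagPVM_measure, hlin] at hx
    have hs : Summable fun ω => ‖⟪e ω, x⟫_ℂ‖ ^ 2 * l ω ^ 2 := by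
      have := ENNReal.summable_toReal hx.ne
      refine this.congr fun ω => ?_
      rw [ENNReal.toReal_ofReal (by positivity)]
    -- A finite second moment says exactly that the coefficients expected of the image of `x` are
    -- square summable.
    have hm : Memℓp (fun ω => (l ω : ℂ) * ⟪e ω, x⟫_ℂ) 2 := by
      refine (memℓp_gen_iff (by norm_num)).2 (hs.congr fun ω => ?_)
      norm_num
      rw [mul_pow, mul_comm, sq_abs]
    refine ⟨e.repr.symm ⟨_, hm⟩, (hG _ _).2 fun ω => ?_⟩
    rw [← e.repr_apply_apply, LinearIsometryEquiv.apply_symm_apply]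
  · rw [diagPVM_measure]
    have hf := hfin x y hxy
    have hsq : Integrable (fun t : ℝ => t ^ 2) (diagMeasure e l x) := by
      refine ⟨by fun_prop, ?_⟩
      rw [hasFiniteIntegral_iff_ofReal (Eventually.of_forall fun t => sq_nonneg t)]
      exact hf
    have : IsFiniteMeasure (diagMeasure e l x) := by
      rw [← diagPVM_measure]; infer_instance
    have hid : Integrable (fun t : ℝ => t) (diagMeasure e l x) := by
      refine (hsq.add (integrable_const (1 : ℝ))).mono' (by fun_prop)
        (Eventually.of_forall fun t => ?_)
      simp only [Pi.add_apply, Real.norm_eq_abs]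
      nlinarith [sq_abs t, sq_nonneg (|t| - 1), abs_nonneg t]
    constructor
    · have h1 := Complex.hasSum_ofReal.2 (hasSum_integral_diagMeasure e l x hid)
      refine (e.hasSum_inner_mul_inner x y).unique (h1.congr_fun fun ω => ?_)
      rw [(hG x y).1 hxy ω, ← inner_conj_symm x (e ω)]
      push_cast
      rw [← Complex.conj_mul']
      ring
    · exact (hnorm x y hxy).unique (hasSum_integral_diagMeasure e l x hsq)

/-- The scalar spectral measures of an operator with an orthonormal basis of eigenvectors. -/
theorem spectralMeasure_measure [CompleteSpace H] {G : Set (H × H)}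
    (hG : ∀ x y, (x, y) ∈ G ↔ ∀ ω, ⟪e ω, y⟫_ℂ = (l ω : ℂ) * ⟪e ω, x⟫_ℂ) (x : H) :
    (spectralMeasure G).measure x = diagMeasure e l x := by
  classical
  -- The measure is an arbitrary choice; `diagPVM` shows that the choice is not vacuous, and the
  -- eigenvectors then pin it down.
  have hE : (spectralMeasure G).Represents G :=
    Classical.epsilon_spec (p := fun E : PVM H => E.Represents G) ⟨_, diagPVM_represents e l hG⟩
  refine PVM.measure_eq_diagMeasure e l _ (fun ω B hB => ?_) x
  refine hE.proj_eigenvector ((hG _ _).2 fun ω' => ?_) hB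
  rw [inner_smul_right]
  by_cases h : ω' = ω
  · rw [h]
  · rw [e.orthonormal.2 h]
    simp

end Spectral

/-! ### The Hilbert space of Hilbert-Schmidt operators and its rank-one bases -/

section HilbertSchmidt

theorem eq_of_hilbertBasis {E F : Type*} [NormedAddCommGroup E] [InnerProductSpace ℂ E]
    [NormedAddCommGroup F] [NormedSpace ℂ F] {ι : Type*} (u : HilbertBasis ι ℂ E) {S T : E →L[ℂ] F}
    (h : ∀ i, S (u i) = T (u i)) : S = T := by
  refine ContinuousLinearMap.ext_on (s := Set.range u) ?_ ?_
  · have := u.dense_span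
    rwa [← Submodule.dense_iff_topologicalClosure_eq_top] at this
  · rintro _ ⟨i, rfl⟩
    exact h i

variable {K : Type u} [NormedAddCommGroup K] [InnerProductSpace ℂ K] [CompleteSpace K]

theorem HS.ext_op {S T : HS K} (h : S.op = T.op) : S = T := Subtype.ext h

theorem HS.add_op (S T : HS K) : (S + T).op = S.op + T.op := rfl

theorem HS.smul_op (c : ℂ) (T : HS K) : (c • T).op = c • T.op := rfl

theorem HS.zero_op : (0 : HS K).op = 0 := rfl

/-- The embedding of `B₂(K)` in the `K`-valued `ℓ²` space is isometric. -/
noncomputable def HS.isometry : HS K →ₗᵢ[ℂ] lp (fun _ : basisSet K => K) 2 :=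
  (HS.toL2 K).isometryOfInner fun _ _ => rfl

theorem summable_norm_mul_l2 (w : lp (fun _ : basisSet K => K) 2) (x : K) :
    (Summable fun i => ‖⟪basis K i, x⟫_ℂ‖ * ‖w i‖) ∧
      ∑' i, ‖⟪basis K i, x⟫_ℂ‖ * ‖w i‖ ≤ ‖w‖ * ‖x‖ := by
  have hx := hasSum_norm_inner_sq (basis K) x
  have hw : HasSum (fun i => ‖w i‖ ^ 2) (‖w‖ ^ 2) := by
    have := lp.hasSum_norm (p := 2) (by norm_num) w
    norm_num at this
    exact this
  have h := Real.summable_and_inner_le_Lp_mul_Lq_tsum_of_nonneg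
    (f := fun i => ‖⟪basis K i, x⟫_ℂ‖) (g := fun i => ‖w i‖) (p := 2) (q := 2)
    Real.HolderConjugate.two_two (fun _ => norm_nonneg _) (fun _ => norm_nonneg _)
    (by simpa using hx.summable) (by simpa using hw.summable)
  refine ⟨h.1, h.2.trans_eq ?_⟩
  simp only [Real.rpow_ofNat, hx.tsum_eq, hw.tsum_eq]
  rw [← Real.sqrt_eq_rpow, ← Real.sqrt_eq_rpow, Real.sqrt_sq (norm_nonneg _),
    Real.sqrt_sq (norm_nonneg _), mul_comm]

theorem summable_l2_comb (w : lp (fun _ : basisSet K => K) 2) (x : K) :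
    Summable fun i => ⟪basis K i, x⟫_ℂ • w i :=
  Summable.of_norm (by simpa only [norm_smul] using (summable_norm_mul_l2 w x).1)

/-- The bounded operator with prescribed square summable values on the fixed basis. -/
noncomputable def opOfL2 (w : lp (fun _ : basisSet K => K) 2) : K →L[ℂ] K :=
  LinearMap.mkContinuous
    { toFun := fun x => ∑' i, ⟪basis K i, x⟫_ℂ • w i
      map_add' := fun x y => by
        simp only [inner_add_right, add_smul]
        exact (summable_l2_comb w x).tsum_add (summable_l2_comb w y)
      map_smul' := fun c x => by
        simp only [inner_smul_right, mul_smul, RingHom.id_apply]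
        exact (summable_l2_comb w x).tsum_const_smul c }
    ‖w‖ fun x => by
      refine (norm_tsum_le_tsum_norm ?_).trans ?_
      · simpa only [norm_smul] using (summable_norm_mul_l2 w x).1
      · simpa only [norm_smul] using (summable_norm_mul_l2 w x).2

theorem opOfL2_basis (w : lp (fun _ : basisSet K => K) 2) (i : basisSet K) :
    opOfL2 w (basis K i) = w i := by
  change ∑' j, ⟪basis K j, basis K i⟫_ℂ • w j = w i
  rw [tsum_eq_single i fun j hj => by rw [(basis K).orthonormal.2 hj, zero_smul],
    inner_self_eq_norm_sq_to_K, (basis K).orthonormal.1 i]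
  simp

/-- Square summable columns define a bounded operator by Cauchy-Schwarz. This makes `B₂(K)`
isometric to an `ℓ²` space, hence complete. -/
theorem HS.toL2_surjective : Function.Surjective (HS.toL2 K) := by
  intro w
  have h : (fun i => opOfL2 w (basis K i)) = w := funext (opOfL2_basis w)
  exact ⟨⟨opOfL2 w, by change Memℓp _ _; rw [h]; exact w.2⟩, Subtype.ext h⟩

instance : CompleteSpace (HS K) := by
  have e : HS K ≃ₗᵢ[ℂ] lp (fun _ : basisSet K => K) 2 :=
    LinearIsometryEquiv.ofSurjective HS.isometry HS.toL2_surjective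
  exact (completeSpace_congr (e := e.toEquiv) e.isometry.isUniformEmbedding).2 inferInstance

/-- The rank-one operator `|x⟩⟨y|` as a vector of `B₂(K)`. -/
noncomputable def rankOneHS (x y : K) : HS K :=
  ⟨InnerProductSpace.rankOne ℂ x y, by
    refine (memℓp_gen_iff (by norm_num)).2 ?_
    refine ((hasSum_norm_inner_sq (basis K) y).summable.mul_right (‖x‖ ^ 2)).congr fun i => ?_
    rw [InnerProductSpace.rankOne_apply, norm_smul, ← norm_inner_symm]
    norm_num [mul_pow]⟩

theorem rankOneHS_op_apply (x y z : K) : (rankOneHS x y).op z = ⟪y, z⟫_ℂ • x := rfl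

theorem inner_rankOneHS (x y : K) (T : HS K) : ⟪rankOneHS x y, T⟫_ℂ = ⟪x, T.op y⟫_ℂ := by
  rw [HS.inner_eq, ← ContinuousLinearMap.adjoint_inner_left,
    ← (basis K).tsum_inner_mul_inner]
  congr 1
  ext i
  rw [rankOneHS_op_apply, inner_smul_left, inner_conj_symm,
    ContinuousLinearMap.adjoint_inner_left, mul_comm]

variable {ι κ : Type*} (u : HilbertBasis ι ℂ K) (v : HilbertBasis κ ℂ K)

/-- The orthonormal basis `|uᵢ⟩⟨vⱼ|` of `B₂(K)`. -/
noncomputable def hsBasis : HilbertBasis (ι × κ) ℂ (HS K) :=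
  HilbertBasis.mkOfOrthogonalEqBot (v := fun ω : ι × κ => rankOneHS (u ω.1) (v ω.2))
    (by
      classical
      rw [orthonormal_iff_ite]
      rintro ⟨i, j⟩ ⟨k, l⟩
      rw [inner_rankOneHS, rankOneHS_op_apply, inner_smul_right]
      have h1 := orthonormal_iff_ite.1 u.orthonormal i k
      have h2 := orthonormal_iff_ite.1 v.orthonormal l j
      simp only [h1, h2, Prod.mk.injEq]
      by_cases hi : i = k <;> by_cases hj : l = j <;> simp [hi, hj, eq_comm (a := j)])
    (by
      rw [Submodule.eq_bot_iff]
      intro T hT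
      rw [Submodule.mem_orthogonal] at hT
      -- Orthogonality to all `|uᵢ⟩⟨vⱼ|` means that every matrix coefficient `⟨uᵢ, T vⱼ⟩` is zero.
      refine HS.ext_op (eq_of_hilbertBasis v fun j => hilbertBasis_ext u fun i => ?_)
      rw [← inner_rankOneHS, hT _ (Submodule.subset_span ⟨(i, j), rfl⟩), HS.zero_op]
      simp)

theorem hsBasis_apply (i : ι) (j : κ) : hsBasis u v (i, j) = rankOneHS (u i) (v j) := by
  simp [hsBasis]

theorem inner_hsBasis (i : ι) (j : κ) (T : HS K) :
    ⟪hsBasis u v (i, j), T⟫_ℂ = ⟪u i, T.op (v j)⟫_ℂ := by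
  rw [hsBasis_apply, inner_rankOneHS]

/-- A bounded operator with square summable matrix coefficients is Hilbert-Schmidt. -/
theorem exists_hs_op_eq (T : K →L[ℂ] K)
    (h : Summable fun ω : ι × κ => ‖⟪u ω.1, T (v ω.2)⟫_ℂ‖ ^ 2) : ∃ A : HS K, A.op = T := by
  have hm : Memℓp (fun ω : ι × κ => ⟪u ω.1, T (v ω.2)⟫_ℂ) 2 :=
    (memℓp_gen_iff (by norm_num)).2 (by simpa using h)
  refine ⟨(hsBasis u v).repr.symm ⟨_, hm⟩, eq_of_hilbertBasis v fun j =>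
    hilbertBasis_ext u fun i => ?_⟩
  rw [← inner_hsBasis, ← (hsBasis u v).repr_apply_apply, LinearIsometryEquiv.apply_symm_apply]

end HilbertSchmidt

/-! ### Diagonalizing the relative modular operator -/

section Modular

variable {K : Type u} [NormedAddCommGroup K] [InnerProductSpace ℂ K] [CompleteSpace K]
  {ρ σ : State K} {r s : ℝ} {x y : K}

theorem State.inner_op_left (ρ : State K) (x y : K) : ⟪ρ.op x, y⟫_ℂ = ⟪x, ρ.op y⟫_ℂ :=
  ρ.isPositive.isSymmetric x y

theorem State.sqrtOp_isPositive (ρ : State K) : ρ.sqrtOp.IsPositive :=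
  (ContinuousLinearMap.nonneg_iff_isPositive _).1 (CFC.sqrt_nonneg _)

theorem State.inner_sqrtOp_left (ρ : State K) (x y : K) :
    ⟪ρ.sqrtOp x, y⟫_ℂ = ⟪x, ρ.sqrtOp y⟫_ℂ :=
  ρ.sqrtOp_isPositive.isSymmetric x y

theorem State.sqrtOp_sqrtOp (ρ : State K) (x : K) : ρ.sqrtOp (ρ.sqrtOp x) = ρ.op x :=
  DFunLike.congr_fun
    (CFC.sqrt_mul_sqrt_self ρ.op ((ContinuousLinearMap.nonneg_iff_isPositive _).2 ρ.isPositive)) x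

theorem State.eigenvalue_nonneg (hx : ρ.op x = (r : ℂ) • x) (h1 : x ≠ 0) : 0 ≤ r := by
  have h := ρ.norm_sqrtOp_sq x
  rw [hx, inner_smul_right, inner_self_eq_norm_sq_to_K] at h
  have h2 : ‖ρ.sqrtOp x‖ ^ 2 = r * ‖x‖ ^ 2 := by
    rw [h, ← Complex.ofReal_re (r * ‖x‖ ^ 2)]
    push_cast
    rfl
  have h3 : 0 < ‖x‖ ^ 2 := by positivity
  by_contra hr
  have := mul_neg_of_neg_of_pos (not_le.1 hr) h3
  have := sq_nonneg ‖ρ.sqrtOp x‖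
  linarith

/-- For `r > 0` the defect `z = √ρ x - √r x` satisfies `√ρ z = -√r z`, which positivity of `√ρ`
allows only for `z = 0`. For `r = 0` one has `‖√ρ x‖² = ⟨x, ρ x⟩ = 0`. -/
theorem State.sqrtOp_eigenvector (hx : ρ.op x = (r : ℂ) • x) (hr : 0 ≤ r) :
    ρ.sqrtOp x = ((√r : ℝ) : ℂ) • x := by
  rcases hr.eq_or_lt with rfl | hr
  · have h := ρ.norm_sqrtOp_sq x
    rw [hx] at h
    simpa using h
  · set z := ρ.sqrtOp x - ((√r : ℝ) : ℂ) • x with hz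
    have hzz : ρ.sqrtOp z = -(((√r : ℝ) : ℂ) • z) := by
      rw [hz, map_sub, map_smul, ρ.sqrtOp_sqrtOp, hx, smul_sub, smul_smul, ← Complex.ofReal_mul,
        Real.mul_self_sqrt hr.le]
      abel
    have h1 := ρ.sqrtOp_isPositive.inner_nonneg_right z
    rw [hzz, inner_neg_right, inner_smul_right, inner_self_eq_norm_sq_to_K] at h1
    have h2 : (0 : ℝ) ≤ -(√r * ‖z‖ ^ 2) := by
      rw [← Complex.zero_le_real]
      push_cast
      exact h1
    have h3 : 0 < √r := Real.sqrt_pos.2 hr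
    have h4 : ‖z‖ ^ 2 = 0 := by nlinarith [sq_nonneg ‖z‖]
    rw [sq_eq_zero_iff, norm_eq_zero, hz, sub_eq_zero] at h4
    exact h4

open Classical in
theorem State.supp_eigenvector (hx : ρ.op x = (r : ℂ) • x) :
    ρ.supp x = if r = 0 then 0 else x := by
  split_ifs with h
  · rw [State.supp, Submodule.starProjection_apply_eq_zero_iff]
    refine Submodule.le_orthogonal_orthogonal _ ?_
    simpa [h] using hx
  · refine Submodule.starProjection_eq_self_iff.2 ?_
    rw [Submodule.mem_orthogonal]
    intro y hy
    have hy' : ρ.op y = 0 := hy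
    have h1 := ρ.inner_op_left y x
    rw [hy', inner_zero_left, hx, inner_smul_right] at h1
    exact (mul_eq_zero.1 h1.symm).resolve_left (by exact_mod_cast h)

theorem graphS_zero (ρ σ : State K) : (0 : HS K × HS K) ∈ graphS ρ σ :=
  ⟨0, 0, by simp [HS.zero_op], by simp [HS.zero_op]⟩

theorem graphS_add {a b : HS K × HS K} (ha : a ∈ graphS ρ σ) (hb : b ∈ graphS ρ σ) :
    a + b ∈ graphS ρ σ := by
  obtain ⟨X, Y, h1, h2⟩ := ha
  obtain ⟨X', Y', h1', h2'⟩ := hb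
  refine ⟨X + X', Y + Y', ?_, ?_⟩
  · rw [Prod.fst_add, HS.add_op, HS.add_op, h1, h1']
    noncomm_ring
  · rw [Prod.snd_add, HS.add_op, h2, h2', map_add]
    noncomm_ring

theorem graphS_smul {a b : HS K} (c : ℂ) (h : (a, b) ∈ graphS ρ σ) :
    (c • a, starRingEnd ℂ c • b) ∈ graphS ρ σ := by
  obtain ⟨X, Y, h1, h2⟩ := h
  refine ⟨c • X, c • Y, ?_, ?_⟩
  · simp only [HS.smul_op] at h1 ⊢
    rw [h1, smul_add, smul_mul_assoc, smul_mul_assoc]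
  · simp only [HS.smul_op] at h2 ⊢
    rw [h2, map_smulₛₗ, mul_smul_comm, smul_mul_assoc]

/-- If `s ≠ 0`, take `X = s^(-1/2) |x⟩⟨y|` and `Y = 0`. If `s = 0`, then `|x⟩⟨y|` is itself of the
form `Y (1 - Π_σ)` and is sent to `0`, which agrees with the convention `r / 0 = 0`; one formula
covers both cases. -/
theorem graphS_rankOne (hr : 0 ≤ r) (hs : 0 ≤ s) (hx : ρ.op x = (r : ℂ) • x)
    (hy : σ.op y = (s : ℂ) • y) :
    (rankOneHS x y, ((√(r / s) : ℝ) : ℂ) • rankOneHS y x) ∈ graphS ρ σ := by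
  classical
  have hsup := State.supp_eigenvector hy
  have hsupz : ∀ z, ⟪y, σ.supp z⟫_ℂ = ⟪σ.supp y, z⟫_ℂ := fun z =>
    (Submodule.inner_starProjection_left_eq_right _ y z).symm
  by_cases h : s = 0
  · refine ⟨0, rankOneHS x y, ?_, ?_⟩
    · ext z
      rw [if_pos h] at hsup
      simp [rankOneHS_op_apply, hsupz, hsup]
    · simp only [h, div_zero, Real.sqrt_zero, Complex.ofReal_zero, zero_smul, map_zero, mul_zero,
        zero_mul]
      rfl
  · have hs' : 0 < √s := Real.sqrt_pos.2 (lt_of_le_of_ne hs (Ne.symm h))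
    have hs'' : ((√s : ℝ) : ℂ) ≠ 0 := by exact_mod_cast hs'.ne'
    refine ⟨(((√s)⁻¹ : ℝ) : ℂ) • (rankOneHS x y).op, 0, ?_, ?_⟩
    · ext z
      simp only [rankOneHS_op_apply, HS.zero_op, zero_mul, add_zero,
        mul_apply_eq_comp, smul_apply]
      rw [← σ.inner_sqrtOp_left, State.sqrtOp_eigenvector hy hs, inner_smul_left, smul_smul,
        Complex.conj_ofReal]
      push_cast
      field_simp
    · ext z
      have hadj : ContinuousLinearMap.adjoint ((((√s)⁻¹ : ℝ) : ℂ) • (rankOneHS x y).op) =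
          (((√s)⁻¹ : ℝ) : ℂ) • (rankOneHS y x).op := by
        rw [map_smulₛₗ]
        simp only [Complex.conj_ofReal]
        congr 1
        exact InnerProductSpace.adjoint_rankOne x y
      rw [hadj]
      rw [if_neg h] at hsup
      simp only [rankOneHS_op_apply, HS.smul_op, mul_apply_eq_comp,
        smul_apply, map_smul, hsup]
      rw [← ρ.inner_sqrtOp_left, State.sqrtOp_eigenvector hx hr, inner_smul_left, smul_smul,
        smul_smul, Complex.conj_ofReal, Real.sqrt_div hr]
      push_cast
      congr 1
      field_simp

/-- Both sides reduce to multiples of the coefficient of `X` at `(x, y)`: for `s ≠ 0` the `Y` term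
dies because `(1 - Π_σ) y = 0`, and for `s = 0` both sides are zero. The relation does not mention
`X` and `Y`, so it survives taking closures. -/
theorem graphS_coeff (hr : 0 ≤ r) (hs : 0 ≤ s) (hx : ρ.op x = (r : ℂ) • x)
    (hy : σ.op y = (s : ℂ) • y) {b c : HS K} (h : (b, c) ∈ graphS ρ σ) :
    ⟪y, c.op x⟫_ℂ = ((√(r / s) : ℝ) : ℂ) * starRingEnd ℂ ⟪x, b.op y⟫_ℂ := by
  classical
  obtain ⟨X, Y, h1, h2⟩ := h
  simp only at h1 h2
  have hsup := State.supp_eigenvector hy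
  have hsupz : ∀ z, ⟪y, σ.supp z⟫_ℂ = ⟪σ.supp y, z⟫_ℂ := fun z =>
    (Submodule.inner_starProjection_left_eq_right _ y z).symm
  rw [h1, h2]
  simp only [mul_apply_eq_comp, add_apply,
    sub_apply, one_apply_eq_self, hsupz, hsup,
    State.sqrtOp_eigenvector hy hs, State.sqrtOp_eigenvector hx hr]
  by_cases h : s = 0
  · simp [h]
  · have hs' : 0 < √s := Real.sqrt_pos.2 (lt_of_le_of_ne hs (Ne.symm h))
    have hs'' : ((√s : ℝ) : ℂ) ≠ 0 := by exact_mod_cast hs'.ne'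
    rw [if_neg h, sub_self, map_zero, add_zero, map_smul, map_smul, inner_smul_right,
      inner_smul_right, ContinuousLinearMap.adjoint_inner_right, map_mul, inner_conj_symm,
      Complex.conj_ofReal, Real.sqrt_div hr]
    push_cast
    field_simp

variable {ι κ : Type*} {u : HilbertBasis ι ℂ K} {v : HilbertBasis κ ℂ K} {r : ι → ℝ} {s : κ → ℝ}

/-- The coefficient relation is a closed condition. Conversely, if it holds, the finite partial sums
of the expansions of `b` and `c` are antilinear combinations of the rank-one pairs, and they
converge to `(b, c)`. -/
theorem mem_closure_graphS_iff (hr : ∀ i, 0 ≤ r i) (hs : ∀ j, 0 ≤ s j)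
    (hu : ∀ i, ρ.op (u i) = (r i : ℂ) • u i) (hv : ∀ j, σ.op (v j) = (s j : ℂ) • v j)
    (b c : HS K) :
    (b, c) ∈ closure (graphS ρ σ) ↔ ∀ i j, ⟪hsBasis v u (j, i), c⟫_ℂ =
      ((√(r i / s j) : ℝ) : ℂ) * starRingEnd ℂ ⟪hsBasis u v (i, j), b⟫_ℂ := by
  constructor
  · intro h
    have hcl : IsClosed {p : HS K × HS K | ∀ i j, ⟪hsBasis v u (j, i), p.2⟫_ℂ =
        ((√(r i / s j) : ℝ) : ℂ) * starRingEnd ℂ ⟪hsBasis u v (i, j), p.1⟫_ℂ} := by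
      simp only [Set.ofPred_forall]
      refine isClosed_iInter fun i => isClosed_iInter fun j => isClosed_eq (by fun_prop) ?_
      exact continuous_const.mul (Complex.continuous_conj.comp (by fun_prop))
    refine (closure_minimal ?_ hcl) h
    rintro ⟨b, c⟩ hbc i j
    rw [inner_hsBasis, inner_hsBasis]
    exact graphS_coeff (hr i) (hs j) (hu i) (hv j) hbc
  · intro h
    have hb := (hsBasis u v).hasSum_repr b
    have hc := (Equiv.prodComm ι κ).hasSum_iff.2 ((hsBasis v u).hasSum_repr c)
    refine mem_closure_of_tendsto (hb.prodMk hc) (Eventually.of_forall fun F => ?_)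
    refine Finset.sum_induction _ (· ∈ graphS ρ σ) (fun _ _ => graphS_add) (graphS_zero ρ σ) ?_
    rintro ⟨i, j⟩ -
    simp only [Function.comp, Equiv.prodComm_apply, Prod.swap_prod_mk, HilbertBasis.repr_apply_apply]
    have := graphS_smul ⟪hsBasis u v (i, j), b⟫_ℂ
      (graphS_rankOne (hr i) (hs j) (hu i) (hv j))
    rwa [smul_smul, mul_comm, ← h i j, ← hsBasis_apply, ← hsBasis_apply] at this

/-- The relative modular operator is diagonal in the basis `|uᵢ⟩⟨vⱼ|`, with eigenvalues
`rᵢ / sⱼ`. -/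
theorem mem_modularGraph_iff (hr : ∀ i, 0 ≤ r i) (hs : ∀ j, 0 ≤ s j)
    (hu : ∀ i, ρ.op (u i) = (r i : ℂ) • u i) (hv : ∀ j, σ.op (v j) = (s j : ℂ) • v j)
    (x y : HS K) :
    (x, y) ∈ modularGraph ρ σ ↔ ∀ ω, ⟪hsBasis u v ω, y⟫_ℂ =
      ((r ω.1 / s ω.2 : ℝ) : ℂ) * ⟪hsBasis u v ω, x⟫_ℂ := by
  have hm : ∀ i j, ((√(r i / s j) : ℝ) : ℂ) * ((√(r i / s j) : ℝ) : ℂ) = ((r i / s j : ℝ) : ℂ) :=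
    fun i j => by
      rw [← Complex.ofReal_mul, Real.mul_self_sqrt (div_nonneg (hr i) (hs j))]
  constructor
  · rintro ⟨z, hz, hzy⟩ ⟨i, j⟩
    have h1 := (mem_closure_graphS_iff hr hs hu hv x z).1 hz i j
    -- Testing the adjoint relation on `|uᵢ⟩⟨vⱼ|` isolates one coefficient and supplies the second
    -- factor `√(rᵢ / sⱼ)`.
    have h2 := hzy _ (graphS_rankOne (hr i) (hs j) (hu i) (hv j))
    simp only [inner_conj_symm] at h2
    rw [← hsBasis_apply, ← hsBasis_apply, inner_smul_right, ← inner_conj_symm z, h1, map_mul,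
      Complex.conj_ofReal, Complex.conj_conj] at h2
    rw [← h2, ← mul_assoc, hm]
  · intro h
    -- The intermediate vector `z` has coefficients of squared modulus `λ |x_ω|²`. It exists since
    -- `λ ≤ 1 + λ²`, so these are dominated by `|x_ω|² + |y_ω|²`.
    have hmem : Memℓp (fun ω : κ × ι => ((√(r ω.2 / s ω.1) : ℝ) : ℂ) *
        starRingEnd ℂ ⟪hsBasis u v (ω.2, ω.1), x⟫_ℂ) 2 := by
      have h3 := (hasSum_norm_inner_sq (hsBasis u v) x).summable.add
        (hasSum_norm_inner_sq (hsBasis u v) y).summable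
      have h4 := (Equiv.prodComm κ ι).summable_iff.2 h3
      refine (memℓp_gen_iff (by norm_num)).2 (h4.of_nonneg_of_le (fun _ => by positivity) ?_)
      rintro ⟨j, i⟩
      have h5 := div_nonneg (hr i) (hs j)
      simp only [Function.comp, Equiv.prodComm_apply, Prod.swap_prod_mk, h]
      simp only [ENNReal.toReal_ofNat, Real.rpow_ofNat, norm_mul, mul_pow, Complex.norm_real,
        Real.norm_eq_abs, sq_abs, Real.sq_sqrt h5, RCLike.norm_conj]
      nlinarith [sq_nonneg (r i / s j - 1), sq_nonneg ‖⟪hsBasis u v (i, j), x⟫_ℂ‖,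
        mul_nonneg (sq_nonneg (r i / s j - 1)) (sq_nonneg ‖⟪hsBasis u v (i, j), x⟫_ℂ‖),
        mul_nonneg h5 (sq_nonneg ‖⟪hsBasis u v (i, j), x⟫_ℂ‖)]
    let z : HS K := (hsBasis v u).repr.symm ⟨_, hmem⟩
    have hz : ∀ i j, ⟪hsBasis v u (j, i), z⟫_ℂ =
        ((√(r i / s j) : ℝ) : ℂ) * starRingEnd ℂ ⟪hsBasis u v (i, j), x⟫_ℂ := fun i j => by
      rw [← (hsBasis v u).repr_apply_apply, LinearIsometryEquiv.apply_symm_apply]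
    refine ⟨z, (mem_closure_graphS_iff hr hs hu hv x z).2 hz, ?_⟩
    rintro ⟨b, c⟩ hbc
    have hbc' := (mem_closure_graphS_iff hr hs hu hv b c).1 (subset_closure hbc)
    simp only [inner_conj_symm]
    -- Expand both inner products by Parseval, one in each rank-one basis, and match terms after
    -- swapping the indices.
    refine ((Equiv.prodComm ι κ).hasSum_iff.2
      ((hsBasis v u).hasSum_inner_mul_inner z c)).unique
      (((hsBasis u v).hasSum_inner_mul_inner b y).congr_fun ?_)
    rintro ⟨i, j⟩
    simp only [Function.comp, Equiv.prodComm_apply, Prod.swap_prod_mk]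
    rw [h, ← inner_conj_symm z, hz, hbc', ← inner_conj_symm b, map_mul, Complex.conj_ofReal,
      Complex.conj_conj, ← hm]
    ring

end Modular

/-! ### Eigenbases of states -/

section Diagonalization

variable {K : Type u} [NormedAddCommGroup K] [InnerProductSpace ℂ K] [CompleteSpace K]

theorem HS.opOfL2_toL2 (T : HS K) : opOfL2 (HS.toL2 K T) = T.op :=
  eq_of_hilbertBasis (basis K) fun i => opOfL2_basis _ i

theorem HS.norm_op_le (T : HS K) : ‖T.op‖ ≤ ‖T‖ := by
  rw [← HS.opOfL2_toL2]
  refine (LinearMap.mkContinuous_norm_le _ (norm_nonneg _) _).trans_eq ?_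
  exact HS.isometry.norm_map T

/-- The embedding of the Hilbert-Schmidt operators in the bounded operators. -/
noncomputable def HS.opL (K : Type u) [NormedAddCommGroup K] [InnerProductSpace ℂ K]
    [CompleteSpace K] : HS K →L[ℂ] (K →L[ℂ] K) :=
  LinearMap.mkContinuous
    { toFun := HS.op
      map_add' := HS.add_op
      map_smul' := HS.smul_op } 1 fun T => by
    rw [one_mul]
    exact HS.norm_op_le T

theorem isCompactOperator_rankOneHS (x y : K) : IsCompactOperator (rankOneHS x y).op := by
  have h : IsCompactOperator (ContinuousLinearMap.toSpanSingleton ℂ x) :=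
    isCompactOperator_of_locallyCompactSpace_rng _
  exact h.comp_clm (innerSL ℂ y)

/-- The operator norm is at most the Hilbert-Schmidt norm, so the finite-rank partial sums of the
expansion of `T` converge in operator norm. -/
theorem HS.isCompactOperator (T : HS K) : IsCompactOperator T.op := by
  have h := ((hsBasis (basis K) (basis K)).hasSum_repr T).mapL (HS.opL K)
  refine isCompactOperator_of_tendsto h (Eventually.of_forall fun F => ?_)
  have : ∑ ω ∈ F, HS.opL K ((hsBasis (basis K) (basis K)).repr T ω •
      hsBasis (basis K) (basis K) ω) ∈ compactOperator (RingHom.id ℂ) K K := by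
    refine Submodule.sum_mem _ ?_
    rintro ⟨i, j⟩ -
    rw [map_smul]
    refine Submodule.smul_mem _ _ ?_
    rw [hsBasis_apply]
    exact isCompactOperator_rankOneHS _ _
  exact this

theorem State.isCompactOperator (ρ : State K) : IsCompactOperator ρ.op := by
  have h := ρ.sqrtHS.isCompactOperator.comp_clm ρ.sqrtOp
  have h2 : (ρ.op : K → K) = ρ.sqrtHS.op ∘ ρ.sqrtOp := by
    ext x
    exact (ρ.sqrtOp_sqrtOp x).symm
  rwa [h2]

/-- The spectral theorem for compact self-adjoint operators, with a Hilbert basis chosen in every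
eigenspace. The kernel is included, so the basis is complete and separability of `K` plays no role.
-/
theorem State.exists_eigenbasis (ρ : State K) :
    ∃ (ι : Type u) (u : HilbertBasis ι ℂ K) (r : ι → ℝ), (∀ i, 0 ≤ r i) ∧
      ∀ i, ρ.op (u i) = (r i : ℂ) • u i := by
  have hsym : (ρ.op : K →ₗ[ℂ] K).IsSymmetric := ρ.isPositive.isSymmetric
  let V : ℂ → Submodule ℂ K := fun μ => Module.End.eigenspace (ρ.op : K →ₗ[ℂ] K) μ
  have hV : ∀ μ x, x ∈ V μ ↔ ρ.op x = μ • x := fun μ x => Module.End.mem_eigenspace_iff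
  have hcl : ∀ μ, CompleteSpace (V μ) := fun μ => by
    refine IsClosed.completeSpace_coe (s := (V μ : Set K)) (hs := ?_)
    have : (V μ : Set K) = {x | ρ.op x = μ • x} := Set.ext (hV μ)
    rw [this]
    exact isClosed_eq (by fun_prop) (by fun_prop)
  choose w b hb using fun μ => exists_hilbertBasis ℂ (V μ)
  have hfam := hsym.orthogonalFamily_eigenspaces
  have hon := hfam.orthonormal_sigma_orthonormal (fun μ => (b μ).orthonormal)
  let u : HilbertBasis (Σ μ, w μ) ℂ K := HilbertBasis.mkOfOrthogonalEqBot hon (by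
    rw [← ContinuousLinearMap.orthogonalComplement_iSup_eigenspaces_eq_bot ρ.isCompactOperator
      hsym]
    refine le_antisymm (fun x hx => ?_) ?_
    · rw [← Submodule.iInf_orthogonal, Submodule.mem_iInf]
      intro μ y hy
      rw [Submodule.mem_orthogonal'] at hx
      have h0 : (innerSL ℂ x).comp (V μ).subtypeL = 0 :=
        eq_of_hilbertBasis (b μ) fun i => hx _ (Submodule.subset_span ⟨⟨μ, i⟩, rfl⟩)
      have := DFunLike.congr_fun h0 ⟨y, hy⟩
      exact inner_eq_zero_symm.1 (by simpa using this)
    · refine Submodule.orthogonal_le (Submodule.span_le.2 ?_)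
      rintro _ ⟨⟨μ, i⟩, rfl⟩
      exact Submodule.mem_iSup_of_mem μ (b μ i).2)
  have hu : ∀ a, u a = (b a.1 a.2 : K) := fun a => by simp [u]
  have he : ∀ a, ρ.op (u a) = a.1 • u a := fun a => by
    rw [hu]
    exact (hV _ _).1 (b a.1 a.2).2
  -- The family runs over all complex `μ`, but an index exists only where the eigenspace is nonzero,
  -- and there `μ` is real.
  have hreal : ∀ a : Σ μ, w μ, ((a.1.re : ℝ) : ℂ) = a.1 := fun a => by
    have h0 : u a ≠ 0 := fun h => by
      have := u.orthonormal.1 a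
      rw [h, norm_zero] at this
      exact zero_ne_one this
    have := hsym.conj_eigenvalue_eq_self
      (Module.End.hasEigenvalue_of_hasEigenvector
        ⟨Module.End.mem_eigenspace_iff.2 (he a), h0⟩)
    exact Complex.conj_eq_iff_re.1 this
  have he' : ∀ a, ρ.op (u a) = ((a.1.re : ℝ) : ℂ) • u a := fun a => by rw [hreal, he]
  refine ⟨Σ μ, w μ, u, fun a => a.1.re, fun a => State.eigenvalue_nonneg (he' a) fun h => ?_, he'⟩
  have := u.orthonormal.1 a
  rw [h, norm_zero] at this
  exact zero_ne_one this

end Diagonalization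

/-! ### Classical divergences of weights on a discrete set -/

section Classical

open Classical in
/-- The classical `f`-divergence of the nonnegative weights `p` and `q`. -/
noncomputable def cDiv {Ω : Type*} (f : ℝ → ℝ) (p q : Ω → ℝ) : EReal :=
  (((∑' ω, if 0 < p ω ∧ 0 < q ω then ENNReal.ofReal (q ω * f (p ω / q ω)) else 0 : ℝ≥0∞) : EReal)
    - ((∑' ω, if 0 < p ω ∧ 0 < q ω then ENNReal.ofReal (q ω * -f (p ω / q ω)) else 0 : ℝ≥0∞)
      : EReal))
    + limZero f * ((∑' ω, if p ω = 0 then q ω else 0 : ℝ) : EReal)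
    + slopeInfty f * ((∑' ω, if q ω = 0 then p ω else 0 : ℝ) : EReal)

theorem cDiv_comp_equiv {Ω Ω' : Type*} (e : Ω' ≃ Ω) (f : ℝ → ℝ) (p q : Ω → ℝ) :
    cDiv f (p ∘ e) (q ∘ e) = cDiv f p q := by
  classical
  unfold cDiv
  rw [← e.tsum_eq fun ω => if 0 < p ω ∧ 0 < q ω then ENNReal.ofReal (q ω * f (p ω / q ω)) else 0,
    ← e.tsum_eq fun ω => if 0 < p ω ∧ 0 < q ω then ENNReal.ofReal (q ω * -f (p ω / q ω)) else 0,
    ← e.tsum_eq fun ω => if p ω = 0 then q ω else 0,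
    ← e.tsum_eq fun ω => if q ω = 0 then p ω else 0]
  rfl

end Classical

/-! ### Quantum divergences as classical ones -/

section Representation

variable {K : Type u} [NormedAddCommGroup K] [InnerProductSpace ℂ K] [CompleteSpace K]
  {ρ σ : State K}

theorem State.norm_sqrtHS_sq (σ : State K) : ‖σ.sqrtHS‖ ^ 2 = 1 := by
  have h1 : ∀ i, ⟪σ.sqrtHS.op (basis K i), σ.sqrtHS.op (basis K i)⟫_ℂ =
      ⟪basis K i, σ.op (basis K i)⟫_ℂ := fun i => by
    rw [← σ.sqrtOp_sqrtOp]
    exact σ.inner_sqrtOp_left _ _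
  have h2 : ⟪σ.sqrtHS, σ.sqrtHS⟫_ℂ = 1 := by
    rw [HS.inner_eq]
    simp only [h1]
    exact σ.hasSum_trace.tsum_eq
  rw [inner_self_eq_norm_sq_to_K] at h2
  exact Complex.ofReal_injective (by push_cast; exact h2)

variable {ι κ : Type*} {u : HilbertBasis ι ℂ K} {v : HilbertBasis κ ℂ K} {r : ι → ℝ} {s : κ → ℝ}

theorem inner_hsBasis_sqrtHS (hs : ∀ j, 0 ≤ s j) (hv : ∀ j, σ.op (v j) = (s j : ℂ) • v j)
    (i : ι) (j : κ) :
    ⟪hsBasis u v (i, j), σ.sqrtHS⟫_ℂ = ((√(s j) : ℝ) : ℂ) * ⟪u i, v j⟫_ℂ := by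
  rw [inner_hsBasis, ← inner_smul_right, ← State.sqrtOp_eigenvector (hv j) (hs j)]
  rfl

theorem norm_inner_hsBasis_sqrtHS (hs : ∀ j, 0 ≤ s j)
    (hv : ∀ j, σ.op (v j) = (s j : ℂ) • v j) (ω : ι × κ) :
    ‖⟪hsBasis u v ω, σ.sqrtHS⟫_ℂ‖ ^ 2 = s ω.2 * ‖⟪u ω.1, v ω.2⟫_ℂ‖ ^ 2 := by
  rw [inner_hsBasis_sqrtHS hs hv ω.1 ω.2, norm_mul, mul_pow, Complex.norm_real, Real.norm_eq_abs,
    sq_abs, Real.sq_sqrt (hs _)]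

theorem hasSum_weights (hs : ∀ j, 0 ≤ s j) (hv : ∀ j, σ.op (v j) = (s j : ℂ) • v j) :
    HasSum (fun ω : ι × κ => s ω.2 * ‖⟪u ω.1, v ω.2⟫_ℂ‖ ^ 2) 1 := by
  rw [← σ.norm_sqrtHS_sq]
  exact (hasSum_norm_inner_sq (hsBasis u v) σ.sqrtHS).congr_fun fun ω =>
    (norm_inner_hsBasis_sqrtHS hs hv ω).symm

open Classical in
-- The trace is defined in a fixed basis unrelated to the eigenvectors. Writing it as `⟨√σ, √σ (1 -
-- Π_ρ)⟩₂` makes it basis free, and Parseval in `|vⱼ⟩⟨uᵢ|` then evaluates it.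
theorem re_trace_mul_compl_supp (hs : ∀ j, 0 ≤ s j)
    (hu : ∀ i, ρ.op (u i) = (r i : ℂ) • u i) (hv : ∀ j, σ.op (v j) = (s j : ℂ) • v j) :
    (trace (σ.op * (1 - ρ.supp))).re =
      ∑' ω : κ × ι, if r ω.2 = 0 then s ω.1 * ‖⟪v ω.1, u ω.2⟫_ℂ‖ ^ 2 else 0 := by
  have hcoef : ∀ j i, ⟪v j, (σ.sqrtOp * (1 - ρ.supp)) (u i)⟫_ℂ =
      if r i = 0 then ((√(s j) : ℝ) : ℂ) * ⟪v j, u i⟫_ℂ else 0 := by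
    intro j i
    rw [mul_apply_eq_comp, sub_apply, one_apply_eq_self, State.supp_eigenvector (hu i),
      ← σ.inner_sqrtOp_left, State.sqrtOp_eigenvector (hv j) (hs j), inner_smul_left,
      Complex.conj_ofReal]
    split_ifs <;> simp
  have hsw : Summable fun ω : κ × ι => s ω.1 * ‖⟪v ω.1, u ω.2⟫_ℂ‖ ^ 2 := by
    have := ((Equiv.prodComm κ ι).hasSum_iff.2 (hasSum_weights (u := u) hs hv)).summable
    refine this.congr fun ω => ?_
    simp only [Function.comp, Equiv.prodComm_apply, Prod.fst_swap, Prod.snd_swap]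
    rw [norm_inner_symm]
  obtain ⟨A, hA⟩ := exists_hs_op_eq v u (σ.sqrtOp * (1 - ρ.supp)) (by
    refine hsw.of_nonneg_of_le (fun _ => by positivity) fun ω => ?_
    rw [hcoef]
    split_ifs
    · rw [norm_mul, mul_pow, Complex.norm_real, Real.norm_eq_abs, sq_abs, Real.sq_sqrt (hs _)]
    · have := hs ω.1
      norm_num
      positivity)
  have htr : trace (σ.op * (1 - ρ.supp)) = ⟪σ.sqrtHS, A⟫_ℂ := by
    rw [HS.inner_eq, hA]
    unfold trace
    congr 1
    ext i
    rw [mul_apply_eq_comp, mul_apply_eq_comp, ← σ.sqrtOp_sqrtOp, ← σ.inner_sqrtOp_left]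
    rfl
  have hsum := Complex.hasSum_re ((hsBasis v u).hasSum_inner_mul_inner σ.sqrtHS A)
  rw [htr, ← hsum.tsum_eq]
  congr 1
  ext ⟨j, i⟩
  rw [inner_hsBasis, hA, hcoef, ← inner_conj_symm, inner_hsBasis]
  have : σ.sqrtHS.op (u i) = σ.sqrtOp (u i) := rfl
  rw [this, ← σ.inner_sqrtOp_left, State.sqrtOp_eigenvector (hv j) (hs j), inner_smul_left,
    Complex.conj_ofReal]
  split_ifs
  · rw [← Complex.normSq_eq_conj_mul_self, Complex.ofReal_re, Complex.normSq_eq_norm_sq, norm_mul,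
      mul_pow, Complex.norm_real, Real.norm_eq_abs, sq_abs, Real.sq_sqrt (hs _)]
  · simp

theorem modularMeasure_eq (hr : ∀ i, 0 ≤ r i) (hs : ∀ j, 0 ≤ s j)
    (hu : ∀ i, ρ.op (u i) = (r i : ℂ) • u i) (hv : ∀ j, σ.op (v j) = (s j : ℂ) • v j) :
    modularMeasure ρ σ = diagMeasure (hsBasis u v) (fun ω => r ω.1 / s ω.2) σ.sqrtHS :=
  spectralMeasure_measure _ _ (mem_modularGraph_iff hr hs hu hv) _

open Classical in
-- The overlap `|⟨uᵢ, vⱼ⟩|²` cancels in `p / q = rᵢ / sⱼ`. The excluded terms vanish on the left as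
-- well: either the atom has mass zero or it sits at `λ = 0`, outside the domain of integration.
theorem lintegral_modularMeasure (hr : ∀ i, 0 ≤ r i) (hs : ∀ j, 0 ≤ s j)
    (hu : ∀ i, ρ.op (u i) = (r i : ℂ) • u i) (hv : ∀ j, σ.op (v j) = (s j : ℂ) • v j)
    (f : ℝ → ℝ) :
    ∫⁻ t in Ioi 0, ENNReal.ofReal (f t) ∂(modularMeasure ρ σ) =
      ∑' ω : ι × κ, if 0 < r ω.1 * ‖⟪u ω.1, v ω.2⟫_ℂ‖ ^ 2 ∧ 0 < s ω.2 * ‖⟪u ω.1, v ω.2⟫_ℂ‖ ^ 2 then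
        ENNReal.ofReal (s ω.2 * ‖⟪u ω.1, v ω.2⟫_ℂ‖ ^ 2 *
          f (r ω.1 * ‖⟪u ω.1, v ω.2⟫_ℂ‖ ^ 2 / (s ω.2 * ‖⟪u ω.1, v ω.2⟫_ℂ‖ ^ 2))) else 0 := by
  rw [modularMeasure_eq hr hs hu hv, ← lintegral_indicator measurableSet_Ioi, lintegral_diagMeasure]
  congr 1
  ext ⟨i, j⟩
  rw [norm_inner_hsBasis_sqrtHS hs hv]
  simp only
  rcases (sq_nonneg ‖⟪u i, v j⟫_ℂ‖).eq_or_lt with h0 | h0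
  · simp [← h0]
  rcases (hs j).eq_or_lt with h1 | h1
  · simp [← h1]
  rcases (hr i).eq_or_lt with h2 | h2
  · simp [← h2]
  have h3 : r i / s j ∈ Ioi (0 : ℝ) := div_pos h2 h1
  rw [indicator_of_mem h3, if_pos ⟨mul_pos h2 h0, mul_pos h1 h0⟩, mul_div_mul_right _ _ h0.ne',
    ENNReal.ofReal_mul (p := s j * _) (by positivity)]

open Classical in
-- A weight can vanish through its eigenvalue or through the overlap. The second possibility
-- contributes nothing, as the other weight carries the same overlap factor.
theorem tsum_weights_zero {α β : Type*} (e : α ≃ β) {a : β → ℝ} {c d : β → ℝ} (a' : α → ℝ)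
    (hc : ∀ b, 0 ≤ c b)
    (hd : ∀ x, a' x = d (e x) * c (e x)) :
    (∑' x, if a (e x) = 0 then a' x else 0) = ∑' b, if a b * c b = 0 then d b * c b else 0 := by
  rw [← e.tsum_eq]
  congr 1
  ext x
  rw [hd]
  rcases (hc (e x)).eq_or_lt with h | h
  · simp [← h]
  · simp [h.ne']

theorem fDiv_eq_cDiv (hr : ∀ i, 0 ≤ r i) (hs : ∀ j, 0 ≤ s j)
    (hu : ∀ i, ρ.op (u i) = (r i : ℂ) • u i) (hv : ∀ j, σ.op (v j) = (s j : ℂ) • v j)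
    (f : ℝ → ℝ) :
    fDiv f ρ σ = cDiv f (fun ω : ι × κ => r ω.1 * ‖⟪u ω.1, v ω.2⟫_ℂ‖ ^ 2)
      (fun ω : ι × κ => s ω.2 * ‖⟪u ω.1, v ω.2⟫_ℂ‖ ^ 2) := by
  classical
  unfold fDiv cDiv extIntegral
  have h1 := lintegral_modularMeasure hr hs hu hv f
  have h2 := lintegral_modularMeasure hr hs hu hv (fun t => -f t)
  have h3 : (∑' ω : κ × ι, if r ω.2 = 0 then s ω.1 * ‖⟪v ω.1, u ω.2⟫_ℂ‖ ^ 2 else 0) = _ :=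
    tsum_weights_zero (Equiv.prodComm κ ι) (a := fun ω => r ω.1)
    (c := fun ω => ‖⟪u ω.1, v ω.2⟫_ℂ‖ ^ 2) (d := fun ω => s ω.2)
    (fun ω => s ω.1 * ‖⟪v ω.1, u ω.2⟫_ℂ‖ ^ 2) (fun _ => sq_nonneg _)
    fun ω => by rw [norm_inner_symm]; rfl
  have h4 : (∑' ω : ι × κ, if s ω.2 = 0 then r ω.1 * ‖⟪u ω.1, v ω.2⟫_ℂ‖ ^ 2 else 0) = _ :=
    tsum_weights_zero (Equiv.refl (ι × κ)) (a := fun ω => s ω.2)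
    (c := fun ω => ‖⟪u ω.1, v ω.2⟫_ℂ‖ ^ 2) (d := fun ω => r ω.1) _ (fun _ => sq_nonneg _)
    fun ω => rfl
  rw [h1, h2, re_trace_mul_compl_supp hs hu hv, re_trace_mul_compl_supp hr hv hu, h3, h4]

/-- The Nussbaum-Szkoła distributions: quantum `f`-divergences are classical. -/
theorem exists_classical (ρ σ : State K) : ∃ (Ω : Type u) (p q : Ω → ℝ),
    (∀ ω, 0 ≤ p ω) ∧ (∀ ω, 0 ≤ q ω) ∧ HasSum p 1 ∧ HasSum q 1 ∧
      ∀ f, fDiv f ρ σ = cDiv f p q ∧ fDiv f σ ρ = cDiv f q p := by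
  obtain ⟨ι, u, r, hr, hu⟩ := ρ.exists_eigenbasis
  obtain ⟨κ, v, s, hs, hv⟩ := σ.exists_eigenbasis
  refine ⟨ι × κ, fun ω => r ω.1 * ‖⟪u ω.1, v ω.2⟫_ℂ‖ ^ 2,
    fun ω => s ω.2 * ‖⟪u ω.1, v ω.2⟫_ℂ‖ ^ 2, fun ω => mul_nonneg (hr _) (sq_nonneg _),
    fun ω => mul_nonneg (hs _) (sq_nonneg _), ?_, hasSum_weights hs hv,
    fun f => ⟨fDiv_eq_cDiv hr hs hu hv f, ?_⟩⟩
  · have := (Equiv.prodComm ι κ).hasSum_iff.2 (hasSum_weights (u := v) hr hu)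
    refine this.congr_fun fun ω => ?_
    simp only [Function.comp, Equiv.prodComm_apply, Prod.fst_swap, Prod.snd_swap]
    rw [norm_inner_symm]
  · rw [fDiv_eq_cDiv hs hr hv hu f, ← cDiv_comp_equiv (Equiv.prodComm κ ι)]
    congr 1 <;> ext ω <;> simp only [Function.comp, Equiv.prodComm_apply, Prod.fst_swap,
      Prod.snd_swap] <;> rw [norm_inner_symm]

end Representation

/-! ### Affine normalization and limits at zero and infinity -/

section Normalization

variable {Ω : Type*} {p q : Ω → ℝ} {f g : ℝ → ℝ} {c : ℝ} {L₀ L : ℝ≥0∞}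

/-- The classical `g`-divergence of a nonnegative `g` with values `L₀` at `0` and slope `L` at
infinity. -/
noncomputable def nDiv (g : ℝ → ℝ) (L₀ L : ℝ≥0∞) (p q : Ω → ℝ) : ℝ≥0∞ :=
  ∑' ω, if q ω = 0 then L * ENNReal.ofReal (p ω)
    else if p ω = 0 then L₀ * ENNReal.ofReal (q ω) else ENNReal.ofReal (q ω * g (p ω / q ω))

theorem ofReal_max_zero (x : ℝ) : ENNReal.ofReal (max x 0) = ENNReal.ofReal x := by
  rcases le_total 0 x with h | h
  · rw [max_eq_left h]
  · rw [max_eq_right h, ENNReal.ofReal_zero, ENNReal.ofReal_of_nonpos h]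

theorem tsum_ofReal_sub_tsum_ofReal_neg {x : Ω → ℝ} (hx : Summable x) :
    ((∑' ω, ENNReal.ofReal (x ω) : ℝ≥0∞) : EReal) - ((∑' ω, ENNReal.ofReal (-x ω) : ℝ≥0∞) : EReal)
      = ((∑' ω, x ω : ℝ) : EReal) := by
  have h1 : Summable fun ω => max (x ω) 0 := by
    refine hx.abs.of_nonneg_of_le (fun _ => le_max_right _ _) fun ω => ?_
    exact max_le (le_abs_self _) (abs_nonneg _)
  have h2 : Summable fun ω => max (-x ω) 0 := by
    refine hx.abs.of_nonneg_of_le (fun _ => le_max_right _ _) fun ω => ?_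
    exact max_le (neg_le_abs _) (abs_nonneg _)
  have e1 : ∑' ω, ENNReal.ofReal (x ω) = ENNReal.ofReal (∑' ω, max (x ω) 0) := by
    rw [ENNReal.ofReal_tsum_of_nonneg (fun _ => le_max_right _ _) h1]
    congr 1
    ext ω
    exact (ofReal_max_zero _).symm
  have e2 : ∑' ω, ENNReal.ofReal (-x ω) = ENNReal.ofReal (∑' ω, max (-x ω) 0) := by
    rw [ENNReal.ofReal_tsum_of_nonneg (fun _ => le_max_right _ _) h2]
    congr 1
    ext ω
    exact (ofReal_max_zero _).symm
  rw [e1, e2, EReal.coe_ennreal_ofReal, EReal.coe_ennreal_ofReal,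
    max_eq_left (tsum_nonneg fun _ => le_max_right _ _),
    max_eq_left (tsum_nonneg fun _ => le_max_right _ _), ← EReal.coe_sub, ← h1.tsum_sub h2]
  congr 2
  ext ω
  rcases le_total 0 (x ω) with h | h
  · rw [max_eq_left h, max_eq_right (by linarith), sub_zero]
  · rw [max_eq_right h, max_eq_left (by linarith), zero_sub, neg_neg]

/-- Distributivity can fail in `EReal`. It holds here because `c` is finite and `a` is a nonnegative
real; `a = 0` is treated apart, where `∞ * 0 = 0`. -/
theorem ereal_sub_mul_coe (L : ℝ≥0∞) (c : ℝ) {a : ℝ} (ha : 0 ≤ a) :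
    ((L : EReal) - (c : EReal)) * (a : EReal) =
      ((L * ENNReal.ofReal a : ℝ≥0∞) : EReal) - ((c * a : ℝ) : EReal) := by
  rcases ha.eq_or_lt with rfl | ha'
  · simp
  · induction L with
    | top =>
      rw [ENNReal.top_mul (by simpa using ha'), EReal.coe_ennreal_top, EReal.top_sub_coe,
        EReal.top_mul_coe_of_pos ha', EReal.top_sub_coe]
    | coe l =>
      rw [EReal.coe_ennreal_mul, EReal.coe_ennreal_ofReal, max_eq_left ha,
        EReal.coe_nnreal_eq_coe_real]
      norm_cast
      ring

theorem nDiv_eq_add (hp : ∀ ω, 0 ≤ p ω) (hq : ∀ ω, 0 ≤ q ω) :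
    nDiv g L₀ L p q =
      (∑' ω, ENNReal.ofReal (if 0 < p ω ∧ 0 < q ω then q ω * g (p ω / q ω) else 0)) +
        L₀ * (∑' ω, ENNReal.ofReal (if p ω = 0 then q ω else 0)) +
        L * (∑' ω, ENNReal.ofReal (if q ω = 0 then p ω else 0)) := by
  rw [← ENNReal.tsum_mul_left, ← ENNReal.tsum_mul_left, ← ENNReal.tsum_add, ← ENNReal.tsum_add]
  unfold nDiv
  congr 1
  ext ω
  rcases (hp ω).eq_or_lt with h1 | h1 <;> rcases (hq ω).eq_or_lt with h2 | h2
  · simp [← h1, ← h2]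
  · simp [← h1, h2.ne']
  · simp [← h2, h1.ne']
  · simp [h1, h2, h1.ne', h2.ne']

/-- Affine normalization of an `f`-divergence. -/
theorem cDiv_eq_nDiv (hp : ∀ ω, 0 ≤ p ω) (hq : ∀ ω, 0 ≤ q ω) (hP : HasSum p 1) (hQ : HasSum q 1)
    (hfg : ∀ t, 0 < t → f t = g t + c * (t - 1)) (hg : ∀ t, 0 < t → 0 ≤ g t)
    (h0 : limZero f = (L₀ : EReal) - (c : EReal))
    (hinf : slopeInfty f = (L : EReal) + (c : EReal)) :
    cDiv f p q = nDiv g L₀ L p q := by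
  set a : ℝ := ∑' ω, if p ω = 0 then q ω else 0 with ha
  set b : ℝ := ∑' ω, if q ω = 0 then p ω else 0 with hb
  have ha0 : ∀ ω, 0 ≤ if p ω = 0 then q ω else 0 := fun ω => by split_ifs <;> simp [hq]
  have hb0 : ∀ ω, 0 ≤ if q ω = 0 then p ω else 0 := fun ω => by split_ifs <;> simp [hp]
  have hsa : Summable fun ω => if p ω = 0 then q ω else 0 :=
    hQ.summable.of_nonneg_of_le ha0 fun ω => by split_ifs <;> simp [hq]
  have hsb : Summable fun ω => if q ω = 0 then p ω else 0 :=
    hP.summable.of_nonneg_of_le hb0 fun ω => by split_ifs <;> simp [hp]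
  have ha' : 0 ≤ a := tsum_nonneg ha0
  have hb' : 0 ≤ b := tsum_nonneg hb0
  let z : Ω → ℝ := fun ω => if 0 < p ω ∧ 0 < q ω then c * (p ω - q ω) else 0
  let y : Ω → ℝ := fun ω => if 0 < p ω ∧ 0 < q ω then q ω * g (p ω / q ω) else 0
  let x : Ω → ℝ := fun ω => if 0 < p ω ∧ 0 < q ω then q ω * f (p ω / q ω) else 0
  -- On the common support `p` has mass `1 - b` and `q` has mass `1 - a`. The resulting `c (a - b)`
  -- is cancelled at the end by the `-c a` and `+c b` coming from the two boundary terms.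
  have hz : HasSum z (c * (a - b)) := by
    have h := (((hP.sub hsb.hasSum).sub (hQ.sub hsa.hasSum)).mul_left c)
    have e : c * (1 - b - (1 - a)) = c * (a - b) := by ring
    rw [← hb, ← ha, e] at h
    refine h.congr_fun fun ω => ?_
    rcases (hp ω).eq_or_lt with h1 | h1 <;> rcases (hq ω).eq_or_lt with h2 | h2
    · simp [z, ← h1, ← h2]
    · simp [z, ← h1, h2.ne']
    · simp [z, ← h2, h1.ne']
    · simp [z, h1, h2, h1.ne', h2.ne']
  have hxyz : ∀ ω, x ω = y ω + z ω := fun ω => by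
    simp only [x, y, z]
    split_ifs with h
    · rw [hfg _ (div_pos h.1 h.2)]
      have := h.2.ne'
      field_simp
    · simp
  have hy : ∀ ω, 0 ≤ y ω := fun ω => by
    simp only [y]
    split_ifs with h
    · exact mul_nonneg h.2.le (hg _ (div_pos h.1 h.2))
    · exact le_rfl
  have hzabs : ∑' ω, ENNReal.ofReal |z ω| ≠ ∞ := by
    rw [← ENNReal.ofReal_tsum_of_nonneg (fun _ => abs_nonneg _) hz.summable.abs]
    exact ENNReal.ofReal_ne_top
  have hminus : ∑' ω, ENNReal.ofReal (-x ω) ≠ ∞ := by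
    refine ne_top_of_le_ne_top hzabs (ENNReal.tsum_le_tsum fun ω => ?_)
    refine ENNReal.ofReal_le_ofReal ?_
    linarith [hxyz ω, hy ω, neg_le_abs (z ω)]
  -- As `y ≥ 0`, the negative part of `x = y + z` is dominated by the summable `|z|`. So `∞ - ∞`
  -- cannot occur, and an infinite sum of `y` makes both sides `⊤`.
  have key : ((∑' ω, ENNReal.ofReal (x ω) : ℝ≥0∞) : EReal)
      - ((∑' ω, ENNReal.ofReal (-x ω) : ℝ≥0∞) : EReal) =
      ((∑' ω, ENNReal.ofReal (y ω) : ℝ≥0∞) : EReal) + ((c * (a - b) : ℝ) : EReal) := by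
    by_cases hG : ∑' ω, ENNReal.ofReal (y ω) = ∞
    · have hA : ∑' ω, ENNReal.ofReal (x ω) = ∞ := by
        by_contra hA
        refine ENNReal.add_ne_top.2 ⟨hA, hzabs⟩ (top_le_iff.1 ?_)
        rw [← hG, ← ENNReal.tsum_add]
        refine ENNReal.tsum_le_tsum fun ω => ?_
        refine le_trans (ENNReal.ofReal_le_ofReal ?_) ENNReal.ofReal_add_le
        linarith [hxyz ω, neg_le_abs (z ω)]
      rw [hA, hG]
      lift ∑' ω, ENNReal.ofReal (-x ω) to NNReal using hminus with w
      rw [EReal.coe_ennreal_top, EReal.top_add_coe, EReal.coe_nnreal_eq_coe_real]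
      exact EReal.top_sub_coe _
    · have hys : Summable y := by
        refine (ENNReal.summable_toReal hG).congr fun ω => ?_
        rw [ENNReal.toReal_ofReal (hy ω)]
      have hxs : Summable x := (hys.add hz.summable).congr fun ω => (hxyz ω).symm
      rw [tsum_ofReal_sub_tsum_ofReal_neg hxs, ← ENNReal.ofReal_tsum_of_nonneg hy hys,
        EReal.coe_ennreal_ofReal, max_eq_left (tsum_nonneg hy), ← hz.tsum_eq, ← EReal.coe_add,
        ← hys.tsum_add hz.summable, tsum_congr hxyz]
  have e1 : ∀ F : ℝ → ℝ, (∑' ω, if 0 < p ω ∧ 0 < q ω then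
      ENNReal.ofReal (q ω * F (p ω / q ω)) else 0) =
      ∑' ω, ENNReal.ofReal (if 0 < p ω ∧ 0 < q ω then q ω * F (p ω / q ω) else 0) := by
    intro F
    congr 1
    ext ω
    split_ifs <;> simp
  have e2 : ∀ ω, (if 0 < p ω ∧ 0 < q ω then q ω * -f (p ω / q ω) else 0) = -x ω := fun ω => by
    simp only [x]
    split_ifs <;> simp
  have e3 : (L : EReal) + (c : EReal) = (L : EReal) - ((-c : ℝ) : EReal) := by
    rw [EReal.coe_neg, sub_eq_add_neg, neg_neg]
  have e4 := e1 f
  have e5 := e1 (fun t => -f t)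
  simp only [e2] at e5
  have e6 : cDiv f p q = ((∑' ω, ENNReal.ofReal (x ω) : ℝ≥0∞) : EReal)
      - ((∑' ω, ENNReal.ofReal (-x ω) : ℝ≥0∞) : EReal) + limZero f * (a : EReal)
      + slopeInfty f * (b : EReal) := by
    unfold cDiv
    rw [← e4, ← e5]
  rw [e6, key, h0, hinf, e3, ereal_sub_mul_coe _ _ ha', ereal_sub_mul_coe _ _ hb',
    nDiv_eq_add hp hq, ← ENNReal.ofReal_tsum_of_nonneg ha0 hsa,
    ← ENNReal.ofReal_tsum_of_nonneg hb0 hsb, EReal.coe_ennreal_add, EReal.coe_ennreal_add]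
  set G : EReal := ((∑' ω, ENNReal.ofReal (y ω) : ℝ≥0∞) : EReal)
  set A : EReal := ((L₀ * ENNReal.ofReal a : ℝ≥0∞) : EReal)
  set B : EReal := ((L * ENNReal.ofReal b : ℝ≥0∞) : EReal)
  rw [sub_eq_add_neg A, sub_eq_add_neg B, ← EReal.coe_neg, ← EReal.coe_neg]
  have e8 : G + ((c * (a - b) : ℝ) : EReal) + (A + ((-(c * a) : ℝ) : EReal)) +
      (B + ((-(-c * b) : ℝ) : EReal)) = G + A + B + (((c * (a - b) : ℝ) : EReal) +
        ((-(c * a) : ℝ) : EReal) + ((-(-c * b) : ℝ) : EReal)) := by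
    abel
  rw [e8, ← EReal.coe_add, ← EReal.coe_add]
  have e9 : c * (a - b) + -(c * a) + -(-c * b) = 0 := by ring
  rw [e9, EReal.coe_zero, add_zero]

/-- `g` is the nonnegative normalization of `f` by a multiple of `t - 1`, with slope `L` at
infinity. -/
structure IsNormalization (f g : ℝ → ℝ) (c : ℝ) (L : ℝ≥0∞) : Prop where
  eq : ∀ t, 0 < t → f t = g t + c * (t - 1)
  nonneg : ∀ t, 0 ≤ t → 0 ≤ g t
  limZero_eq : limZero f = ((g 0 - c : ℝ) : EReal)
  slope_eq : slopeInfty f = (L : EReal) + (c : EReal)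

theorem IsNormalization.cDiv_eq (h : IsNormalization f g c L) (hp : ∀ ω, 0 ≤ p ω)
    (hq : ∀ ω, 0 ≤ q ω) (hP : HasSum p 1) (hQ : HasSum q 1) :
    cDiv f p q = nDiv g (ENNReal.ofReal (g 0)) L p q := by
  refine cDiv_eq_nDiv hp hq hP hQ h.eq (fun t ht => h.nonneg t ht.le) ?_ h.slope_eq
  rw [h.limZero_eq, EReal.coe_ennreal_ofReal, max_eq_left (h.nonneg 0 le_rfl), EReal.coe_sub]

/-- With `L₀ = g 0` the case `p = 0` is absorbed into `q g(p / q)`. When `L = ∞` the default value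
`L.toReal = 0` is harmless, because `p` then vanishes wherever `q` does. -/
theorem nDiv_eq_tsum_ofReal (hq : ∀ ω, 0 ≤ q ω)
    (hL : L = ∞ → ∀ ω, q ω = 0 → p ω = 0) :
    nDiv g (ENNReal.ofReal (g 0)) L p q =
      ∑' ω, ENNReal.ofReal (if q ω = 0 then L.toReal * p ω else q ω * g (p ω / q ω)) := by
  unfold nDiv
  congr 1
  ext ω
  split_ifs with h1 h2
  · by_cases h : L = ∞
    · simp [hL h ω h1]
    · rw [ENNReal.ofReal_mul ENNReal.toReal_nonneg, ENNReal.ofReal_toReal h]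
  · rw [h2, zero_div, ENNReal.ofReal_mul (hq ω), mul_comm]
  · rfl

theorem IsNormalization.cDiv_eq_of_hasSum (h : IsNormalization f g c L) (hp : ∀ ω, 0 ≤ p ω)
    (hq : ∀ ω, 0 ≤ q ω) (hP : HasSum p 1) (hQ : HasSum q 1)
    (hL : L = ∞ → ∀ ω, q ω = 0 → p ω = 0) {x : ℝ}
    (hx : HasSum (fun ω => if q ω = 0 then L.toReal * p ω else q ω * g (p ω / q ω)) x) :
    cDiv f p q = (x : EReal) := by
  have h0 : ∀ ω, 0 ≤ if q ω = 0 then L.toReal * p ω else q ω * g (p ω / q ω) := fun ω => by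
    split_ifs
    · exact mul_nonneg ENNReal.toReal_nonneg (hp ω)
    · exact mul_nonneg (hq ω) (h.nonneg _ (div_nonneg (hp ω) (hq ω)))
  rw [h.cDiv_eq hp hq hP hQ, nDiv_eq_tsum_ofReal hq hL,
    ← ENNReal.ofReal_tsum_of_nonneg h0 hx.summable, hx.tsum_eq, EReal.coe_ennreal_ofReal,
    max_eq_left (hx.nonneg h0)]

theorem IsNormalization.cDiv_eq_of_hasSum_ac (h : IsNormalization f g c L) (hp : ∀ ω, 0 ≤ p ω)
    (hq : ∀ ω, 0 ≤ q ω) (hP : HasSum p 1) (hQ : HasSum q 1)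
    (hL : ∀ ω, q ω = 0 → p ω = 0) {x : ℝ}
    (hx : HasSum (fun ω => q ω * g (p ω / q ω)) x) :
    cDiv f p q = (x : EReal) := by
  refine h.cDiv_eq_of_hasSum hp hq hP hQ (fun _ => hL) (hx.congr_fun fun ω => ?_)
  split_ifs with h1
  · simp [h1, hL ω h1]
  · rfl

theorem IsNormalization.cDiv_cases (h : IsNormalization f g c ∞) (hp : ∀ ω, 0 ≤ p ω)
    (hq : ∀ ω, 0 ≤ q ω) (hP : HasSum p 1) (hQ : HasSum q 1) :
    cDiv f p q = ⊤ ∨ ∃ x : ℝ, 0 ≤ x ∧ cDiv f p q = (x : EReal) ∧ (∀ ω, q ω = 0 → p ω = 0) ∧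
      HasSum (fun ω => q ω * g (p ω / q ω)) x := by
  by_cases hN : nDiv g (ENNReal.ofReal (g 0)) ∞ p q = ∞
  · left
    rw [h.cDiv_eq hp hq hP hQ, hN, EReal.coe_ennreal_top]
  · right
    have hac : ∀ ω, q ω = 0 → p ω = 0 := fun ω hω => by
      by_contra hpω
      refine ENNReal.ne_top_of_tsum_ne_top hN ω ?_
      rw [if_pos hω, ENNReal.top_mul]
      simpa using lt_of_le_of_ne (hp ω) (Ne.symm hpω)
    have h0 : ∀ ω, 0 ≤ q ω * g (p ω / q ω) := fun ω =>
      mul_nonneg (hq ω) (h.nonneg _ (div_nonneg (hp ω) (hq ω)))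
    have hs : Summable fun ω => q ω * g (p ω / q ω) := by
      rw [nDiv_eq_tsum_ofReal hq fun _ => hac] at hN
      refine (ENNReal.summable_toReal hN).congr fun ω => ?_
      split_ifs with h1
      · simp [h1]
      · rw [ENNReal.toReal_ofReal (h0 ω)]
    exact ⟨_, tsum_nonneg h0, h.cDiv_eq_of_hasSum_ac hp hq hP hQ hac hs.hasSum, hac, hs.hasSum⟩

theorem limZero_eq_coe {x : ℝ} (h : Tendsto f (𝓝[>] 0) (𝓝 x)) : limZero f = (x : EReal) :=
  (EReal.tendsto_coe.2 h).limUnder_eq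

theorem slopeInfty_eq_coe {x : ℝ} (h : Tendsto (fun t => f t / t) atTop (𝓝 x)) :
    slopeInfty f = (x : EReal) :=
  (EReal.tendsto_coe.2 h).limUnder_eq

theorem slopeInfty_eq_top (h : Tendsto (fun t => f t / t) atTop atTop) : slopeInfty f = ⊤ :=
  (EReal.tendsto_coe_atTop.comp h).limUnder_eq

theorem isNormalization_totalVar :
    IsNormalization (fun t => |t - 1|) (fun t => |t - 1|) 0 1 where
  eq t _ := by simp
  nonneg t _ := abs_nonneg _
  limZero_eq := by
    refine limZero_eq_coe ?_
    have : ContinuousAt (fun t : ℝ => |t - 1|) 0 := by fun_prop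
    rw [sub_zero]
    exact this.tendsto.mono_left nhdsWithin_le_nhds
  slope_eq := by
    have h : Tendsto (fun t : ℝ => |t - 1| / t) atTop (𝓝 1) := by
      have : Tendsto (fun t : ℝ => 1 - t⁻¹) atTop (𝓝 (1 - 0)) :=
        tendsto_const_nhds.sub tendsto_inv_atTop_zero
      rw [sub_zero] at this
      refine this.congr' ?_
      filter_upwards [eventually_ge_atTop 1] with t ht
      rw [abs_of_nonneg (by linarith), sub_div, div_self (by positivity), one_div]
    simpa using slopeInfty_eq_coe h

theorem isNormalization_chiSq :
    IsNormalization (fun t => (t - 1) ^ 2) (fun t => (t - 1) ^ 2) 0 ∞ where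
  eq t _ := by simp
  nonneg t _ := sq_nonneg _
  limZero_eq := by
    refine limZero_eq_coe ?_
    have : ContinuousAt (fun t : ℝ => (t - 1) ^ 2) 0 := by fun_prop
    rw [sub_zero]
    exact this.tendsto.mono_left nhdsWithin_le_nhds
  slope_eq := by
    have h : Tendsto (fun t : ℝ => (t - 1) ^ 2 / t) atTop atTop := by
      refine tendsto_atTop_mono' _ ?_ (tendsto_atTop_add_const_right atTop (-2 : ℝ) tendsto_id)
      filter_upwards [eventually_ge_atTop 1] with t ht
      rw [le_div_iff₀ (by positivity), id]
      nlinarith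
    simpa using slopeInfty_eq_top h

theorem isNormalization_hellingerSq :
    IsNormalization (fun t => 1 / 2 * (√t - 1) ^ 2) (fun t => 1 / 2 * (√t - 1) ^ 2) 0
      (ENNReal.ofReal (1 / 2)) where
  eq t _ := by simp
  nonneg t _ := by positivity
  limZero_eq := by
    refine limZero_eq_coe ?_
    have : ContinuousAt (fun t : ℝ => 1 / 2 * (√t - 1) ^ 2) 0 := by fun_prop
    rw [sub_zero]
    exact this.tendsto.mono_left nhdsWithin_le_nhds
  slope_eq := by
    have h : Tendsto (fun t : ℝ => (1 / 2 * (√t - 1) ^ 2) / t) atTop (𝓝 (1 / 2)) := by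
      have h1 : Tendsto (fun t : ℝ => (√t)⁻¹) atTop (𝓝 0) :=
        tendsto_inv_atTop_zero.comp Real.tendsto_sqrt_atTop
      have : Tendsto (fun t : ℝ => 1 / 2 * (1 - (√t)⁻¹) ^ 2) atTop (𝓝 (1 / 2 * (1 - 0) ^ 2)) :=
        ((tendsto_const_nhds.sub h1).pow 2).const_mul _
      norm_num at this ⊢
      refine this.congr' ?_
      filter_upwards [eventually_gt_atTop 0] with t ht
      have h2 := Real.sqrt_pos.2 ht
      have h3 := Real.sq_sqrt ht.le
      field_simp
      rw [h3, mul_comm]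
    rw [slopeInfty_eq_coe h, EReal.coe_ennreal_ofReal]
    norm_num

theorem mul_log_sub_add_one_nonneg {t : ℝ} (ht : 0 ≤ t) : 0 ≤ t * Real.log t - t + 1 := by
  rcases ht.eq_or_lt with rfl | ht
  · simp
  · have := Real.one_sub_inv_le_log_of_pos ht
    have h2 := mul_le_mul_of_nonneg_left this ht.le
    rw [mul_sub, mul_inv_cancel₀ ht.ne'] at h2
    linarith

theorem isNormalization_mul_log {k : ℝ} (hk : 0 < k) :
    IsNormalization (fun t => k * (t * Real.log t)) (fun t => k * (t * Real.log t - t + 1)) k ∞ where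
  eq t _ := by ring
  nonneg t ht := mul_nonneg hk.le (mul_log_sub_add_one_nonneg ht)
  limZero_eq := by
    refine limZero_eq_coe ?_
    have : ContinuousAt (fun t : ℝ => k * (t * Real.log t)) 0 :=
      (Real.continuous_mul_log.const_mul k).continuousAt
    have h2 := this.tendsto.mono_left (nhdsWithin_le_nhds (s := Ioi 0))
    simpa using h2
  slope_eq := by
    have h : Tendsto (fun t : ℝ => k * (t * Real.log t) / t) atTop atTop := by
      refine (Real.tendsto_log_atTop.const_mul_atTop hk).congr' ?_
      filter_upwards [eventually_gt_atTop 0] with t ht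
      field_simp
    simpa using slopeInfty_eq_top h

theorem isNormalization_rpow_of_one_lt {α : ℝ} (hα : 1 < α) :
    IsNormalization (fun t => t ^ α) (fun t => t ^ α) 0 ∞ where
  eq t _ := by simp
  nonneg t ht := Real.rpow_nonneg ht _
  limZero_eq := by
    refine limZero_eq_coe ?_
    have : ContinuousAt (fun t : ℝ => t ^ α) 0 :=
      Real.continuousAt_rpow_const _ _ (Or.inr (by linarith))
    rw [sub_zero]
    exact this.tendsto.mono_left nhdsWithin_le_nhds
  slope_eq := by
    have h : Tendsto (fun t : ℝ => t ^ α / t) atTop atTop := by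
      refine (tendsto_rpow_atTop (y := α - 1) (by linarith)).congr' ?_
      filter_upwards [eventually_gt_atTop 0] with t ht
      rw [Real.rpow_sub_one ht.ne']
    simpa using slopeInfty_eq_top h

theorem tendsto_rpow_div_self_of_lt_one {α : ℝ} (hα : α < 1) :
    Tendsto (fun t : ℝ => t ^ α / t) atTop (𝓝 0) := by
  refine (tendsto_rpow_neg_atTop (y := 1 - α) (by linarith)).congr' ?_
  filter_upwards [eventually_gt_atTop 0] with t ht
  rw [neg_sub, Real.rpow_sub_one ht.ne']

theorem isNormalization_rpow_of_lt_one {α : ℝ} (h0 : 0 < α) (hα : α < 1) :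
    IsNormalization (fun t => t ^ α) (fun t => t ^ α) 0 0 where
  eq t _ := by simp
  nonneg t ht := Real.rpow_nonneg ht _
  limZero_eq := by
    refine limZero_eq_coe ?_
    have : ContinuousAt (fun t : ℝ => t ^ α) 0 :=
      Real.continuousAt_rpow_const _ _ (Or.inr h0.le)
    rw [sub_zero]
    exact this.tendsto.mono_left nhdsWithin_le_nhds
  slope_eq := by
    simpa using slopeInfty_eq_coe (tendsto_rpow_div_self_of_lt_one hα)

theorem limZero_hellingerAlpha {α : ℝ} (h0 : 0 < α) :
    limZero (fun t => (t ^ α - 1) / (α - 1)) = ((-1 / (α - 1) : ℝ) : EReal) := by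
  refine limZero_eq_coe ?_
  have : ContinuousAt (fun t : ℝ => (t ^ α - 1) / (α - 1)) 0 :=
    ((Real.continuousAt_rpow_const _ _ (Or.inr h0.le)).sub continuousAt_const).div_const _
  have h2 := this.tendsto.mono_left (nhdsWithin_le_nhds (s := Ioi 0))
  simpa [Real.zero_rpow h0.ne'] using h2

/-- The constant `α / (α - 1)` is the derivative of `f` at `1`, and nonnegativity of the normalized
function is Bernoulli's inequality. -/
theorem isNormalization_hellingerAlpha_of_one_lt {α : ℝ} (hα : 1 < α) :
    IsNormalization (fun t => (t ^ α - 1) / (α - 1))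
      (fun t => (t ^ α - 1) / (α - 1) - α / (α - 1) * (t - 1)) (α / (α - 1)) ∞ where
  eq t _ := by ring
  nonneg t ht := by
    have h := one_add_mul_self_le_rpow_one_add (s := t - 1) (by linarith) hα.le
    rw [add_sub_cancel] at h
    rw [div_mul_eq_mul_div, ← sub_div]
    exact div_nonneg (by linarith) (by linarith)
  limZero_eq := by
    rw [limZero_hellingerAlpha (by linarith)]
    congr 1
    rw [Real.zero_rpow (by linarith)]
    ring
  slope_eq := by
    have h1 : Tendsto (fun t : ℝ => t ^ α / t) atTop atTop := by
      refine (tendsto_rpow_atTop (y := α - 1) (by linarith)).congr' ?_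
      filter_upwards [eventually_gt_atTop 0] with t ht
      rw [Real.rpow_sub_one ht.ne']
    have h2 : Tendsto (fun t : ℝ => t ^ α / t + -1) atTop atTop :=
      tendsto_atTop_add_const_right _ _ h1
    have h : Tendsto (fun t : ℝ => (t ^ α - 1) / (α - 1) / t) atTop atTop := by
      refine tendsto_atTop_mono' _ ?_ (h2.atTop_div_const (r := α - 1) (by linarith))
      filter_upwards [eventually_ge_atTop 1] with t ht
      rw [div_right_comm]
      refine div_le_div_of_nonneg_right ?_ (by linarith)
      rw [sub_div]
      have : 1 / t ≤ 1 := by rw [div_le_one (by linarith)]; exact ht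
      linarith
    rw [slopeInfty_eq_top h]
    simp

theorem isNormalization_hellingerAlpha_of_lt_one {α : ℝ} (h0 : 0 < α) (hα : α < 1) :
    IsNormalization (fun t => (t ^ α - 1) / (α - 1))
      (fun t => (t ^ α - 1) / (α - 1) - α / (α - 1) * (t - 1)) (α / (α - 1))
      (ENNReal.ofReal (α / (1 - α))) where
  eq t _ := by ring
  nonneg t ht := by
    have h := rpow_one_add_le_one_add_mul_self (s := t - 1) (by linarith) h0.le hα.le
    rw [add_sub_cancel] at h
    rw [div_mul_eq_mul_div, ← sub_div]
    exact div_nonneg_of_nonpos (by linarith) (by linarith)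
  limZero_eq := by
    rw [limZero_hellingerAlpha h0]
    congr 1
    rw [Real.zero_rpow h0.ne']
    ring
  slope_eq := by
    have h : Tendsto (fun t : ℝ => (t ^ α - 1) / (α - 1) / t) atTop (𝓝 ((0 - 0) / (α - 1))) := by
      have h2 := ((tendsto_rpow_div_self_of_lt_one hα).sub tendsto_inv_atTop_zero).div_const (α - 1)
      refine h2.congr fun t => ?_
      rw [div_right_comm, sub_div (t ^ α), one_div]
    rw [slopeInfty_eq_coe h, EReal.coe_ennreal_ofReal,
      max_eq_left (div_nonneg h0.le (by linarith)), ← EReal.coe_add]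
    congr 1
    have h1 : α - 1 ≠ 0 := by linarith
    have h2 : 1 - α ≠ 0 := by linarith
    field_simp
    ring

end Normalization

/-! ### One-variable inequalities by second derivatives -/

section OneVariable

/-- A function with a critical zero at `1` and nonnegative second derivative is nonnegative. -/
theorem nonneg_of_second_deriv_nonneg {k k' k'' : ℝ → ℝ} (h1 : ∀ t, 0 < t → HasDerivAt k (k' t) t)
    (h2 : ∀ t, 0 < t → HasDerivAt k' (k'' t) t) (h3 : ∀ t, 0 < t → 0 ≤ k'' t) (hk : k 1 = 0)
    (hk' : k' 1 = 0) {t : ℝ} (ht : 0 < t) : 0 ≤ k t := by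
  have hmono : MonotoneOn k' (Ioi 0) := by
    refine monotoneOn_of_deriv_nonneg (convex_Ioi 0)
      (fun s hs => (h2 s hs).continuousAt.continuousWithinAt) ?_ ?_
    · rw [interior_Ioi]
      exact fun s hs => (h2 s hs).differentiableAt.differentiableWithinAt
    · rw [interior_Ioi]
      intro s hs
      rw [(h2 s hs).deriv]
      exact h3 s hs
  rcases le_total 1 t with h | h
  · have hm : MonotoneOn k (Icc 1 t) := by
      refine monotoneOn_of_deriv_nonneg (convex_Icc 1 t)
        (fun s hs => (h1 s (by linarith [hs.1])).continuousAt.continuousWithinAt) ?_ ?_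
      · intro s hs
        rw [interior_Icc] at hs
        exact (h1 s (by linarith [hs.1])).differentiableAt.differentiableWithinAt
      · intro s hs
        rw [interior_Icc] at hs
        have hs0 : 0 < s := by linarith [hs.1]
        rw [(h1 s hs0).deriv, ← hk']
        exact hmono (mem_Ioi.2 one_pos) hs0 hs.1.le
    rw [← hk]
    exact hm ⟨le_rfl, h⟩ ⟨h, le_rfl⟩ h
  · have hm : AntitoneOn k (Icc t 1) := by
      refine antitoneOn_of_deriv_nonpos (convex_Icc t 1)
        (fun s hs => (h1 s (by linarith [hs.1])).continuousAt.continuousWithinAt) ?_ ?_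
      · intro s hs
        rw [interior_Icc] at hs
        exact (h1 s (by linarith [hs.1])).differentiableAt.differentiableWithinAt
      · intro s hs
        rw [interior_Icc] at hs
        have hs0 : 0 < s := by linarith [hs.1]
        rw [(h1 s hs0).deriv, ← hk']
        exact hmono hs0 (mem_Ioi.2 one_pos) hs.2.le
    rw [← hk]
    exact hm ⟨le_rfl, h⟩ ⟨h, le_rfl⟩ h

/-- The three functions have second derivatives `t⁻²`, `t⁻¹` and `1`, so the combination has the
perfect square `(t⁻¹ - c)²`. Their divergences are `D(q‖p)`, `D(p‖q)` and `χ² / 2`. -/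
theorem kl_chi_one_var (c : ℝ) {t : ℝ} (ht : 0 < t) :
    0 ≤ (t - 1 - Real.log t) - 2 * c * (t * Real.log t - t + 1) + c ^ 2 * ((t - 1) ^ 2 / 2) := by
  refine nonneg_of_second_deriv_nonneg
    (k := fun t => (t - 1 - Real.log t) - 2 * c * (t * Real.log t - t + 1) +
      c ^ 2 * ((t - 1) ^ 2 / 2))
    (k' := fun t => (1 - t⁻¹) - 2 * c * Real.log t + c ^ 2 * (t - 1))
    (k'' := fun t => (t⁻¹ - c) ^ 2) ?_ ?_ (fun t _ => sq_nonneg _) (by simp) (by simp) ht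
  · intro s hs
    have hl := Real.hasDerivAt_log hs.ne'
    have hi := hasDerivAt_id s
    have := (((hi.sub_const 1).sub hl).sub ((((hi.mul hl).sub hi).add_const 1).const_mul (2 * c))).add
      ((((hi.sub_const 1).pow 2).div_const 2).const_mul (c ^ 2))
    refine this.congr_deriv ?_
    simp only [id]
    have := hs.ne'
    field_simp
    ring
  · intro s hs
    have hl := Real.hasDerivAt_log hs.ne'
    have hi := hasDerivAt_id s
    have := (((hasDerivAt_inv hs.ne').const_sub 1).sub (hl.const_mul (2 * c))).add
      ((hi.sub_const 1).const_mul (c ^ 2))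
    refine this.congr_deriv ?_
    have := hs.ne'
    field_simp
    ring

/-- Here the second derivatives are `t⁻¹`, `t^(-3/2)` and `t⁻²`; the factor `4` normalizes the
middle one so that the sum is `(t^(-1/2) - c t⁻¹)²`. -/
theorem kl_hellinger_one_var (c : ℝ) {t : ℝ} (ht : 0 < t) :
    0 ≤ (t * Real.log t - t + 1) - 2 * c * (4 * (1 / 2 * (√t - 1) ^ 2)) +
      c ^ 2 * (t - 1 - Real.log t) := by
  have e : ∀ s : ℝ, 0 < s → 4 * (1 / 2 * (√s - 1) ^ 2) = 2 * s - 4 * √s + 2 := fun s hs => by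
    rw [sub_sq, Real.sq_sqrt hs.le]
    ring
  rw [e t ht]
  refine nonneg_of_second_deriv_nonneg
    (k := fun t => (t * Real.log t - t + 1) - 2 * c * (2 * t - 4 * √t + 2) +
      c ^ 2 * (t - 1 - Real.log t))
    (k' := fun t => Real.log t - 2 * c * (2 - 2 * (√t)⁻¹) + c ^ 2 * (1 - t⁻¹))
    (k'' := fun t => ((√t)⁻¹ - c * t⁻¹) ^ 2) ?_ ?_ (fun t _ => sq_nonneg _) (by norm_num)
    (by norm_num) ht
  · intro s hs
    have hl := Real.hasDerivAt_log hs.ne'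
    have hi := hasDerivAt_id s
    have hq := Real.hasDerivAt_sqrt hs.ne'
    have := ((((hi.mul hl).sub hi).add_const 1).sub
      ((((hi.const_mul 2).sub (hq.const_mul 4)).add_const 2).const_mul (2 * c))).add
      (((hi.sub_const 1).sub hl).const_mul (c ^ 2))
    refine this.congr_deriv ?_
    simp only [id]
    have := hs.ne'
    have := (Real.sqrt_pos.2 hs).ne'
    field_simp
    ring
  · intro s hs
    have hl := Real.hasDerivAt_log hs.ne'
    have hq' := (Real.sqrt_pos.2 hs).ne'
    have hq := (Real.hasDerivAt_sqrt hs.ne').inv hq'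
    have := (hl.sub (((hq.const_mul 2).const_sub 2).const_mul (2 * c))).add
      (((hasDerivAt_inv hs.ne').const_sub 1).const_mul (c ^ 2))
    refine this.congr_deriv ?_
    have hs' := hs.ne'
    have e2 : √s ^ 2 = s := Real.sq_sqrt hs.le
    obtain ⟨r, hr, rfl⟩ : ∃ r, 0 < r ∧ s = r ^ 2 := ⟨√s, Real.sqrt_pos.2 hs, e2.symm⟩
    rw [Real.sqrt_sq hr.le]
    have := hr.ne'
    field_simp
    ring

end OneVariable

/-! ### Termwise inequalities for a pair of weights -/

section TwoVariable

variable {p q : ℝ}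

theorem kl_term (h : q = 0 → p = 0) :
    q * (p / q * Real.log (p / q) - p / q + 1) = p * Real.log (p / q) - p + q := by
  by_cases hq : q = 0
  · simp [hq, h hq]
  · field_simp

theorem chi_term (h : q = 0 → p = 0) : q * (p / q - 1) ^ 2 = (p - q) ^ 2 / q := by
  by_cases hq : q = 0
  · simp [hq, h hq]
  · field_simp

theorem hellinger_term (hp : 0 ≤ p) (hq : 0 < q) :
    q * (1 / 2 * (√(p / q) - 1) ^ 2) = 1 / 2 * (√p - √q) ^ 2 := by
  have h1 := Real.sqrt_pos.2 hq
  have h2 := Real.sq_sqrt hq.le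
  rw [Real.sqrt_div hp]
  field_simp
  rw [h2]

theorem kl_chi_two_var (c : ℝ) (hp : 0 ≤ p) (hq : 0 ≤ q) (h1 : q = 0 → p = 0) (h2 : p = 0 → q = 0) :
    0 ≤ (q * Real.log (q / p) - q + p) - 2 * c * (p * Real.log (p / q) - p + q) +
      c ^ 2 * ((p - q) ^ 2 / q / 2) := by
  rcases hq.eq_or_lt with h | hq'
  · simp [← h, h1 h.symm]
  · have hp' : 0 < p := lt_of_le_of_ne hp fun h => hq'.ne' (h2 h.symm)
    have := mul_nonneg hq (kl_chi_one_var c (div_pos hp' hq'))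
    have e : Real.log (q / p) = -Real.log (p / q) := by rw [← Real.log_inv, inv_div]
    rw [e]
    refine this.trans_eq ?_
    field_simp
    ring

theorem kl_hellinger_two_var (c : ℝ) (hp : 0 ≤ p) (hq : 0 ≤ q) (h1 : q = 0 → p = 0)
    (h2 : p = 0 → q = 0) :
    0 ≤ (p * Real.log (p / q) - p + q) - 2 * c * (4 * (1 / 2 * (√p - √q) ^ 2)) +
      c ^ 2 * (q * Real.log (q / p) - q + p) := by
  rcases hq.eq_or_lt with h | hq'
  · simp [← h, h1 h.symm]
  · have hp' : 0 < p := lt_of_le_of_ne hp fun h => hq'.ne' (h2 h.symm)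
    have := mul_nonneg hq (kl_hellinger_one_var c (div_pos hp' hq'))
    have e : Real.log (q / p) = -Real.log (p / q) := by rw [← Real.log_inv, inv_div]
    rw [e, ← hellinger_term hp hq']
    refine this.trans_eq ?_
    field_simp
    ring

theorem kl_le_chi_two_var (hp : 0 ≤ p) (hq : 0 ≤ q) (h1 : q = 0 → p = 0) :
    p * Real.log (p / q) - p + q ≤ (p - q) ^ 2 / q := by
  rcases hq.eq_or_lt with h | hq'
  · simp [← h, h1 h.symm]
  rcases hp.eq_or_lt with h | hp'
  · rw [← h]
    field_simp
    simp [sq]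
  · have h3 := mul_le_mul_of_nonneg_left (Real.log_le_sub_one_of_pos (div_pos hp' hq')) hp
    have e : (p - q) ^ 2 / q = p * (p / q - 1) - p + q := by
      field_simp
      ring
    linarith

/-- The tangent of `log` at `m`, multiplied by `p`, with `p² / q` rewritten as `(p - q)² / q + 2 p -
q`. Choosing `m = 1 + χ²`, the total of `p² / q`, turns the sum into Jensen's inequality. -/
theorem kl_le_log_two_var {m : ℝ} (hm : 0 < m) (hp : 0 ≤ p) (hq : 0 ≤ q) (h1 : q = 0 → p = 0) :
    p * Real.log (p / q) - p + q ≤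
      ((p - q) ^ 2 / q + 2 * p - q) / m + p * (Real.log m - 2) + q := by
  rcases hq.eq_or_lt with h | hq'
  · simp [← h, h1 h.symm]
  rcases hp.eq_or_lt with h | hp'
  · rw [← h]
    field_simp
    simp
    linarith
  · have h3 := mul_le_mul_of_nonneg_left
      (Real.log_le_sub_one_of_pos (div_pos (div_pos hp' hq') hm)) hp
    rw [Real.log_div (div_pos hp' hq').ne' hm.ne'] at h3
    have e : ((p - q) ^ 2 / q + 2 * p - q) / m = p * (p / q / m) := by
      field_simp
      ring
    rw [e]
    linarith

theorem kl_le_tv_chi_two_var (hp : 0 ≤ p) (hq : 0 ≤ q) (h1 : q = 0 → p = 0) :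
    p * Real.log (p / q) - p + q ≤ 1 / 2 * |p - q| + 1 / 2 * ((p - q) ^ 2 / q) := by
  rcases hq.eq_or_lt with h | hq'
  · simp [← h, h1 h.symm]
  rcases hp.eq_or_lt with h | hp'
  · rw [← h]
    have : (0 - q) ^ 2 / q = q := by field_simp; simp
    rw [this, zero_sub, abs_neg, abs_of_pos hq']
    linarith
  · have hl := Real.log_le_sub_one_of_pos (div_pos hp' hq')
    rcases le_total p q with h | h
    · rw [abs_of_nonpos (by linarith)]
      have h3 := mul_le_mul_of_nonneg_left hl hp
      have e : p * (p / q - 1) = (p - q) ^ 2 / q + (p - q) := by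
        field_simp
        ring
      have h5 : (p - q) ^ 2 / q ≤ q - p := by
        rw [div_le_iff₀ hq']
        nlinarith
      linarith
    · rw [abs_of_nonneg (by linarith)]
      -- For large `p / q` the bound `log t ≤ t - 1` is too weak. Applying it to `√t` instead leaves
      -- the polynomial inequality `h4`.
      set s := √(p / q) with hs
      have hs2 : s ^ 2 = p / q := Real.sq_sqrt (div_pos hp' hq').le
      have hpq : p = s ^ 2 * q := by rw [hs2]; field_simp
      have hs1 : 1 ≤ s := by
        rw [hs, Real.one_le_sqrt, le_div_iff₀ hq']
        linarith
      have hlog : Real.log (p / q) = 2 * Real.log s := by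
        rw [← hs2, Real.log_pow]
        norm_num
      have hls := Real.log_le_sub_one_of_pos (by linarith : 0 < s)
      have h3 := mul_le_mul_of_nonneg_left hls hp
      have e : (p - q) ^ 2 / q = q * (s ^ 2 - 1) ^ 2 := by
        rw [hpq]
        field_simp
      rw [hlog, e]
      have h4 : 0 ≤ (s - 1) * (s ^ 3 / 2 - 3 / 2 * s ^ 2 + s + 1) := by
        refine mul_nonneg (by linarith) ?_
        nlinarith [mul_nonneg (by linarith : 0 ≤ s) (sq_nonneg (s - 3 / 2)), sq_nonneg (s - 2)]
      have h5 := mul_nonneg hq h4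
      rw [hpq] at h3 ⊢
      nlinarith

/-- A supporting function of the convex homogeneous `(p - q) log (p / q)` at the ratios `k` and `1 /
k`. After factoring out `k`, `log y ≤ y - 1` handles the term with `-q` and `log y ≥ 1 - y⁻¹` the
term with `p`. -/
theorem sub_mul_log_ge {k : ℝ} (hk : 1 ≤ k) (hp : 0 < p) (hq : 0 < q) :
    (Real.log k + 1 - 1 / k + (k - 1) ^ 2 / (2 * k)) * |p - q| - (k - 1) ^ 2 / (2 * k) * (p + q) ≤
      (p - q) * Real.log (p / q) := by
  have hk0 : 0 < k := by linarith
  have main : ∀ p q : ℝ, 0 < p → 0 < q →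
      (Real.log k + 1 - 1 / k + (k - 1) ^ 2 / (2 * k)) * (p - q) -
        (k - 1) ^ 2 / (2 * k) * (p + q) ≤ (p - q) * Real.log (p / q) := by
    intro p q hp hq
    have h1 := Real.log_le_sub_one_of_pos (div_pos (div_pos hp hq) hk0)
    have h2 := Real.one_sub_inv_le_log_of_pos (div_pos (div_pos hp hq) hk0)
    rw [Real.log_div (div_pos hp hq).ne' hk0.ne'] at h1 h2
    have h3 := mul_le_mul_of_nonneg_left h1 hq.le
    have h4 := mul_le_mul_of_nonneg_left h2 hp.le
    have e3 : q * (p / q / k - 1) = p / k - q := by field_simp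
    have e4 : p * (1 - (p / q / k)⁻¹) = p - k * q := by field_simp
    have e5 : (Real.log k + 1 - 1 / k + (k - 1) ^ 2 / (2 * k)) * (p - q) -
        (k - 1) ^ 2 / (2 * k) * (p + q) = Real.log k * (p - q) + p - k * q - p / k + q := by
      field_simp
      ring
    rw [e3] at h3
    rw [e4] at h4
    rw [e5]
    linarith
  rcases le_total q p with h | h
  · rw [abs_of_nonneg (by linarith)]
    exact main p q hp hq
  · rw [abs_of_nonpos (by linarith)]
    have := main q p hq hp
    rw [← inv_div p q, Real.log_inv] at this
    linarith

/-- In terms of `d = |p - q|` and `s = p + q` the right side is `4 s / (1 - (d / s)²) - 4 s`. It is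
bounded below by the tangent at `d / s = w`, found by linearizing `1 / m` at `1 - w²` and then `(d /
s)²` at `w`. -/
theorem chi_add_chi_ge (w : ℝ) (hp : 0 < p) (hq : 0 < q) :
    4 * ((2 * (1 / (1 - w ^ 2)) - (1 / (1 - w ^ 2)) ^ 2 * (1 + w ^ 2)) * (p + q) +
      2 * (1 / (1 - w ^ 2)) ^ 2 * w * |p - q|) - 4 * (p + q) ≤
      (p - q) ^ 2 / q + (p - q) ^ 2 / p := by
  set c := 1 / (1 - w ^ 2) with hc
  set s := p + q with hs
  set d := |p - q| with hd
  have hs0 : 0 < s := by positivity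
  have hd2 : d ^ 2 = s ^ 2 - 4 * p * q := by
    rw [hd, sq_abs]
    ring
  have hm : 0 < 4 * p * q / s ^ 2 := by positivity
  set m := 4 * p * q / s ^ 2 with hmdef
  have e1 : (p - q) ^ 2 / q + (p - q) ^ 2 / p = 4 * s * (1 / m) - 4 * s := by
    rw [hmdef]
    field_simp
    rw [hs]
    ring
  have h1 : 2 * c - c ^ 2 * m ≤ 1 / m := by
    rw [le_div_iff₀ hm]
    nlinarith [sq_nonneg (c * m - 1)]
  have h2 : m ≤ 1 - (2 * w * (d / s) - w ^ 2) := by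
    have e2 : m = 1 - (d / s) ^ 2 := by
      rw [hmdef, div_pow, hd2]
      field_simp
      ring
    nlinarith [sq_nonneg (d / s - w)]
  have h3 : 2 * c - c ^ 2 * (1 - (2 * w * (d / s) - w ^ 2)) ≤ 1 / m := by
    nlinarith [sq_nonneg c, mul_le_mul_of_nonneg_left h2 (sq_nonneg c)]
  have h4 := mul_le_mul_of_nonneg_left h3 (by positivity : 0 ≤ 4 * s)
  rw [e1]
  have e3 : 4 * s * (2 * c - c ^ 2 * (1 - (2 * w * (d / s) - w ^ 2))) =
      4 * ((2 * c - c ^ 2 * (1 + w ^ 2)) * s + 2 * c ^ 2 * w * d) := by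
    field_simp
    ring
  linarith

/-- With `t = p / q` the gap is `q (t - 1 - c)²` for `t ≥ 1` and `q (t² + (c² - 1) t)` for `t ≤ 1`.
It closes at `t = 0` and `t = 1 + c`, the two ratios of the extremal pair; `c ≥ 1` is needed on the
second branch. -/
theorem chi_tangent {c : ℝ} (hc : 1 ≤ c) (hp : 0 ≤ p) (hq : 0 ≤ q) (h1 : q = 0 → p = 0) :
    (1 + c) ^ 2 / 2 * |p - q| + (2 * c - (1 + c) ^ 2 / 2) * p + (1 - (1 + c) ^ 2 / 2) * q ≤
      (p - q) ^ 2 / q := by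
  rcases hq.eq_or_lt with h | hq'
  · simp [← h, h1 h.symm]
  rw [le_div_iff₀ hq']
  rcases le_total q p with h | h
  · rw [abs_of_nonneg (by linarith)]
    nlinarith [sq_nonneg (p - q - c * q)]
  · rw [abs_of_nonpos (by linarith)]
    nlinarith [sq_nonneg (p - q + q), mul_nonneg (mul_nonneg hp hq) (by nlinarith : 0 ≤ c ^ 2 - 1)]

theorem abs_sub_eq_mul_sqrt (hp : 0 ≤ p) (hq : 0 ≤ q) : |p - q| = |√p - √q| * (√p + √q) := by
  have : p - q = (√p - √q) * (√p + √q) := by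
    linarith [Real.sq_sqrt hp, Real.sq_sqrt hq]
  rw [this, abs_mul, abs_of_nonneg (by positivity : 0 ≤ √p + √q)]

theorem sq_sub_sqrt_le (hp : 0 ≤ p) (hq : 0 ≤ q) : (√p - √q) ^ 2 ≤ |p - q| := by
  rw [abs_sub_eq_mul_sqrt hp hq, ← sq_abs, sq]
  refine mul_le_mul_of_nonneg_left ?_ (abs_nonneg _)
  have h1 := Real.sqrt_nonneg p
  have h2 := Real.sqrt_nonneg q
  rw [abs_le]
  constructor <;> linarith

end TwoVariable

/-- The discriminant criterion. It gives Cauchy-Schwarz for convergent series from termwise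
nonnegativity alone. -/
theorem sq_le_mul_of_quadratic {a b d : ℝ} (h : ∀ c : ℝ, 0 ≤ a - 2 * c * b + c ^ 2 * d) :
    b ^ 2 ≤ d * a := by
  have := discrim_le_zero (a := d) (b := -2 * b) (c := a) fun x => by
    have := h x
    nlinarith
  unfold discrim at this
  nlinarith

/-- A pair of probability distributions on a discrete space. -/
structure IsPair {Ω : Type*} (p q : Ω → ℝ) : Prop where
  left_nonneg : ∀ ω, 0 ≤ p ω
  right_nonneg : ∀ ω, 0 ≤ q ω
  hasSum_left : HasSum p 1
  hasSum_right : HasSum q 1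

/-! ### Inequalities between finite divergences -/

namespace IsPair

variable {Ω : Type*} {p q : Ω → ℝ} {v h d d' x x' : ℝ}

theorem symm (H : IsPair p q) : IsPair q p := ⟨H.2, H.1, H.4, H.3⟩

theorem summable_tv (H : IsPair p q) : Summable fun ω => |p ω - q ω| :=
  (H.hasSum_left.summable.sub H.hasSum_right.summable).abs

theorem hasSum_hellinger (H : IsPair p q) :
    ∃ h, HasSum (fun ω => 1 / 2 * (√(p ω) - √(q ω)) ^ 2) h :=
  ⟨_, ((H.summable_tv.of_nonneg_of_le (fun _ => sq_nonneg _) fun ω =>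
    sq_sub_sqrt_le (H.1 ω) (H.2 ω)).mul_left (1 / 2)).hasSum⟩

theorem tv_le_two (H : IsPair p q) (hv : HasSum (fun ω => |p ω - q ω|) v) : v ≤ 2 := by
  have := hasSum_le (fun ω => ?_) hv (H.hasSum_left.add H.hasSum_right)
  · linarith
  · have h1 := H.1 ω
    have h2 := H.2 ω
    rw [abs_le]
    constructor <;> linarith

/-- Absolute continuity provides a point where both weights are positive, and there `|p - q| < p +
q` strictly. By contraposition `V = 2` forces `D` and `χ²` to be infinite. -/
theorem tv_lt_two (H : IsPair p q) (hac : ∀ ω, q ω = 0 → p ω = 0)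
    (hv : HasSum (fun ω => |p ω - q ω|) v) : v < 2 := by
  have h0 : ∃ ω, p ω ≠ 0 := by
    by_contra! hp
    have := H.hasSum_left
    rw [show p = fun _ => 0 from funext hp] at this
    exact zero_ne_one (hasSum_zero.unique this)
  obtain ⟨ω, hω⟩ := h0
  have h1 : 0 < p ω := lt_of_le_of_ne (H.1 ω) (Ne.symm hω)
  have h2 : 0 < q ω := lt_of_le_of_ne (H.2 ω) fun h => hω (hac ω h.symm)
  have := hasSum_lt (i := ω) (fun ω => ?_) ?_ hv (H.hasSum_left.add H.hasSum_right)
  · linarith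
  · have h1 := H.1 ω
    have h2 := H.2 ω
    simp only [abs_le]
    constructor <;> linarith
  · simp only [abs_lt]
    constructor <;> linarith

theorem hellinger_le (H : IsPair p q) (hv : HasSum (fun ω => |p ω - q ω|) v)
    (hh : HasSum (fun ω => 1 / 2 * (√(p ω) - √(q ω)) ^ 2) h) : h ≤ v / 2 := by
  have := hasSum_le (fun ω => ?_) hh (hv.mul_left (1 / 2))
  · linarith
  · exact mul_le_mul_of_nonneg_left (sq_sub_sqrt_le (H.1 ω) (H.2 ω)) (by norm_num)

/-- Cauchy-Schwarz for `|p - q| = |√p - √q| (√p + √q)`, where the squares of the factors sum to `2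
h` and `4 - 2 h`. -/
theorem tv_le (H : IsPair p q) (hv : HasSum (fun ω => |p ω - q ω|) v)
    (hh : HasSum (fun ω => 1 / 2 * (√(p ω) - √(q ω)) ^ 2) h) : v / 2 ≤ √h * √(2 - h) := by
  have hh0 : 0 ≤ h := hh.nonneg fun ω => by positivity
  have hv0 : 0 ≤ v := hv.nonneg fun ω => abs_nonneg _
  have hs : HasSum (fun ω => (√(p ω) + √(q ω)) ^ 2) (4 - 2 * h) := by
    have h1 := ((H.hasSum_left.add H.hasSum_right).mul_left 2).sub (hh.mul_left 2)
    rw [show (4 : ℝ) - 2 * h = 2 * (1 + 1) - 2 * h by norm_num]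
    refine h1.congr_fun fun ω => ?_
    nlinarith [Real.sq_sqrt (H.1 ω), Real.sq_sqrt (H.2 ω)]
  have key := sq_le_mul_of_quadratic (a := 2 * h) (b := v) (d := 4 - 2 * h) fun c => by
    have h1 := ((hh.mul_left 2).sub (hv.mul_left (2 * c))).add (hs.mul_left (c ^ 2))
    refine h1.nonneg fun ω => ?_
    rw [abs_sub_eq_mul_sqrt (H.1 ω) (H.2 ω)]
    nlinarith [sq_nonneg (|√(p ω) - √(q ω)| - c * (√(p ω) + √(q ω))),
      sq_abs (√(p ω) - √(q ω))]
  rw [← Real.sqrt_mul hh0]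
  refine Real.le_sqrt_of_sq_le ?_
  linarith

theorem sq_tv_le_chi (H : IsPair p q) (hac : ∀ ω, q ω = 0 → p ω = 0)
    (hv : HasSum (fun ω => |p ω - q ω|) v) (hx : HasSum (fun ω => (p ω - q ω) ^ 2 / q ω) x) :
    v ^ 2 ≤ x := by
  have key := sq_le_mul_of_quadratic (a := x) (b := v) (d := 1) fun c => by
    have h1 := (hx.sub (hv.mul_left (2 * c))).add (H.hasSum_right.mul_left (c ^ 2))
    refine h1.nonneg fun ω => ?_
    rcases (H.2 ω).eq_or_lt with h | h
    · simp [← h, hac ω h.symm]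
    · have : (p ω - q ω) ^ 2 / q ω - 2 * c * |p ω - q ω| + c ^ 2 * q ω =
          (|p ω - q ω| - c * q ω) ^ 2 / q ω := by
        rw [← sq_abs (p ω - q ω)]
        field_simp
        ring
      rw [this]
      positivity
  linarith

/-- Sums `chi_tangent` with `c = v / (2 - v)`. A pair whose ratios are only `0` and `1 + c` has
total variation `2 c / (1 + c) = v` and `χ² = c`. -/
theorem div_tv_le_chi (H : IsPair p q) (hac : ∀ ω, q ω = 0 → p ω = 0)
    (hv : HasSum (fun ω => |p ω - q ω|) v) (hx : HasSum (fun ω => (p ω - q ω) ^ 2 / q ω) x)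
    (h1 : 1 < v) (h2 : v < 2) : v / (2 - v) ≤ x := by
  have h3 : 0 < 2 - v := by linarith
  have hc : 1 ≤ v / (2 - v) := by
    rw [le_div_iff₀ h3]
    linarith
  have := hasSum_le (fun ω => chi_tangent hc (H.1 ω) (H.2 ω) (hac ω))
    (((hv.mul_left _).add (H.hasSum_left.mul_left _)).add (H.hasSum_right.mul_left _)) hx
  refine le_trans (le_of_eq ?_) this
  field_simp
  ring

theorem summable_kl_of_chi (H : IsPair p q) (hac : ∀ ω, q ω = 0 → p ω = 0)
    (hx : Summable fun ω => (p ω - q ω) ^ 2 / q ω) :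
    Summable fun ω => p ω * Real.log (p ω / q ω) - p ω + q ω :=
  hx.of_nonneg_of_le (fun ω => by
      rw [← kl_term (hac ω)]
      exact mul_nonneg (H.2 ω) (mul_log_sub_add_one_nonneg (div_nonneg (H.1 ω) (H.2 ω))))
    fun ω => kl_le_chi_two_var (H.1 ω) (H.2 ω) (hac ω)

theorem kl_le_log (H : IsPair p q) (hac : ∀ ω, q ω = 0 → p ω = 0)
    (hd : HasSum (fun ω => p ω * Real.log (p ω / q ω) - p ω + q ω) d)
    (hx : HasSum (fun ω => (p ω - q ω) ^ 2 / q ω) x) (hx0 : 0 ≤ x) : d ≤ Real.log (1 + x) := by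
  have hm : 0 < 1 + x := by linarith
  have := hasSum_le (fun ω => kl_le_log_two_var hm (H.1 ω) (H.2 ω) (hac ω)) hd
    (((((hx.add (H.hasSum_left.mul_left 2)).sub H.hasSum_right).div_const (1 + x)).add
      (H.hasSum_left.mul_right (Real.log (1 + x) - 2))).add H.hasSum_right)
  have e : (x + 2 * 1 - 1) / (1 + x) = 1 := by
    field_simp
    ring
  rw [e] at this
  linarith

theorem kl_le_tv_chi (H : IsPair p q) (hac : ∀ ω, q ω = 0 → p ω = 0)
    (hd : HasSum (fun ω => p ω * Real.log (p ω / q ω) - p ω + q ω) d)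
    (hv : HasSum (fun ω => |p ω - q ω|) v)
    (hx : HasSum (fun ω => (p ω - q ω) ^ 2 / q ω) x) : d ≤ 1 / 2 * (v + x) := by
  have := hasSum_le (fun ω => kl_le_tv_chi_two_var (H.1 ω) (H.2 ω) (hac ω)) hd
    ((hv.mul_left (1 / 2)).add (hx.mul_left (1 / 2)))
  linarith

theorem kl_chi_quadratic (H : IsPair p q) (hac : ∀ ω, q ω = 0 → p ω = 0)
    (hac' : ∀ ω, p ω = 0 → q ω = 0)
    (hd : HasSum (fun ω => p ω * Real.log (p ω / q ω) - p ω + q ω) d)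
    (hd' : HasSum (fun ω => q ω * Real.log (q ω / p ω) - q ω + p ω) d')
    (hx : HasSum (fun ω => (p ω - q ω) ^ 2 / q ω) x) (c : ℝ) :
    0 ≤ d' - 2 * c * d + c ^ 2 * (x / 2) :=
  ((hd'.sub (hd.mul_left (2 * c))).add ((hx.div_const 2).mul_left (c ^ 2))).nonneg fun ω =>
    kl_chi_two_var c (H.1 ω) (H.2 ω) (hac ω) (hac' ω)

theorem kl_hellinger_quadratic (H : IsPair p q) (hac : ∀ ω, q ω = 0 → p ω = 0)
    (hac' : ∀ ω, p ω = 0 → q ω = 0)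
    (hd : HasSum (fun ω => p ω * Real.log (p ω / q ω) - p ω + q ω) d)
    (hd' : HasSum (fun ω => q ω * Real.log (q ω / p ω) - q ω + p ω) d')
    (hh : HasSum (fun ω => 1 / 2 * (√(p ω) - √(q ω)) ^ 2) h) (c : ℝ) :
    0 ≤ d - 2 * c * (4 * h) + c ^ 2 * d' :=
  ((hd.sub ((hh.mul_left 4).mul_left (2 * c))).add (hd'.mul_left (c ^ 2))).nonneg fun ω =>
    kl_hellinger_two_var c (H.1 ω) (H.2 ω) (hac ω) (hac' ω)

theorem tv_log_le_kl_add_kl (H : IsPair p q) (hac : ∀ ω, q ω = 0 → p ω = 0)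
    (hac' : ∀ ω, p ω = 0 → q ω = 0)
    (hd : HasSum (fun ω => p ω * Real.log (p ω / q ω) - p ω + q ω) d)
    (hd' : HasSum (fun ω => q ω * Real.log (q ω / p ω) - q ω + p ω) d')
    (hv : HasSum (fun ω => |p ω - q ω|) v) (hv0 : 0 ≤ v) (hv2 : v < 2) :
    v * Real.log ((2 + v) / (2 - v)) ≤ d + d' := by
  have h3 : 0 < 2 - v := by linarith
  have h4 : 0 < 2 + v := by linarith
  have hk : 1 ≤ (2 + v) / (2 - v) := by
    rw [le_div_iff₀ h3]
    linarith
  -- This is the ratio of the two-point pair with weights `(2 ± v) / 4`. For it everything except `v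
  -- log k` cancels in the summed bound.
  set k := (2 + v) / (2 - v) with hkdef
  have := hasSum_le (fun ω => ?_)
    ((hv.mul_left (Real.log k + 1 - 1 / k + (k - 1) ^ 2 / (2 * k))).sub
      ((H.hasSum_left.add H.hasSum_right).mul_left ((k - 1) ^ 2 / (2 * k)))) (hd.add hd')
  · refine le_trans (le_of_eq ?_) this
    have e : (1 - 1 / k + (k - 1) ^ 2 / (2 * k)) * v - (k - 1) ^ 2 / (2 * k) * (1 + 1) = 0 := by
      rw [hkdef]
      field_simp
      ring
    linear_combination -e
  · rcases (H.2 ω).eq_or_lt with h | hq'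
    · simp [← h, hac ω h.symm]
    · have hp' : 0 < p ω := lt_of_le_of_ne (H.1 ω) fun h => hq'.ne' (hac' ω h.symm)
      refine (sub_mul_log_ge hk hp' hq').trans_eq ?_
      have e : Real.log (q ω / p ω) = -Real.log (p ω / q ω) := by rw [← Real.log_inv, inv_div]
      rw [e]
      ring

theorem tv_le_chi_add_chi (H : IsPair p q) (hac : ∀ ω, q ω = 0 → p ω = 0)
    (hac' : ∀ ω, p ω = 0 → q ω = 0) (hx : HasSum (fun ω => (p ω - q ω) ^ 2 / q ω) x)
    (hx' : HasSum (fun ω => (q ω - p ω) ^ 2 / p ω) x')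
    (hv : HasSum (fun ω => |p ω - q ω|) v) (hv0 : 0 ≤ v) (hv2 : v < 2) :
    8 * v ^ 2 / (4 - v ^ 2) ≤ x + x' := by
  -- The average of `|p - q| / (p + q)` with weight `(p + q) / 2` is `v / 2`, so the tangent at this
  -- point gives Jensen's bound.
  set w := v / 2 with hw
  have h1 : 0 < 1 - w ^ 2 := by nlinarith
  have := hasSum_le (fun ω => ?_)
    (((((H.hasSum_left.add H.hasSum_right).mul_left
      (2 * (1 / (1 - w ^ 2)) - (1 / (1 - w ^ 2)) ^ 2 * (1 + w ^ 2))).add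
      (hv.mul_left (2 * (1 / (1 - w ^ 2)) ^ 2 * w))).mul_left 4).sub
      ((H.hasSum_left.add H.hasSum_right).mul_left 4)) (hx.add hx')
  · refine le_trans (le_of_eq ?_) this
    have h2 : v = 2 * w := by rw [hw]; ring
    rw [h2]
    have h3 : 4 - (2 * w) ^ 2 = 4 * (1 - w ^ 2) := by ring
    rw [h3]
    field_simp
    ring
  · rcases (H.2 ω).eq_or_lt with h | hq'
    · simp [← h, hac ω h.symm]
    · have hp' : 0 < p ω := lt_of_le_of_ne (H.1 ω) fun h => hq'.ne' (hac' ω h.symm)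
      refine (chi_add_chi_ge w hp' hq').trans_eq ?_
      rw [← neg_sub (q ω) (p ω), neg_sq]

theorem eq_of_chi_eq_zero (H : IsPair p q) (hac : ∀ ω, q ω = 0 → p ω = 0)
    (hx : HasSum (fun ω => (p ω - q ω) ^ 2 / q ω) 0) : p = q := by
  have h := (hasSum_zero_iff_of_nonneg fun ω => div_nonneg (sq_nonneg _) (H.2 ω)).1 hx
  funext ω
  have h1 := congrFun h ω
  rcases (H.2 ω).eq_or_lt with h2 | h2
  · rw [← h2, hac ω h2.symm]
  · simp only [Pi.zero_apply, div_eq_zero_iff, h2.ne', or_false, sq_eq_zero_iff, sub_eq_zero] at h1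
    exact h1

/-- All terms vanish, and `log y < y - 1` for `y ≠ 1` forces equality. This excludes `0 * ∞` in
products: if one relative entropy is zero, the reversed one is zero too. -/
theorem eq_of_kl_eq_zero (H : IsPair p q) (hac : ∀ ω, q ω = 0 → p ω = 0)
    (hd : HasSum (fun ω => p ω * Real.log (p ω / q ω) - p ω + q ω) 0) : p = q := by
  have h := (hasSum_zero_iff_of_nonneg fun ω => by
    rw [← kl_term (hac ω)]
    exact mul_nonneg (H.2 ω) (mul_log_sub_add_one_nonneg (div_nonneg (H.1 ω) (H.2 ω)))).1 hd
  funext ω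
  have h1 := congrFun h ω
  rcases (H.2 ω).eq_or_lt with h2 | h2
  · rw [← h2, hac ω h2.symm]
  rcases (H.1 ω).eq_or_lt with h3 | h3
  · simp only [Pi.zero_apply, ← h3] at h1
    linarith
  by_contra hne
  have h4 : q ω / p ω ≠ 1 := fun h5 => hne ((div_eq_one_iff_eq h3.ne').1 h5).symm
  have h5 := mul_lt_mul_of_pos_left (Real.log_lt_sub_one_of_pos (div_pos h2 h3) h4) h3
  have e : Real.log (q ω / p ω) = -Real.log (p ω / q ω) := by rw [← Real.log_inv, inv_div]
  have e2 : p ω * (q ω / p ω - 1) = q ω - p ω := by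
    field_simp
  rw [e, e2] at h5
  simp only [Pi.zero_apply] at h1
  linarith

theorem kl_mul_kl_le (hd0 : 0 ≤ d) (hd'0 : 0 ≤ d') (hx0 : 0 ≤ x) (hx'0 : 0 ≤ x')
    (h1 : d ^ 2 ≤ x / 2 * d') (h2 : d' ^ 2 ≤ x' / 2 * d) : d * d' ≤ 1 / 4 * (x * x') := by
  rcases (mul_nonneg hd0 hd'0).eq_or_lt with h | h
  · rw [← h]
    positivity
  · have h3 := mul_le_mul h1 h2 (sq_nonneg _) (by positivity)
    have h4 : (d * d') * (d * d') ≤ (1 / 4 * (x * x')) * (d * d') := by nlinarith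
    exact le_of_mul_le_mul_right h4 h

/-- `D(p‖q) ≤ D_β(p‖q)` for `β > 1`, in exponential form. -/
theorem exp_kl_le_rpow (H : IsPair p q) (hac : ∀ ω, q ω = 0 → p ω = 0) {β t : ℝ}
    (hd : HasSum (fun ω => p ω * Real.log (p ω / q ω) - p ω + q ω) d)
    (ht : HasSum (fun ω => q ω * (p ω / q ω) ^ β) t) : Real.exp ((β - 1) * d) ≤ t := by
  set m := (β - 1) * d with hm
  -- Jensen by the tangent of `exp` at `m`, the `p`-mean of `(β - 1) log (p / q)`. Nothing is
  -- assumed about the sign of `β - 1`, so the bound also serves orders below `1`.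
  have := hasSum_le (fun ω => ?_) (((H.hasSum_left.mul_left (1 - m)).add
    (((hd.add H.hasSum_left).sub H.hasSum_right).mul_left (β - 1))).mul_left (Real.exp m)) ht
  · refine le_trans (le_of_eq ?_) this
    have e : (1 - m) * 1 + (β - 1) * (d + 1 - 1) = 1 := by
      rw [hm]
      ring
    rw [e, mul_one]
  · rcases (H.2 ω).eq_or_lt with h2 | h2
    · simp [← h2, hac ω h2.symm]
    rcases (H.1 ω).eq_or_lt with h3 | h3
    · rw [← h3]
      have : 0 ≤ q ω * (0 / q ω) ^ β :=
        mul_nonneg h2.le (Real.rpow_nonneg (div_nonneg le_rfl h2.le) _)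
      simpa using this
    · have h4 : q ω * (p ω / q ω) ^ β =
          p ω * (Real.exp m * Real.exp ((β - 1) * Real.log (p ω / q ω) - m)) := by
        have hpq := div_pos h3 h2
        rw [← Real.exp_add, add_sub_cancel, mul_comm (β - 1), ← Real.rpow_def_of_pos hpq,
          Real.rpow_sub_one hpq.ne']
        field_simp
      rw [h4]
      have h5 := Real.add_one_le_exp ((β - 1) * Real.log (p ω / q ω) - m)
      have h6 := mul_le_mul_of_nonneg_left h5 (mul_nonneg h3.le (Real.exp_pos m).le)
      refine le_trans (le_of_eq ?_) (h6.trans_eq (by ring))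
      ring

theorem summable_kl_of_rpow (H : IsPair p q) (hac : ∀ ω, q ω = 0 → p ω = 0) {β : ℝ} (hβ : 1 < β)
    (ht : Summable fun ω => q ω * (p ω / q ω) ^ β) :
    Summable fun ω => p ω * Real.log (p ω / q ω) - p ω + q ω := by
  refine ((ht.mul_left (β - 1)⁻¹).add H.hasSum_right.summable).of_nonneg_of_le (fun ω => ?_)
    fun ω => ?_
  · rw [← kl_term (hac ω)]
    exact mul_nonneg (H.2 ω) (mul_log_sub_add_one_nonneg (div_nonneg (H.1 ω) (H.2 ω)))
  · rcases (H.2 ω).eq_or_lt with h2 | h2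
    · simp [← h2, hac ω h2.symm]
    have hpq := div_nonneg (H.1 ω) (H.2 ω)
    have hβ' : 0 < β - 1 := by linarith
    rcases (H.1 ω).eq_or_lt with h3 | h3
    · rw [← h3]
      have : 0 ≤ (β - 1)⁻¹ * (q ω * (0 / q ω) ^ β) :=
        mul_nonneg (by positivity) (mul_nonneg h2.le (Real.rpow_nonneg (div_nonneg le_rfl h2.le) _))
      simpa using this
    · have h4 := mul_le_mul_of_nonneg_left (Real.log_le_rpow_div hpq hβ') (H.1 ω)
      have h5 : (β - 1)⁻¹ * (q ω * (p ω / q ω) ^ β) = p ω * ((p ω / q ω) ^ (β - 1) / (β - 1)) := by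
        rw [Real.rpow_sub_one (div_pos h3 h2).ne']
        field_simp
      rw [h5]
      linarith

theorem summable_chi_of_rpow (H : IsPair p q) (hac : ∀ ω, q ω = 0 → p ω = 0) {α : ℝ} (hα : 2 < α)
    (ht : Summable fun ω => q ω * (p ω / q ω) ^ α) :
    Summable fun ω => (p ω - q ω) ^ 2 / q ω := by
  refine (ht.add (H.hasSum_right.summable.mul_left 2)).of_nonneg_of_le
    (fun ω => div_nonneg (sq_nonneg _) (H.2 ω)) fun ω => ?_
  rcases (H.2 ω).eq_or_lt with h2 | h2
  · simp [← h2, hac ω h2.symm]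
  have hpq := div_nonneg (H.1 ω) (H.2 ω)
  rw [← chi_term (hac ω), mul_comm 2 (q ω), ← mul_add]
  refine mul_le_mul_of_nonneg_left ?_ h2.le
  rcases le_total (p ω / q ω) 1 with h | h
  · nlinarith [Real.rpow_nonneg hpq α]
  · have := Real.rpow_le_rpow_of_exponent_le h hα.le
    rw [Real.rpow_two] at this
    nlinarith

/-- Jensen for the power `α - 1 > 1` under `p`: the mean of `p / q` is `m = 1 + χ²`, and Bernoulli's
inequality is the tangent at `m`. -/
theorem chi_rpow_le (H : IsPair p q) (hac : ∀ ω, q ω = 0 → p ω = 0) {α t : ℝ} (hα : 2 < α)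
    (hx : HasSum (fun ω => (p ω - q ω) ^ 2 / q ω) x) (hx0 : 0 ≤ x)
    (ht : HasSum (fun ω => q ω * (p ω / q ω) ^ α) t) : (1 + x) ^ (α - 1) ≤ t := by
  set m := 1 + x with hm
  have hm0 : 0 < m := by linarith
  set s := α - 1 with hs
  have := hasSum_le (fun ω => ?_) (((H.hasSum_left.mul_left (1 - s)).add
    ((((hx.add (H.hasSum_left.mul_left 2)).sub H.hasSum_right).mul_left (s / m)))).mul_left
      (m ^ s)) ht
  · refine le_trans (le_of_eq ?_) this
    have : x + 2 * 1 - 1 = m := by rw [hm]; ring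
    rw [this]
    field_simp
    ring
  · rcases (H.2 ω).eq_or_lt with h2 | h2
    · simp [← h2, hac ω h2.symm]
    have hpq := div_nonneg (H.1 ω) (H.2 ω)
    have hy : 0 ≤ p ω / q ω / m := div_nonneg hpq hm0.le
    have hb := one_add_mul_self_le_rpow_one_add (s := p ω / q ω / m - 1) (by linarith)
      (p := s) (by linarith)
    rw [add_sub_cancel] at hb
    have h4 := mul_le_mul_of_nonneg_left hb (mul_nonneg (H.1 ω) (Real.rpow_nonneg hm0.le s))
    have h5 : p ω * m ^ s * (p ω / q ω / m) ^ s = q ω * (p ω / q ω) ^ α := by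
      rcases (H.1 ω).eq_or_lt with h3 | h3
      · rw [← h3, zero_div, Real.zero_rpow (by linarith)]
        simp
      · have hms := (Real.rpow_pos_of_pos hm0 s).ne'
        rw [Real.div_rpow hpq hm0.le, hs, Real.rpow_sub_one (div_pos h3 h2).ne']
        rw [hs] at hms
        field_simp
    rw [← h5]
    refine le_trans (le_of_eq ?_) h4
    field_simp
    ring

theorem summable_rpow_of_lt_one (H : IsPair p q) {α : ℝ} (h0 : 0 < α) (hα : α < 1) :
    Summable fun ω => q ω * (p ω / q ω) ^ α := by
  refine (H.hasSum_left.summable.add H.hasSum_right.summable).of_nonneg_of_le (fun ω => ?_)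
    fun ω => ?_
  · exact mul_nonneg (H.2 ω) (Real.rpow_nonneg (div_nonneg (H.1 ω) (H.2 ω)) _)
  · rcases (H.2 ω).eq_or_lt with h2 | h2
    · simpa [← h2] using H.1 ω
    have hpq := div_nonneg (H.1 ω) (H.2 ω)
    have hb := rpow_one_add_le_one_add_mul_self (s := p ω / q ω - 1) (by linarith) h0.le hα.le
    rw [add_sub_cancel] at hb
    have h3 : (p ω / q ω) ^ α ≤ p ω / q ω + 1 := by nlinarith
    have h4 := mul_le_mul_of_nonneg_left h3 h2.le
    refine h4.trans_eq ?_
    field_simp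

end IsPair

/-! ### The same inequalities with infinite values -/

namespace IsPair

variable {Ω : Type*} {p q : Ω → ℝ} {f g : ℝ → ℝ} {c : ℝ}

theorem cDiv_cases (H : IsPair p q) (h : IsNormalization f g c ∞) :
    (cDiv f p q = ⊤ ∧ ¬((∀ ω, q ω = 0 → p ω = 0) ∧ Summable fun ω => q ω * g (p ω / q ω))) ∨
      ∃ x : ℝ, 0 ≤ x ∧ cDiv f p q = (x : EReal) ∧ (∀ ω, q ω = 0 → p ω = 0) ∧
        HasSum (fun ω => q ω * g (p ω / q ω)) x := by
  rcases h.cDiv_cases H.1 H.2 H.3 H.4 with h1 | h1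
  · refine Or.inl ⟨h1, fun ⟨hac, hs⟩ => ?_⟩
    rw [h.cDiv_eq_of_hasSum_ac H.1 H.2 H.3 H.4 hac hs.hasSum] at h1
    exact EReal.coe_ne_top _ h1
  · exact Or.inr h1

theorem chi_cases (H : IsPair p q) :
    (cDiv (fun t => (t - 1) ^ 2) p q = ⊤ ∧
      ¬((∀ ω, q ω = 0 → p ω = 0) ∧ Summable fun ω => (p ω - q ω) ^ 2 / q ω)) ∨
      ∃ x : ℝ, 0 ≤ x ∧ cDiv (fun t => (t - 1) ^ 2) p q = (x : EReal) ∧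
        (∀ ω, q ω = 0 → p ω = 0) ∧ HasSum (fun ω => (p ω - q ω) ^ 2 / q ω) x := by
  rcases H.cDiv_cases isNormalization_chiSq with ⟨h1, h2⟩ | ⟨x, hx, h1, h2, h3⟩
  · exact Or.inl ⟨h1, fun ⟨hac, hs⟩ => h2 ⟨hac, hs.congr fun ω => (chi_term (hac ω)).symm⟩⟩
  · exact Or.inr ⟨x, hx, h1, h2, h3.congr_fun fun ω => (chi_term (h2 ω)).symm⟩

/-- One dichotomy for all scalings `k`, so that a change of logarithm base respects both the finite
and the infinite case. -/
theorem kl_cases (H : IsPair p q) :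
    ((∀ k : ℝ, 0 < k → cDiv (fun t => k * (t * Real.log t)) p q = ⊤) ∧
      ¬((∀ ω, q ω = 0 → p ω = 0) ∧
        Summable fun ω => p ω * Real.log (p ω / q ω) - p ω + q ω)) ∨
      ∃ d : ℝ, 0 ≤ d ∧
        (∀ k : ℝ, 0 < k → cDiv (fun t => k * (t * Real.log t)) p q = ((k * d : ℝ) : EReal)) ∧
        (∀ ω, q ω = 0 → p ω = 0) ∧
        HasSum (fun ω => p ω * Real.log (p ω / q ω) - p ω + q ω) d := by
  by_cases h : (∀ ω, q ω = 0 → p ω = 0) ∧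
      Summable fun ω => p ω * Real.log (p ω / q ω) - p ω + q ω
  · obtain ⟨hac, d, hd⟩ := h
    refine Or.inr ⟨d, hd.nonneg fun ω => ?_, fun k hk => ?_, hac, hd⟩
    · rw [← kl_term (hac ω)]
      exact mul_nonneg (H.2 ω) (mul_log_sub_add_one_nonneg (div_nonneg (H.1 ω) (H.2 ω)))
    · refine (isNormalization_mul_log hk).cDiv_eq_of_hasSum_ac H.1 H.2 H.3 H.4 hac
        ((hd.mul_left k).congr_fun fun ω => ?_)
      rw [← kl_term (hac ω)]
      ring
  · refine Or.inl ⟨fun k hk => ?_, h⟩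
    rcases H.cDiv_cases (isNormalization_mul_log hk) with ⟨h1, -⟩ | ⟨x, -, -, hac, h3⟩
    · exact h1
    · refine (h ⟨hac, (h3.summable.mul_left k⁻¹).congr fun ω => ?_⟩).elim
      rw [← kl_term (hac ω)]
      field_simp

theorem kl_natural_cases (H : IsPair p q) :
    (cDiv (fun t => t * Real.log t) p q = ⊤ ∧ ¬((∀ ω, q ω = 0 → p ω = 0) ∧
        Summable fun ω => p ω * Real.log (p ω / q ω) - p ω + q ω)) ∨
      ∃ d : ℝ, 0 ≤ d ∧ cDiv (fun t => t * Real.log t) p q = (d : EReal) ∧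
        (∀ ω, q ω = 0 → p ω = 0) ∧
        HasSum (fun ω => p ω * Real.log (p ω / q ω) - p ω + q ω) d := by
  rcases H.kl_cases with ⟨h1, h2⟩ | ⟨d, hd, h1, h2, h3⟩
  · exact Or.inl ⟨by simpa using h1 1 one_pos, h2⟩
  · exact Or.inr ⟨d, hd, by simpa using h1 1 one_pos, h2, h3⟩

theorem cDiv_logb (H : IsPair p q) {b : ℝ} (hb : 1 < b) :
    cDiv (fun t => t * Real.logb b t) p q =
      (((Real.log b)⁻¹ : ℝ) : EReal) * cDiv (fun t => t * Real.log t) p q := by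
  have hk : 0 < (Real.log b)⁻¹ := inv_pos.2 (Real.log_pos hb)
  have e : (fun t => t * Real.logb b t) = fun t => (Real.log b)⁻¹ * (t * Real.log t) := by
    ext t
    rw [Real.logb]
    ring
  rw [e]
  rcases H.kl_cases with ⟨h1, -⟩ | ⟨d, hd, h1, -, -⟩
  · have h2 := h1 1 one_pos
    simp only [one_mul] at h2
    rw [h1 _ hk, h2, EReal.coe_mul_top_of_pos hk]
  · have h2 := h1 1 one_pos
    simp only [one_mul] at h2
    rw [h1 _ hk, h2, EReal.coe_mul]

theorem exists_tv (H : IsPair p q) :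
    ∃ v : ℝ, cDiv (fun t => |t - 1|) p q = (v : EReal) ∧ HasSum (fun ω => |p ω - q ω|) v := by
  obtain ⟨v, hv⟩ := H.summable_tv
  refine ⟨v, isNormalization_totalVar.cDiv_eq_of_hasSum H.1 H.2 H.3 H.4 (by simp)
    (hv.congr_fun fun ω => ?_), hv⟩
  split_ifs with h
  · simp [h, abs_of_nonneg (H.1 ω)]
  · have hq : 0 < q ω := lt_of_le_of_ne (H.2 ω) (Ne.symm h)
    rw [← abs_of_pos hq, ← abs_mul, abs_of_pos hq]
    congr 1
    field_simp

theorem exists_hellinger (H : IsPair p q) :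
    ∃ h : ℝ, cDiv (fun t => 1 / 2 * (√t - 1) ^ 2) p q = (h : EReal) ∧
      HasSum (fun ω => 1 / 2 * (√(p ω) - √(q ω)) ^ 2) h := by
  obtain ⟨h, hh⟩ := H.hasSum_hellinger
  refine ⟨h, isNormalization_hellingerSq.cDiv_eq_of_hasSum H.1 H.2 H.3 H.4 (by simp)
    (hh.congr_fun fun ω => ?_), hh⟩
  split_ifs with h1
  · rw [h1, Real.sqrt_zero, sub_zero, Real.sq_sqrt (H.1 ω),
      ENNReal.toReal_ofReal (by norm_num)]
  · exact hellinger_term (H.1 ω) (lt_of_le_of_ne (H.2 ω) (Ne.symm h1))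

theorem kl_self_ne_top (H : IsPair p q) (h : p = q) :
    cDiv (fun t => t * Real.log t) p q ≠ ⊤ := by
  subst h
  rcases H.kl_natural_cases with ⟨-, h2⟩ | ⟨d, -, h2, -⟩
  · refine (h2 ⟨fun _ => id, summable_zero.congr fun ω => ?_⟩).elim
    by_cases hω : p ω = 0
    · simp [hω]
    · simp [div_self hω]
  · rw [h2]
    exact EReal.coe_ne_top _

theorem chi_self_ne_top (H : IsPair p q) (h : p = q) :
    cDiv (fun t => (t - 1) ^ 2) p q ≠ ⊤ := by
  subst h
  rcases H.chi_cases with ⟨-, h2⟩ | ⟨d, -, h2, -⟩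
  · exact (h2 ⟨fun _ => id, summable_zero.congr fun ω => by simp⟩).elim
  · rw [h2]
    exact EReal.coe_ne_top _

theorem kl_le_extLog (H : IsPair p q) {b : ℝ} (hb : 1 < b) :
    cDiv (fun t => t * Real.logb b t) p q ≤ extLog b (1 + cDiv (fun t => (t - 1) ^ 2) p q) := by
  have hk : 0 < (Real.log b)⁻¹ := inv_pos.2 (Real.log_pos hb)
  rw [H.cDiv_logb hb, extLog]
  rcases H.chi_cases with ⟨h1, -⟩ | ⟨x, hx0, h1, hac, hx⟩
  · rw [h1, ← EReal.coe_one, EReal.coe_add_top, EReal.toENNReal_top, ENNReal.log_top,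
      EReal.coe_mul_top_of_pos hk]
    exact le_top
  · rcases H.kl_natural_cases with ⟨-, h2⟩ | ⟨d, hd0, h2, -, hd⟩
    · exact (h2 ⟨hac, H.summable_kl_of_chi hac hx.summable⟩).elim
    · rw [h1, h2, ← EReal.coe_one, ← EReal.coe_add, EReal.real_coe_toENNReal,
        ENNReal.log_ofReal_of_pos (by linarith), ← EReal.coe_mul, ← EReal.coe_mul,
        EReal.coe_le_coe_iff]
      exact mul_le_mul_of_nonneg_left (H.kl_le_log hac hd hx hx0) hk.le

/-- The two integrands differ by an affine function, so both divergences are finite together. The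
power sum `t` is strictly positive because `t = 0` would make `p` vanish; its logarithm is therefore
an ordinary real one. -/
theorem hellingerAlpha_cases (H : IsPair p q) {α : ℝ} (hα : 1 < α) :
    (cDiv (fun t => (t ^ α - 1) / (α - 1)) p q = ⊤ ∧ cDiv (fun t => t ^ α) p q = ⊤) ∨
      ∃ t : ℝ, 0 < t ∧ cDiv (fun t => t ^ α) p q = (t : EReal) ∧
        cDiv (fun t => (t ^ α - 1) / (α - 1)) p q = (((t - 1) / (α - 1) : ℝ) : EReal) ∧
        (∀ ω, q ω = 0 → p ω = 0) ∧ HasSum (fun ω => q ω * (p ω / q ω) ^ α) t := by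
  have hα' : α - 1 ≠ 0 := by linarith
  have hterm : ∀ ω, (q ω = 0 → p ω = 0) → q ω * ((p ω / q ω) ^ α - 1 - α * (p ω / q ω - 1)) =
      q ω * (p ω / q ω) ^ α - q ω - α * (p ω - q ω) := fun ω h => by
    by_cases hq : q ω = 0
    · simp [hq, h hq]
    · field_simp
  have hterm2 : ∀ ω, q ω * (((p ω / q ω) ^ α - 1) / (α - 1) - α / (α - 1) * (p ω / q ω - 1)) =
      q ω * ((p ω / q ω) ^ α - 1 - α * (p ω / q ω - 1)) / (α - 1) := fun ω => by
    field_simp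
  rcases H.cDiv_cases (isNormalization_rpow_of_one_lt hα) with ⟨h1, h2⟩ | ⟨t, ht0, h1, hac, ht⟩
  · refine Or.inl ⟨?_, h1⟩
    rcases H.cDiv_cases (isNormalization_hellingerAlpha_of_one_lt hα) with
      ⟨h3, -⟩ | ⟨e, -, -, hac, he⟩
    · exact h3
    · refine (h2 ⟨hac, ?_⟩).elim
      have h4 := ((he.summable.mul_left (α - 1)).add H.hasSum_right.summable).add
        ((H.hasSum_left.summable.sub H.hasSum_right.summable).mul_left α)
      refine h4.congr fun ω => ?_
      rw [hterm2, mul_div_cancel₀ _ hα', hterm ω (hac ω)]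
      ring
  · refine Or.inr ⟨t, ?_, h1, ?_, hac, ht⟩
    · refine lt_of_le_of_ne ht0 fun h => ?_
      rw [← h] at ht
      have h5 := (hasSum_zero_iff_of_nonneg fun ω => mul_nonneg (H.2 ω)
        (Real.rpow_nonneg (div_nonneg (H.1 ω) (H.2 ω)) _)).1 ht
      have h6 : p = fun _ => 0 := by
        funext ω
        by_cases hq : q ω = 0
        · exact hac ω hq
        · have h7 := congrFun h5 ω
          simp only [Pi.zero_apply, mul_eq_zero, hq, false_or] at h7
          rw [Real.rpow_eq_zero (div_nonneg (H.1 ω) (H.2 ω)) (by linarith), div_eq_zero_iff] at h7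
          exact h7.resolve_right hq
      have h8 := H.hasSum_left
      rw [h6] at h8
      exact zero_ne_one (hasSum_zero.unique h8)
    · refine (isNormalization_hellingerAlpha_of_one_lt hα).cDiv_eq_of_hasSum_ac H.1 H.2 H.3 H.4
        hac ?_
      have h4 := ((ht.sub H.hasSum_right).sub
        ((H.hasSum_left.sub H.hasSum_right).mul_left α)).div_const (α - 1)
      rw [sub_self, mul_zero, sub_zero] at h4
      refine h4.congr_fun fun ω => ?_
      rw [hterm2, hterm ω (hac ω)]

theorem hellingerAlpha_of_lt_one (H : IsPair p q) {α : ℝ} (h0 : 0 < α) (hα : α < 1) :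
    ∃ t : ℝ, 0 ≤ t ∧ cDiv (fun t => t ^ α) p q = (t : EReal) ∧
      cDiv (fun t => (t ^ α - 1) / (α - 1)) p q = (((t - 1) / (α - 1) : ℝ) : EReal) ∧
      HasSum (fun ω => q ω * (p ω / q ω) ^ α) t := by
  obtain ⟨t, ht⟩ := H.summable_rpow_of_lt_one h0 hα
  have hα' : α - 1 ≠ 0 := by linarith
  have hα'' : 1 - α ≠ 0 := by linarith
  refine ⟨t, ht.nonneg fun ω => mul_nonneg (H.2 ω)
    (Real.rpow_nonneg (div_nonneg (H.1 ω) (H.2 ω)) _), ?_, ?_, ht⟩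
  · refine (isNormalization_rpow_of_lt_one h0 hα).cDiv_eq_of_hasSum H.1 H.2 H.3 H.4 (by simp)
      (ht.congr_fun fun ω => ?_)
    split_ifs with h
    · simp [h]
    · rfl
  · refine (isNormalization_hellingerAlpha_of_lt_one h0 hα).cDiv_eq_of_hasSum H.1 H.2 H.3 H.4
      (by simp) ?_
    have h4 := ((ht.sub H.hasSum_right).sub
      ((H.hasSum_left.sub H.hasSum_right).mul_left α)).div_const (α - 1)
    rw [sub_self, mul_zero, sub_zero] at h4
    refine h4.congr_fun fun ω => ?_
    split_ifs with h
    · rw [h, ENNReal.toReal_ofReal (div_nonneg h0.le (by linarith))]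
      field_simp
      ring
    · field_simp

theorem chi_le_hellingerAlpha (H : IsPair p q) {α : ℝ} (hα : 2 < α) :
    cDiv (fun t => (t - 1) ^ 2) p q ≤
      ((((1 + ((α - 1 : ℝ) : EReal) * cDiv (fun t => (t ^ α - 1) / (α - 1)) p q).toENNReal ^
        (1 / (α - 1)) : ℝ≥0∞) : EReal) - 1) := by
  have hα' : 0 < α - 1 := by linarith
  rcases H.hellingerAlpha_cases (by linarith : 1 < α) with ⟨h1, -⟩ | ⟨t, ht0, -, h1, hac, ht⟩
  · rw [h1, EReal.coe_mul_top_of_pos hα', ← EReal.coe_one, EReal.coe_add_top,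
      EReal.toENNReal_top, ENNReal.top_rpow_of_pos (by positivity), EReal.coe_ennreal_top,
      EReal.top_sub_coe]
    exact le_top
  · rcases H.chi_cases with ⟨-, h2⟩ | ⟨x, hx0, h2, -, hx⟩
    · exact (h2 ⟨hac, H.summable_chi_of_rpow hac hα ht.summable⟩).elim
    · have e : 1 + (α - 1) * ((t - 1) / (α - 1)) = t := by
        field_simp
        ring
      rw [h1, h2, ← EReal.coe_mul, ← EReal.coe_one, ← EReal.coe_add, EReal.real_coe_toENNReal,
        ENNReal.ofReal_rpow_of_pos (by rw [e]; exact ht0), EReal.coe_ennreal_ofReal,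
        max_eq_left (Real.rpow_nonneg (by rw [e]; exact ht0.le) _), ← EReal.coe_sub,
        EReal.coe_le_coe_iff, e]
      have h3 := H.chi_rpow_le hac hα hx hx0 ht
      have h4 := Real.rpow_le_rpow (by positivity) h3 (by positivity : 0 ≤ 1 / (α - 1))
      rw [← Real.rpow_mul (by linarith), mul_one_div_cancel hα'.ne', Real.rpow_one] at h4
      linarith

theorem renyi_chain_of_lt_one (H : IsPair p q) {α : ℝ} (h0 : 0 < α) (hα : α < 1) :
    cDiv (fun t => (t ^ α - 1) / (α - 1)) p q ≤
        (((α - 1)⁻¹ : ℝ) : EReal) * ENNReal.log (cDiv (fun t => t ^ α) p q).toENNReal ∧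
      (((α - 1)⁻¹ : ℝ) : EReal) * ENNReal.log (cDiv (fun t => t ^ α) p q).toENNReal ≤
        cDiv (fun t => t * Real.log t) p q := by
  have hk : (α - 1)⁻¹ < 0 := inv_neg''.2 (by linarith)
  obtain ⟨t, ht0, h1, h2, ht⟩ := H.hellingerAlpha_of_lt_one h0 hα
  rw [h1, h2, EReal.real_coe_toENNReal]
  constructor
  · rcases ht0.eq_or_lt with h | h
    · rw [← h, ENNReal.ofReal_zero, ENNReal.log_zero, EReal.coe_mul_bot_of_neg hk]
      exact le_top
    · rw [ENNReal.log_ofReal_of_pos h, ← EReal.coe_mul, EReal.coe_le_coe_iff, div_eq_inv_mul]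
      exact mul_le_mul_of_nonpos_left (Real.log_le_sub_one_of_pos h) hk.le
  · rcases H.kl_natural_cases with ⟨h3, -⟩ | ⟨d, hd0, h3, hac, hd⟩
    · rw [h3]
      exact le_top
    · have h4 := H.exp_kl_le_rpow hac hd ht
      have h5 : 0 < t := (Real.exp_pos _).trans_le h4
      rw [h3, ENNReal.log_ofReal_of_pos h5, ← EReal.coe_mul, EReal.coe_le_coe_iff]
      have h6 := (Real.le_log_iff_exp_le h5).2 h4
      have h7 := mul_le_mul_of_nonpos_left h6 hk.le
      refine h7.trans_eq ?_
      have : α - 1 ≠ 0 := by linarith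
      field_simp

theorem renyi_chain_of_one_lt (H : IsPair p q) {β : ℝ} (hβ : 1 < β) :
    cDiv (fun t => t * Real.log t) p q ≤
        (((β - 1)⁻¹ : ℝ) : EReal) * ENNReal.log (cDiv (fun t => t ^ β) p q).toENNReal ∧
      (((β - 1)⁻¹ : ℝ) : EReal) * ENNReal.log (cDiv (fun t => t ^ β) p q).toENNReal ≤
        cDiv (fun t => (t ^ β - 1) / (β - 1)) p q := by
  have hk : 0 < (β - 1)⁻¹ := inv_pos.2 (by linarith)
  rcases H.hellingerAlpha_cases hβ with ⟨h1, h2⟩ | ⟨t, ht0, h1, h2, hac, ht⟩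
  · rw [h1, h2, EReal.toENNReal_top, ENNReal.log_top, EReal.coe_mul_top_of_pos hk]
    exact ⟨le_top, le_rfl⟩
  · rw [h1, h2, EReal.real_coe_toENNReal, ENNReal.log_ofReal_of_pos ht0, ← EReal.coe_mul,
      EReal.coe_le_coe_iff]
    constructor
    · rcases H.kl_natural_cases with ⟨-, h3⟩ | ⟨d, hd0, h3, -, hd⟩
      · exact (h3 ⟨hac, H.summable_kl_of_rpow hac hβ ht.summable⟩).elim
      · have h6 := (Real.le_log_iff_exp_le ht0).2 (H.exp_kl_le_rpow hac hd ht)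
        have h7 := mul_le_mul_of_nonneg_left h6 hk.le
        rw [h3, EReal.coe_le_coe_iff]
        refine le_trans (le_of_eq ?_) h7
        have : β - 1 ≠ 0 := by linarith
        field_simp
    · rw [div_eq_inv_mul]
      exact mul_le_mul_of_nonneg_left (Real.log_le_sub_one_of_pos ht0) hk.le

variable {v h : ℝ}

theorem tv_le_chi (H : IsPair p q) (hv : HasSum (fun ω => |p ω - q ω|) v) :
    ((v ^ 2 : ℝ) : EReal) ≤ cDiv (fun t => (t - 1) ^ 2) p q ∧
      (1 < v → v < 2 → ((v / (2 - v) : ℝ) : EReal) ≤ cDiv (fun t => (t - 1) ^ 2) p q) ∧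
      (v = 2 → cDiv (fun t => (t - 1) ^ 2) p q = ⊤) := by
  rcases H.chi_cases with ⟨h1, -⟩ | ⟨x, hx0, h1, hac, hx⟩
  · rw [h1]
    exact ⟨le_top, fun _ _ => le_top, fun _ => rfl⟩
  · rw [h1, EReal.coe_le_coe_iff, EReal.coe_le_coe_iff]
    exact ⟨H.sq_tv_le_chi hac hv hx, fun h1 h2 => H.div_tv_le_chi hac hv hx h1 h2,
      fun h2 => absurd h2 (H.tv_lt_two hac hv).ne⟩

theorem kl_eq_top (H : IsPair p q) (hv : HasSum (fun ω => |p ω - q ω|) v) (h2 : v = 2) :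
    cDiv (fun t => t * Real.log t) p q = ⊤ := by
  rcases H.kl_natural_cases with ⟨h1, -⟩ | ⟨d, -, -, hac, -⟩
  · exact h1
  · exact absurd h2 (H.tv_lt_two hac hv).ne

theorem hasSum_tv_symm (hv : HasSum (fun ω => |p ω - q ω|) v) :
    HasSum (fun ω => |q ω - p ω|) v :=
  hv.congr_fun fun _ => abs_sub_comm _ _

theorem kl_sq_le (H : IsPair p q) :
    cDiv (fun t => t * Real.log t) p q ^ 2 / cDiv (fun t => t * Real.log t) q p ≤
      ((1 / 2 : ℝ) : EReal) * cDiv (fun t => (t - 1) ^ 2) p q := by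
  have hhalf : (0 : ℝ) < 1 / 2 := by norm_num
  rcases H.chi_cases with ⟨h1, -⟩ | ⟨x, hx0, h1, hac, hx⟩
  · rw [h1, EReal.coe_mul_top_of_pos hhalf]
    exact le_top
  · rcases H.kl_natural_cases with ⟨-, h2⟩ | ⟨d, hd0, h2, -, hd⟩
    · exact (h2 ⟨hac, H.summable_kl_of_chi hac hx.summable⟩).elim
    · rw [h1, h2, ← EReal.coe_mul]
      rcases H.symm.kl_natural_cases with ⟨h3, -⟩ | ⟨d', hd'0, h3, hac', hd'⟩
      · rw [h3, EReal.div_top, ← EReal.coe_zero, EReal.coe_le_coe_iff]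
        positivity
      · rw [h3, ← EReal.coe_pow, ← EReal.coe_div, EReal.coe_le_coe_iff]
        have h4 := sq_le_mul_of_quadratic (H.kl_chi_quadratic hac hac' hd hd' hx)
        -- If `d' = 0`, then `h4` forces `d = 0` too, so division by zero is met only as `0 / 0 =
        -- 0`.
        rcases hd'0.eq_or_lt with h5 | h5
        · rw [← h5, div_zero]
          positivity
        · rw [div_le_iff₀ h5]
          linarith

theorem chi_pos_of_chi_symm_eq_top (H : IsPair p q) {x : ℝ}
    (hx0 : 0 ≤ x) (hac : ∀ ω, q ω = 0 → p ω = 0) (hx : HasSum (fun ω => (p ω - q ω) ^ 2 / q ω) x)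
    (h : cDiv (fun t => (t - 1) ^ 2) q p = ⊤) : 0 < x := by
  refine lt_of_le_of_ne hx0 fun h0 => ?_
  rw [← h0] at hx
  exact H.symm.chi_self_ne_top (H.eq_of_chi_eq_zero hac hx).symm h

theorem kl_pos_of_kl_symm_eq_top (H : IsPair p q) {d : ℝ}
    (hd0 : 0 ≤ d) (hac : ∀ ω, q ω = 0 → p ω = 0)
    (hd : HasSum (fun ω => p ω * Real.log (p ω / q ω) - p ω + q ω) d)
    (h : cDiv (fun t => t * Real.log t) q p = ⊤) : 0 < d := by
  refine lt_of_le_of_ne hd0 fun h0 => ?_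
  rw [← h0] at hd
  exact H.symm.kl_self_ne_top (H.eq_of_kl_eq_zero hac hd).symm h

theorem kl_mul_kl_le_chi (H : IsPair p q) :
    cDiv (fun t => t * Real.log t) p q * cDiv (fun t => t * Real.log t) q p ≤
      ((1 / 4 : ℝ) : EReal) *
        (cDiv (fun t => (t - 1) ^ 2) p q * cDiv (fun t => (t - 1) ^ 2) q p) := by
  have hq : (0 : ℝ) < 1 / 4 := by norm_num
  rcases H.chi_cases with ⟨h1, -⟩ | ⟨x, hx0, h1, hac, hx⟩ <;>
    rcases H.symm.chi_cases with ⟨h2, -⟩ | ⟨x', hx'0, h2, hac', hx'⟩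
  · rw [h1, h2, EReal.top_mul_top, EReal.coe_mul_top_of_pos hq]
    exact le_top
  · rw [h1, h2, EReal.top_mul_coe_of_pos (H.symm.chi_pos_of_chi_symm_eq_top hx'0 hac' hx' h1),
      EReal.coe_mul_top_of_pos hq]
    exact le_top
  · rw [h1, h2, EReal.coe_mul_top_of_pos (H.chi_pos_of_chi_symm_eq_top hx0 hac hx h2),
      EReal.coe_mul_top_of_pos hq]
    exact le_top
  · rcases H.kl_natural_cases with ⟨-, h3⟩ | ⟨d, hd0, h3, -, hd⟩
    · exact (h3 ⟨hac, H.summable_kl_of_chi hac hx.summable⟩).elim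
    rcases H.symm.kl_natural_cases with ⟨-, h4⟩ | ⟨d', hd'0, h4, -, hd'⟩
    · exact (h4 ⟨hac', H.symm.summable_kl_of_chi hac' hx'.summable⟩).elim
    rw [h1, h2, h3, h4, ← EReal.coe_mul, ← EReal.coe_mul, ← EReal.coe_mul, EReal.coe_le_coe_iff]
    exact kl_mul_kl_le hd0 hd'0 hx0 hx'0
      (sq_le_mul_of_quadratic (H.kl_chi_quadratic hac hac' hd hd' hx))
      (sq_le_mul_of_quadratic (H.symm.kl_chi_quadratic hac' hac hd' hd hx'))

theorem kl_add_kl_le_chi (H : IsPair p q) :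
    cDiv (fun t => t * Real.log t) p q + cDiv (fun t => t * Real.log t) q p ≤
      ((1 / 2 : ℝ) : EReal) *
        (cDiv (fun t => (t - 1) ^ 2) p q + cDiv (fun t => (t - 1) ^ 2) q p) := by
  have hq : (0 : ℝ) < 1 / 2 := by norm_num
  rcases H.chi_cases with ⟨h1, -⟩ | ⟨x, hx0, h1, hac, hx⟩ <;>
    rcases H.symm.chi_cases with ⟨h2, -⟩ | ⟨x', hx'0, h2, hac', hx'⟩
  · rw [h1, h2, EReal.top_add_top, EReal.coe_mul_top_of_pos hq]
    exact le_top
  · rw [h1, h2, EReal.top_add_coe, EReal.coe_mul_top_of_pos hq]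
    exact le_top
  · rw [h1, h2, EReal.coe_add_top, EReal.coe_mul_top_of_pos hq]
    exact le_top
  · rcases H.kl_natural_cases with ⟨-, h3⟩ | ⟨d, hd0, h3, -, hd⟩
    · exact (h3 ⟨hac, H.summable_kl_of_chi hac hx.summable⟩).elim
    rcases H.symm.kl_natural_cases with ⟨-, h4⟩ | ⟨d', hd'0, h4, -, hd'⟩
    · exact (h4 ⟨hac', H.symm.summable_kl_of_chi hac' hx'.summable⟩).elim
    rw [h1, h2, h3, h4, ← EReal.coe_add, ← EReal.coe_add, ← EReal.coe_mul, EReal.coe_le_coe_iff]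
    -- At `c = 1` the two quadratics read `2 d ≤ d' + x / 2` and `2 d' ≤ d + x' / 2`; they are
    -- added.
    have h5 := H.kl_chi_quadratic hac hac' hd hd' hx 1
    have h6 := H.symm.kl_chi_quadratic hac' hac hd' hd hx' 1
    linarith

theorem hellinger_le_kl (H : IsPair p q)
    (hh : HasSum (fun ω => 1 / 2 * (√(p ω) - √(q ω)) ^ 2) h) :
    ((16 * h ^ 2 : ℝ) : EReal) ≤
        cDiv (fun t => t * Real.log t) p q * cDiv (fun t => t * Real.log t) q p ∧
      ((8 * h : ℝ) : EReal) ≤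
        cDiv (fun t => t * Real.log t) p q + cDiv (fun t => t * Real.log t) q p := by
  rcases H.kl_natural_cases with ⟨h1, -⟩ | ⟨d, hd0, h1, hac, hd⟩ <;>
    rcases H.symm.kl_natural_cases with ⟨h2, -⟩ | ⟨d', hd'0, h2, hac', hd'⟩
  · rw [h1, h2, EReal.top_mul_top, EReal.top_add_top]
    exact ⟨le_top, le_top⟩
  · rw [h1, h2, EReal.top_mul_coe_of_pos (H.symm.kl_pos_of_kl_symm_eq_top hd'0 hac' hd' h1),
      EReal.top_add_coe]
    exact ⟨le_top, le_top⟩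
  · rw [h1, h2, EReal.coe_mul_top_of_pos (H.kl_pos_of_kl_symm_eq_top hd0 hac hd h2),
      EReal.coe_add_top]
    exact ⟨le_top, le_top⟩
  · rw [h1, h2, ← EReal.coe_mul, ← EReal.coe_add, EReal.coe_le_coe_iff, EReal.coe_le_coe_iff]
    have h3 := H.kl_hellinger_quadratic hac hac' hd hd' hh
    have h4 := sq_le_mul_of_quadratic h3
    have h5 := h3 1
    constructor <;> linarith

theorem kl_le_tv_add_chi (H : IsPair p q) :
    cDiv (fun t => t * Real.log t) p q ≤ ((1 / 2 : ℝ) : EReal) *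
      (cDiv (fun t => |t - 1|) p q + cDiv (fun t => (t - 1) ^ 2) p q) := by
  obtain ⟨v, h0, hv⟩ := H.exists_tv
  rcases H.chi_cases with ⟨h1, -⟩ | ⟨x, hx0, h1, hac, hx⟩
  · rw [h0, h1, EReal.coe_add_top, EReal.coe_mul_top_of_pos (by norm_num)]
    exact le_top
  · rcases H.kl_natural_cases with ⟨-, h2⟩ | ⟨d, hd0, h2, -, hd⟩
    · exact (h2 ⟨hac, H.summable_kl_of_chi hac hx.summable⟩).elim
    · rw [h0, h1, h2, ← EReal.coe_add, ← EReal.coe_mul, EReal.coe_le_coe_iff]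
      exact H.kl_le_tv_chi hac hd hv hx

theorem tv_le_kl_add_kl (H : IsPair p q) (hv : HasSum (fun ω => |p ω - q ω|) v) {b : ℝ}
    (hb : 1 < b) :
    (v < 2 → ((v * Real.logb b ((2 + v) / (2 - v)) : ℝ) : EReal) ≤
        cDiv (fun t => t * Real.logb b t) p q + cDiv (fun t => t * Real.logb b t) q p) ∧
      (v = 2 → cDiv (fun t => t * Real.logb b t) p q + cDiv (fun t => t * Real.logb b t) q p
        = ⊤) := by
  have hk : 0 < (Real.log b)⁻¹ := inv_pos.2 (Real.log_pos hb)
  rw [H.cDiv_logb hb, H.symm.cDiv_logb hb]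
  constructor
  · intro hv2
    rcases H.kl_natural_cases with ⟨h1, -⟩ | ⟨d, hd0, h1, hac, hd⟩ <;>
      rcases H.symm.kl_natural_cases with ⟨h2, -⟩ | ⟨d', hd'0, h2, hac', hd'⟩
    · rw [h1, h2, EReal.coe_mul_top_of_pos hk, EReal.top_add_top]
      exact le_top
    · rw [h1, h2, EReal.coe_mul_top_of_pos hk, ← EReal.coe_mul, EReal.top_add_coe]
      exact le_top
    · rw [h1, h2, EReal.coe_mul_top_of_pos hk, ← EReal.coe_mul, EReal.coe_add_top]
      exact le_top
    · rw [h1, h2, ← EReal.coe_mul, ← EReal.coe_mul, ← EReal.coe_add, EReal.coe_le_coe_iff]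
      have h3 := H.tv_log_le_kl_add_kl hac hac' hd hd' hv (hv.nonneg fun _ => abs_nonneg _) hv2
      have h4 := mul_le_mul_of_nonneg_left h3 hk.le
      rw [Real.logb, ← mul_add]
      refine le_trans (le_of_eq ?_) h4
      ring
  · intro hv2
    rw [H.kl_eq_top hv hv2, H.symm.kl_eq_top (hasSum_tv_symm hv) hv2,
      EReal.coe_mul_top_of_pos hk, EReal.top_add_top]

theorem tv_le_chi_add_chi' (H : IsPair p q) (hv : HasSum (fun ω => |p ω - q ω|) v) :
    (v < 2 → ((8 * v ^ 2 / (4 - v ^ 2) : ℝ) : EReal) ≤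
        cDiv (fun t => (t - 1) ^ 2) p q + cDiv (fun t => (t - 1) ^ 2) q p) ∧
      (v = 2 → cDiv (fun t => (t - 1) ^ 2) p q + cDiv (fun t => (t - 1) ^ 2) q p = ⊤) := by
  constructor
  · intro hv2
    rcases H.chi_cases with ⟨h1, -⟩ | ⟨x, hx0, h1, hac, hx⟩ <;>
      rcases H.symm.chi_cases with ⟨h2, -⟩ | ⟨x', hx'0, h2, hac', hx'⟩
    · rw [h1, h2, EReal.top_add_top]
      exact le_top
    · rw [h1, h2, EReal.top_add_coe]
      exact le_top
    · rw [h1, h2, EReal.coe_add_top]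
      exact le_top
    · rw [h1, h2, ← EReal.coe_add, EReal.coe_le_coe_iff]
      exact H.tv_le_chi_add_chi hac hac' hx hx' hv (hv.nonneg fun _ => abs_nonneg _) hv2
  · intro hv2
    rw [(H.tv_le_chi hv).2.2 hv2, (H.symm.tv_le_chi (hasSum_tv_symm hv)).2.2 hv2,
      EReal.top_add_top]

end IsPair

/-! ### Strictly convex functions and control of total variation -/

section StrictlyConvex

variable {f : ℝ → ℝ}

theorem le_mul_of_convexOn (hf : ConvexOn ℝ (Ioi 0) f) (h1 : f 1 = 0) {a t : ℝ} (ha0 : 0 ≤ a)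
    (ha1 : a ≤ 1) (ht : 0 < t) : f (a * t + (1 - a)) ≤ a * f t := by
  have := hf.2 (mem_Ioi.2 ht) (mem_Ioi.2 one_pos) ha0 (by linarith : 0 ≤ 1 - a) (by ring)
  simpa [h1] using this

/-- A point between `s` and `1` is a convex combination of them, and `f 1 = 0` is the minimum.
Monotonicity ensures that the limit at `0` exists in `EReal`; `div_self_mono_of_convexOn` does the
same for the slope at infinity. -/
theorem antitoneOn_of_convexOn (hf : ConvexOn ℝ (Ioi 0) f) (h0 : ∀ t, 0 < t → 0 ≤ f t)
    (h1 : f 1 = 0) : AntitoneOn f (Ioo 0 1) := by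
  intro s hs t ht hst
  have h2 : 0 < 1 - s := by linarith [hs.2]
  have h3 : (1 - t) / (1 - s) ≤ 1 := by
    rw [div_le_one h2]
    linarith
  have h4 := le_mul_of_convexOn hf h1 (div_nonneg (by linarith [ht.2]) h2.le) h3 hs.1
  have e : (1 - t) / (1 - s) * s + (1 - (1 - t) / (1 - s)) = t := by
    field_simp
    ring
  rw [e] at h4
  have := mul_le_mul_of_nonneg_right h3 (h0 s hs.1)
  linarith

theorem div_self_mono_of_convexOn (hf : ConvexOn ℝ (Ioi 0) f) (h0 : ∀ t, 0 < t → 0 ≤ f t)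
    (h1 : f 1 = 0) {s t : ℝ} (hs : 1 ≤ s) (hst : s ≤ t) : f s / s ≤ f t / t := by
  rcases hs.eq_or_lt with rfl | hs
  · rw [h1, zero_div]
    exact div_nonneg (h0 t (by linarith)) (by linarith)
  have h2 : 0 < t - 1 := by linarith
  have h3 : (s - 1) / (t - 1) ≤ 1 := by
    rw [div_le_one h2]
    linarith
  have h4 := le_mul_of_convexOn hf h1 (div_nonneg (by linarith) h2.le) h3 (by linarith : 0 < t)
  have e : (s - 1) / (t - 1) * t + (1 - (s - 1) / (t - 1)) = s := by
    field_simp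
    ring
  rw [e] at h4
  have h5 : (s - 1) / (t - 1) ≤ s / t := by
    rw [div_le_div_iff₀ h2 (by linarith)]
    nlinarith
  have h6 := mul_le_mul_of_nonneg_right h5 (h0 t (by linarith))
  rw [div_le_iff₀ (by linarith)]
  refine (h4.trans h6).trans_eq ?_
  ring

theorem tendsto_limZero (hf : ConvexOn ℝ (Ioi 0) f) (h0 : ∀ t, 0 < t → 0 ≤ f t) (h1 : f 1 = 0) :
    Tendsto (fun t => (f t : EReal)) (𝓝[>] 0) (𝓝 (limZero f)) := by
  have hanti : AntitoneOn (fun t => (f t : EReal)) (Ioo 0 1) := fun s hs t ht hst =>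
    EReal.coe_le_coe_iff.2 (antitoneOn_of_convexOn hf h0 h1 hs ht hst)
  exact tendsto_nhds_limUnder ⟨_, AntitoneOn.tendsto_nhdsWithin_Ioo_right
    (nonempty_Ioo.2 one_pos) hanti (OrderTop.bddAbove _)⟩

theorem tendsto_slopeInfty (hf : ConvexOn ℝ (Ioi 0) f) (h0 : ∀ t, 0 < t → 0 ≤ f t)
    (h1 : f 1 = 0) :
    Tendsto (fun t : ℝ => ((f t / t : ℝ) : EReal)) atTop (𝓝 (slopeInfty f)) := by
  have hmono : Monotone fun t : ℝ => ((f (max t 1) / max t 1 : ℝ) : EReal) := fun s t hst =>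
    EReal.coe_le_coe_iff.2
      (div_self_mono_of_convexOn hf h0 h1 (le_max_right _ _) (max_le_max_right _ hst))
  refine tendsto_nhds_limUnder ⟨_, (tendsto_atTop_iSup hmono).congr' ?_⟩
  filter_upwards [eventually_ge_atTop 1] with t ht
  rw [max_eq_left ht]

/-- Beyond distance `ε` from `1` the graph of `f` lies above the rays from `(1, 0)` through its
points at `1 ± ε`, where strict convexity makes `f` positive. Within that distance the bound is
nonpositive. -/
theorem exists_linear_lower_bound (hf : StrictConvexOn ℝ (Ioi 0) f) (h0 : ∀ t, 0 < t → 0 ≤ f t)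
    (h1 : f 1 = 0) {ε : ℝ} (hε : 0 < ε) (hε1 : ε < 1) :
    ∃ m : ℝ, 0 < m ∧ ∀ t, 0 < t → m * (|t - 1| - ε) ≤ f t := by
  have hpos : ∀ t, 0 < t → t ≠ 1 → 0 < f t := fun t ht hne => by
    have h2 := hf.2 (mem_Ioi.2 ht) (mem_Ioi.2 one_pos) hne (by norm_num : (0 : ℝ) < 1 / 2)
      (by norm_num : (0 : ℝ) < 1 / 2) (by norm_num)
    have h3 := h0 ((1 / 2 : ℝ) • t + (1 / 2 : ℝ) • 1) (by simp only [smul_eq_mul]; linarith)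
    rw [h1] at h2
    simp only [smul_eq_mul] at h2 h3
    linarith
  have hm : 0 < min (f (1 + ε)) (f (1 - ε)) :=
    lt_min (hpos _ (by linarith) (by linarith)) (hpos _ (by linarith) (by linarith))
  refine ⟨min (f (1 + ε)) (f (1 - ε)) / ε, div_pos hm hε, fun t ht => ?_⟩
  rcases le_total |t - 1| ε with h | h
  · exact (mul_nonpos_of_nonneg_of_nonpos (div_pos hm hε).le (by linarith)).trans (h0 t ht)
  · have hd : 0 < |t - 1| := hε.trans_le h
    have h2 := le_mul_of_convexOn hf.convexOn h1 (div_nonneg hε.le hd.le)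
      ((div_le_one hd).2 h) ht
    have h3 : min (f (1 + ε)) (f (1 - ε)) ≤ ε / |t - 1| * f t := by
      refine le_trans ?_ h2
      rcases abs_cases (t - 1) with ⟨h4, h5⟩ | ⟨h4, h5⟩
      · rw [h4] at hd ⊢
        have e : ε / (t - 1) * t + (1 - ε / (t - 1)) = 1 + ε := by
          field_simp
          ring
        rw [e]
        exact min_le_left _ _
      · rw [h4] at hd ⊢
        have e : ε / -(t - 1) * t + (1 - ε / -(t - 1)) = 1 - ε := by
          have h6 : t - 1 ≠ 0 := h5.ne
          field_simp
          ring
        rw [e]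
        exact min_le_right _ _
    have h6 : min (f (1 + ε)) (f (1 - ε)) / ε * |t - 1| ≤ f t := by
      rw [div_mul_eq_mul_div, div_le_iff₀ hε]
      have := mul_le_mul_of_nonneg_right h3 hd.le
      refine this.trans_eq ?_
      field_simp
    have h7 : 0 ≤ min (f (1 + ε)) (f (1 - ε)) / ε * ε := (mul_pos (div_pos hm hε) hε).le
    rw [mul_sub]
    linarith

/-- The linear lower bound is summed against `q`. Its limits `m (1 - ε)` at zero and `m` for the
slope control the boundary terms. -/
theorem IsPair.tv_le_cDiv {Ω : Type*} {p q : Ω → ℝ} (H : IsPair p q) (hf : ConvexOn ℝ (Ioi 0) f)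
    (h0 : ∀ t, 0 < t → 0 ≤ f t) (h1 : f 1 = 0) {m ε v : ℝ} (hm : 0 < m) (hε : 0 < ε)
    (hε1 : ε < 1) (hfm : ∀ t, 0 < t → m * (|t - 1| - ε) ≤ f t) (hv : HasSum (fun ω => |p ω - q ω|) v) :
    ((m * v : ℝ) : EReal) ≤ cDiv f p q + ((m * ε : ℝ) : EReal) := by
  have hmε : 0 < m * ε := mul_pos hm hε
  have hz := tendsto_limZero hf h0 h1
  have hs := tendsto_slopeInfty hf h0 h1
  have hz0 : 0 ≤ limZero f := by
    refine ge_of_tendsto hz ?_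
    filter_upwards [self_mem_nhdsWithin] with t ht
    exact EReal.coe_nonneg.2 (h0 t ht)
  have hs0 : 0 ≤ slopeInfty f := by
    refine ge_of_tendsto hs ?_
    filter_upwards [eventually_gt_atTop 0] with t ht
    exact EReal.coe_nonneg.2 (div_nonneg (h0 t ht) ht.le)
  have hzm : ((m * (1 - ε) : ℝ) : EReal) ≤ limZero f := by
    have hc : Tendsto (fun t : ℝ => m * (|t - 1| - ε)) (𝓝[>] 0) (𝓝 (m * (|0 - 1| - ε))) :=
      Tendsto.mono_left (ContinuousAt.tendsto (by fun_prop)) nhdsWithin_le_nhds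
    rw [zero_sub, abs_neg, abs_one] at hc
    refine le_of_tendsto_of_tendsto (EReal.tendsto_coe.2 hc) hz ?_
    filter_upwards [self_mem_nhdsWithin] with t ht
    exact EReal.coe_le_coe_iff.2 (hfm t ht)
  have hsm : (m : EReal) ≤ slopeInfty f := by
    have hc : Tendsto (fun t : ℝ => m - m * (1 + ε) * t⁻¹) atTop (𝓝 (m - m * (1 + ε) * 0)) :=
      tendsto_const_nhds.sub (tendsto_inv_atTop_zero.const_mul _)
    rw [mul_zero, sub_zero] at hc
    refine le_of_tendsto_of_tendsto (EReal.tendsto_coe.2 hc) hs ?_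
    filter_upwards [eventually_ge_atTop 1] with t ht
    have ht0 : 0 < t := by linarith
    rw [EReal.coe_le_coe_iff, le_div_iff₀ ht0]
    refine le_trans (le_of_eq ?_) (hfm t ht0)
    rw [abs_of_nonneg (by linarith)]
    field_simp
    ring
  set L₀ := (limZero f).toENNReal with hL₀
  set L := (slopeInfty f).toENNReal with hL
  have hL₀' : (L₀ : EReal) = limZero f := EReal.coe_toENNReal hz0
  have hL' : (L : EReal) = slopeInfty f := EReal.coe_toENNReal hs0
  have hc : cDiv f p q = nDiv f L₀ L p q :=
    cDiv_eq_nDiv (c := 0) H.1 H.2 H.3 H.4 (by simp) h0 (by simp [hL₀']) (by simp [hL'])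
  have hLm : ENNReal.ofReal m ≤ L := by
    rw [← EReal.coe_ennreal_le_coe_ennreal_iff, hL', EReal.coe_ennreal_ofReal, max_eq_left hm.le]
    exact hsm
  have hL₀m : ENNReal.ofReal m ≤ L₀ + ENNReal.ofReal (m * ε) := by
    have h2 : ENNReal.ofReal (m * (1 - ε)) ≤ L₀ := by
      rw [← EReal.coe_ennreal_le_coe_ennreal_iff, hL₀', EReal.coe_ennreal_ofReal,
        max_eq_left (mul_nonneg hm.le (by linarith))]
      exact hzm
    refine le_trans ?_ (add_le_add_left h2 _)
    refine le_trans (ENNReal.ofReal_le_ofReal ?_) ENNReal.ofReal_add_le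
    linarith
  have key : ENNReal.ofReal (m * v) ≤ nDiv f L₀ L p q + ENNReal.ofReal (m * ε) := by
    have e1 : ENNReal.ofReal (m * v) = ∑' ω, ENNReal.ofReal (m * |p ω - q ω|) := by
      rw [← ENNReal.ofReal_tsum_of_nonneg (fun _ => by positivity) (hv.mul_left m).summable,
        (hv.mul_left m).tsum_eq]
    have e2 : ENNReal.ofReal (m * ε) = ∑' ω, ENNReal.ofReal (m * ε * q ω) := by
      rw [← ENNReal.ofReal_tsum_of_nonneg (fun ω => mul_nonneg hmε.le (H.2 ω))
        (H.hasSum_right.mul_left _).summable, (H.hasSum_right.mul_left _).tsum_eq, mul_one]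
    rw [e1, e2, nDiv, ← ENNReal.tsum_add]
    refine ENNReal.tsum_le_tsum fun ω => ?_
    split_ifs with hq hp
    · rw [hq, sub_zero, abs_of_nonneg (H.1 ω), ENNReal.ofReal_mul hm.le, mul_zero,
        ENNReal.ofReal_zero, add_zero]
      gcongr
    · rw [hp, zero_sub, abs_neg, abs_of_nonneg (H.2 ω), ENNReal.ofReal_mul hm.le,
        ENNReal.ofReal_mul hmε.le, ← add_mul]
      gcongr
    · have hq' : 0 < q ω := lt_of_le_of_ne (H.2 ω) (Ne.symm hq)
      have hp' : 0 < p ω := lt_of_le_of_ne (H.1 ω) (Ne.symm hp)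
      refine le_trans (ENNReal.ofReal_le_ofReal ?_) ENNReal.ofReal_add_le
      have h2 := mul_le_mul_of_nonneg_left (hfm _ (div_pos hp' hq')) hq'.le
      have e3 : q ω * (m * (|p ω / q ω - 1| - ε)) = m * |p ω - q ω| - m * ε * q ω := by
        have e4 : |p ω - q ω| = q ω * |p ω / q ω - 1| := by
          rw [← abs_of_pos hq', ← abs_mul, abs_of_pos hq']
          congr 1
          field_simp
        rw [e4]
        ring
      linarith
  have hv0 : 0 ≤ v := hv.nonneg fun _ => abs_nonneg _
  have := EReal.coe_ennreal_le_coe_ennreal_iff.2 key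
  rw [EReal.coe_ennreal_add, EReal.coe_ennreal_ofReal, EReal.coe_ennreal_ofReal,
    max_eq_left (by positivity), max_eq_left hmε.le, ← hc] at this
  exact this

end StrictlyConvex

/-! ### Back to states -/

/-- Nussbaum-Szkoła distributions, bundled. -/
theorem exists_isPair {K : Type u} [NormedAddCommGroup K] [InnerProductSpace ℂ K]
    [CompleteSpace K] (ρ σ : State K) : ∃ (Ω : Type u) (p q : Ω → ℝ), IsPair p q ∧
      ∀ f, fDiv f ρ σ = cDiv f p q ∧ fDiv f σ ρ = cDiv f q p := by
  obtain ⟨Ω, p, q, h1, h2, h3, h4, h5⟩ := exists_classical ρ σ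
  exact ⟨Ω, p, q, ⟨h1, h2, h3, h4⟩, h5⟩

theorem exists_totalVar {K : Type u} [NormedAddCommGroup K] [InnerProductSpace ℂ K]
    [CompleteSpace K] (ρ σ : State K) : ∃ v : ℝ, totalVar ρ σ = (v : EReal) ∧ 0 ≤ v ∧ v ≤ 2 := by
  obtain ⟨Ω, p, q, H, hD⟩ := exists_isPair ρ σ
  obtain ⟨v, hv, hs⟩ := H.exists_tv
  exact ⟨v, (hD _).1.trans hv, hs.nonneg fun _ => abs_nonneg _, H.tv_le_two hs⟩

theorem exists_totalVar_bound {f : ℝ → ℝ} (hf : StrictConvexOn ℝ (Ioi 0) f)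
    (h0 : ∀ t, 0 < t → 0 ≤ f t) (h1 : f 1 = 0) {η : ℝ} (hη : 0 < η) :
    ∃ δ : ℝ, 0 < δ ∧ ∀ (K : Type u) [NormedAddCommGroup K] [InnerProductSpace ℂ K]
      [CompleteSpace K] (ρ σ : State K), fDiv f ρ σ ≤ (δ : EReal) →
        totalVar ρ σ ≤ (η : EReal) := by
  set ε := min (η / 2) (1 / 2) with hε
  have hε0 : 0 < ε := lt_min (by linarith) (by norm_num)
  have hε1 : ε < 1 := (min_le_right _ _).trans_lt (by norm_num)
  have hε2 : ε ≤ η / 2 := min_le_left _ _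
  obtain ⟨m, hm, hfm⟩ := exists_linear_lower_bound hf h0 h1 hε0 hε1
  -- With `D_f ≤ m ε` the bound becomes `V ≤ 2 ε ≤ η`. Both `m` and `ε` are fixed before the space
  -- and the states.
  refine ⟨m * ε, mul_pos hm hε0, fun K _ _ _ ρ σ hle => ?_⟩
  obtain ⟨Ω, p, q, H, hD⟩ := exists_isPair ρ σ
  obtain ⟨v, hv, hs⟩ := H.exists_tv
  have h2 := H.tv_le_cDiv hf.convexOn h0 h1 hm hε0 hε1 hfm hs
  rw [← (hD f).1] at h2
  have h3 := h2.trans (add_le_add_left hle _)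
  rw [← EReal.coe_add, EReal.coe_le_coe_iff] at h3
  rw [totalVar, (hD _).1, hv, EReal.coe_le_coe_iff]
  have h4 : v ≤ 2 * ε := le_of_mul_le_mul_left (by linarith : m * v ≤ m * (2 * ε)) hm
  linarith

end QuantumDiv

theorem mainTheorem5 :
    (∀ (K : Type u) [NormedAddCommGroup K] [InnerProductSpace ℂ K] [CompleteSpace K]
      (ρ σ : State K),
      -- finiteness and range of `V` and `H²`; `v` and `h` name their real values below
      ∃ v h : ℝ, (totalVar ρ σ = (v : EReal) ∧ 0 ≤ v ∧ v ≤ 2) ∧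
        (hellingerSq ρ σ = (h : EReal) ∧ 0 ≤ h ∧ h ≤ 1) ∧
      -- `H² ≤ V / 2 ≤ H √(2 - H²)`
      (h ≤ v / 2 ∧ v / 2 ≤ √h * √(2 - h)) ∧
      -- `D ≤ log (1 + χ²)`, to any base
      (∀ b : ℝ, 1 < b → umegakiBase b ρ σ ≤ extLog b (1 + chiSq ρ σ)) ∧
      -- `χ² ≤ (1 + (α - 1) H_α)^(1 / (α - 1)) - 1`
      (∀ α : ℝ, 2 < α → chiSq ρ σ ≤
        ((((1 + ((α - 1 : ℝ) : EReal) * hellingerAlpha α ρ σ).toENNReal ^ (1 / (α - 1)) : ENNReal)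
          : EReal) - 1)) ∧
      -- `χ²` against `V`
      (v ≤ 1 → ((v ^ 2 : ℝ) : EReal) ≤ chiSq ρ σ) ∧
      (1 < v → v < 2 → ((v / (2 - v) : ℝ) : EReal) ≤ chiSq ρ σ) ∧
      (v = 2 → chiSq ρ σ = ⊤) ∧
      -- `D`, `χ²` and `H²`
      (umegaki ρ σ ^ 2 / umegaki σ ρ ≤ ((1 / 2 : ℝ) : EReal) * chiSq ρ σ) ∧
      (((16 * h ^ 2 : ℝ) : EReal) ≤ umegaki ρ σ * umegaki σ ρ ∧
        umegaki ρ σ * umegaki σ ρ ≤ ((1 / 4 : ℝ) : EReal) * (chiSq ρ σ * chiSq σ ρ)) ∧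
      (((8 * h : ℝ) : EReal) ≤ umegaki ρ σ + umegaki σ ρ ∧
        umegaki ρ σ + umegaki σ ρ ≤ ((1 / 2 : ℝ) : EReal) * (chiSq ρ σ + chiSq σ ρ)) ∧
      -- `D ≤ (V + χ²) / 2`
      (umegaki ρ σ ≤ ((1 / 2 : ℝ) : EReal) * (totalVar ρ σ + chiSq ρ σ)) ∧
      -- symmetrized `D` and `χ²` against `V`
      (∀ b : ℝ, 1 < b →
        (v < 2 → ((v * Real.logb b ((2 + v) / (2 - v)) : ℝ) : EReal)
          ≤ umegakiBase b ρ σ + umegakiBase b σ ρ) ∧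
        (v = 2 → umegakiBase b ρ σ + umegakiBase b σ ρ = ⊤)) ∧
      (v < 2 → ((8 * v ^ 2 / (4 - v ^ 2) : ℝ) : EReal) ≤ chiSq ρ σ + chiSq σ ρ) ∧
      (v = 2 → chiSq ρ σ + chiSq σ ρ = ⊤) ∧
      -- Hellinger, Petz-Rényi and Umegaki
      (∀ α β : ℝ, 0 < α → α < 1 → 1 < β →
        hellingerAlpha α ρ σ ≤ petzRenyi α ρ σ ∧ petzRenyi α ρ σ ≤ umegaki ρ σ ∧
        umegaki ρ σ ≤ petzRenyi β ρ σ ∧ petzRenyi β ρ σ ≤ hellingerAlpha β ρ σ)) ∧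
    (∀ f : ℝ → ℝ, StrictConvexOn ℝ (Ioi 0) f → (∀ t, 0 < t → 0 ≤ f t) → f 1 = 0 →
      (∃ ψ : EReal → ℝ, Tendsto ψ (𝓝[>] 0) (𝓝 0) ∧
        ∀ (K : Type u) [NormedAddCommGroup K] [InnerProductSpace ℂ K] [CompleteSpace K]
          (ρ σ : State K), totalVar ρ σ ≤ (ψ (fDiv f ρ σ) : EReal)) ∧
      (∀ (K : Type u) [NormedAddCommGroup K] [InnerProductSpace ℂ K] [CompleteSpace K]
        (ρ σ : ℕ → State K), Tendsto (fun n => fDiv f (ρ n) (σ n)) atTop (𝓝 0) →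
          Tendsto (fun n => totalVar (ρ n) (σ n)) atTop (𝓝 0))) := by
  refine ⟨fun K _ _ _ ρ σ => ?_, fun f hf h0 h1 => ⟨?_, fun K _ _ _ ρ σ hlim => ?_⟩⟩
  · obtain ⟨Ω, p, q, H, hD⟩ := exists_isPair ρ σ
    obtain ⟨v, hv, hvs⟩ := H.exists_tv
    obtain ⟨h, hh, hhs⟩ := H.exists_hellinger
    have hle := H.hellinger_le hvs hhs
    have hv2 := H.tv_le_two hvs
    have hchi := H.tv_le_chi hvs
    have hsum := H.tv_le_chi_add_chi' hvs
    simp only [totalVar, hellingerSq, umegakiBase, umegaki, chiSq, hellingerAlpha, petzRenyi,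
      fun f => (hD f).1, fun f => (hD f).2]
    exact ⟨v, h, ⟨hv, hvs.nonneg fun _ => abs_nonneg _, hv2⟩,
      ⟨hh, hhs.nonneg fun _ => by positivity, by linarith⟩, ⟨hle, H.tv_le hvs hhs⟩,
      fun b hb => H.kl_le_extLog hb, fun α hα => H.chi_le_hellingerAlpha hα, fun _ => hchi.1,
      hchi.2.1, hchi.2.2, H.kl_sq_le, ⟨(H.hellinger_le_kl hhs).1, H.kl_mul_kl_le_chi⟩,
      ⟨(H.hellinger_le_kl hhs).2, H.kl_add_kl_le_chi⟩, H.kl_le_tv_add_chi,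
      fun b hb => H.tv_le_kl_add_kl hvs hb, hsum.1, hsum.2, fun α β h0 h1 h2 =>
      ⟨(H.renyi_chain_of_lt_one h0 h1).1, (H.renyi_chain_of_lt_one h0 h1).2,
        (H.renyi_chain_of_one_lt h2).1, (H.renyi_chain_of_one_lt h2).2⟩⟩
  -- The modulus `ψ x` is the supremum of `V` over all spaces and all states with `D_f ≤ x`. The
  -- bound `V ≤ 2` makes it finite, and an empty set gives the harmless value `0`.
  · let S : EReal → Set ℝ := fun x => {v | ∃ (K : Type u) (_ : NormedAddCommGroup K)
      (_ : InnerProductSpace ℂ K) (_ : CompleteSpace K) (ρ σ : State K),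
      totalVar ρ σ = (v : EReal) ∧ fDiv f ρ σ ≤ x}
    have hS : ∀ x, ∀ v ∈ S x, 0 ≤ v ∧ v ≤ 2 := by
      rintro x v ⟨K, _, _, _, ρ, σ, hv, -⟩
      obtain ⟨w, hw, hw0, hw2⟩ := exists_totalVar ρ σ
      rw [hw, EReal.coe_eq_coe_iff] at hv
      rw [← hv]
      exact ⟨hw0, hw2⟩
    refine ⟨fun x => sSup (S x), ?_, fun K _ _ _ ρ σ => ?_⟩
    · refine tendsto_order.2 ⟨fun a ha => Eventually.of_forall fun x =>
        ha.trans_le (Real.sSup_nonneg fun v hv => (hS x v hv).1), fun a ha => ?_⟩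
      obtain ⟨δ, hδ, hb⟩ := exists_totalVar_bound hf h0 h1 (half_pos ha)
      filter_upwards [mem_nhdsWithin_of_mem_nhds (Iio_mem_nhds (EReal.coe_pos.2 hδ))] with x hx
      refine (Real.sSup_le (fun v hv => ?_) (half_pos ha).le).trans_lt (half_lt_self ha)
      obtain ⟨K, _, _, _, ρ, σ, hv, hle⟩ := hv
      have := hb K ρ σ (hle.trans (le_of_lt hx))
      rwa [hv, EReal.coe_le_coe_iff] at this
    · obtain ⟨v, hv, -⟩ := exists_totalVar ρ σ
      rw [hv, EReal.coe_le_coe_iff]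
      exact le_csSup ⟨2, fun w hw => (hS _ w hw).2⟩ ⟨K, _, _, _, ρ, σ, hv, le_rfl⟩
  · refine tendsto_order.2 ⟨fun a ha => Eventually.of_forall fun n => ?_, fun a ha => ?_⟩
    · obtain ⟨v, hv, hv0, -⟩ := exists_totalVar (ρ n) (σ n)
      rw [hv]
      exact ha.trans_le (EReal.coe_nonneg.2 hv0)
    · obtain ⟨c, hc0, hca⟩ := EReal.lt_iff_exists_real_btwn.1 ha
      obtain ⟨δ, hδ, hb⟩ := exists_totalVar_bound hf h0 h1 (EReal.coe_pos.1 hc0)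
      filter_upwards [hlim (Iio_mem_nhds (EReal.coe_pos.2 hδ))] with n hn
      exact (hb K (ρ n) (σ n) (le_of_lt hn)).trans_lt hca
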